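/- There is an absolute constant $C>0$ such that the following holds. Let $T>0$, let $v_0\in L^2(\mathbb R^3;\mathbb C)$ and $w_0\in H^1(\mathbb R^3;\mathbb C)$, put $v(t)=e^{it\Delta}v_0$, and let $w\in C([0,T];H^1(\mathbb R^3;\mathbb C))$ be a solution, in the sense of distributions, of $$i\partial_t w+\Delta w=|v+w|^2(v+w)\quad\text{on }[0,T]\times\mathbb R^3,\qquad w(0)=w_0.$$ Then $$\|w\|_{L^4_{t,x}}^4\le C\Big(\|w\|_{L^\infty_tL^2_x}^2\,\|w\|_{L^\infty_t\dot H^{1/2}_x}^2+\|\nabla w\|_{L^\infty_tL^2_x}^2\,\|w\|_{L^\infty_tL^2_x}^4\,\|v\|_{L^2_tL^\infty_x}^2+\|v\|_{L^4_{t,x}}^4\Big),$$ where all space-time norms are taken over $[0,T]\times\mathbb R^3$, $\|f\|_{\dot H^{1/2}}=\||\nabla|^{1/2}f\|_{L^2}$, and the norms of $v$ on the right-hand side may be infinite (with $0\cdot\infty=0$). -/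

import Mathlib

open MeasureTheory Set Topology FourierTransform
open scoped ENNReal NNReal SchwartzMap LineDeriv Laplacian

noncomputable section

/-- The physical space `ℝ³`. -/
abbrev Space3 : Type := EuclideanSpace ℝ (Fin 3)

/-- The complex Hilbert space `L²(ℝ³; ℂ)`. -/
abbrev L2Space : Type := Lp (α := Space3) ℂ 2 volume

/-- The phase `e^{-i t |η|²}` of the free Schrödinger flow, at the angular frequency `η = 2πξ`.
(Mathlib's Fourier transform has the kernel `e^{-2πi x·ξ}`, so that `-Δ` has the symbol
`(2π|ξ|)²`.) -/
def schrodingerPhase (t : ℝ) (ξ : Space3) : ℂ :=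
  Complex.exp (((-(t * (2 * Real.pi * ‖ξ‖) ^ 2) : ℝ) : ℂ) * Complex.I)

theorem continuous_schrodingerPhase (t : ℝ) : Continuous (schrodingerPhase t) := by
  unfold schrodingerPhase
  fun_prop

theorem norm_schrodingerPhase (t : ℝ) (ξ : Space3) : ‖schrodingerPhase t ξ‖ = 1 :=
  Complex.norm_exp_ofReal_mul_I _

theorem memLp_schrodingerPhase_mul (t : ℝ) (f : L2Space) :
    MemLp (fun ξ => schrodingerPhase t ξ * f ξ) 2 volume := by
  refine (Lp.memLp f).of_le
    ((continuous_schrodingerPhase t).aestronglyMeasurable.mul (Lp.aestronglyMeasurable f)) ?_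
  filter_upwards with ξ
  rw [norm_mul, norm_schrodingerPhase, one_mul]

/-- The free Schrödinger evolution `e^{itΔ} f` of `f ∈ L²(ℝ³)`, a Fourier multiplier. -/
def freeSchrodinger (t : ℝ) (f : L2Space) : L2Space :=
  𝓕⁻ ((memLp_schrodingerPhase_mul t (𝓕 f)).toLp)

/-- `g = (g₁, g₂, g₃) ∈ L²` is the gradient of `f ∈ L²`, in the sense of tempered
distributions. -/
def IsGradient (f : L2Space) (g : Fin 3 → L2Space) : Prop :=
  ∀ j : Fin 3, ∂_{(EuclideanSpace.single j 1 : Space3)} (f : 𝓢'(Space3, ℂ)) =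
    (g j : 𝓢'(Space3, ℂ))

/-- `‖∇f‖_{L²}`, with the value `∞` if the distributional gradient of `f` is not in `L²`.
(The gradient is unique if it exists, so the infimum runs over at most one element.) -/
def gradNorm (f : L2Space) : ℝ≥0∞ :=
  ⨅ (g : Fin 3 → L2Space) (_ : IsGradient f g), (∑ j, ‖g j‖ₑ ^ 2) ^ (1 / 2 : ℝ)

/-- `‖f‖_{Ḣ^s} = ‖|∇|^s f‖_{L²}`, where `|∇|^s` is the Fourier multiplier with symbol
`(2π|ξ|)^s`; it has the value `∞` if `f` is not in `Ḣ^s`. -/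
def homSobolevNorm (s : ℝ) (f : L2Space) : ℝ≥0∞ :=
  eLpNorm (fun ξ : Space3 => (((2 * Real.pi * ‖ξ‖) ^ s : ℝ) : ℂ) * (𝓕 f : L2Space) ξ) 2 volume

/-- `w ∈ C([0,T]; H¹)`: both `w` and `∇w` are continuous on `[0,T]` with values in `L²`. -/
def ContinuousInH1 (T : ℝ) (w : ℝ → L2Space) : Prop :=
  ContinuousOn w (Icc 0 T) ∧
    ∃ Dw : ℝ → Fin 3 → L2Space, ContinuousOn Dw (Icc 0 T) ∧
      ∀ t ∈ Icc 0 T, IsGradient (w t) (Dw t)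

/-- `‖g‖_{L^q_t([0,T])}` of a function `g` with values in `[0,∞]` (the essential supremum
if `q = ∞`). -/
def timeNorm (q : ℝ≥0∞) (T : ℝ) (g : ℝ → ℝ≥0∞) : ℝ≥0∞ :=
  eLpNorm g q (volume.restrict (Icc 0 T))

/-- The mixed norm `‖u‖_{L^q_t L^r_x([0,T] × ℝ³)}`. -/
def mixedNorm (q r : ℝ≥0∞) (T : ℝ) (u : ℝ → L2Space) : ℝ≥0∞ :=
  timeNorm q T (fun t => eLpNorm (u t) r volume)

/-- `w ∈ C([0,T]; H¹)` is a solution of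
`i ∂ₜ w + Δ w = |u|² u`, `w(0) = w₀`, where `u = v + w` and `v(t) = e^{itΔ} v₀`.
The equation holds in the sense of distributions, integrated in time:
for every Schwartz function `φ` on `ℝ³` and every `t ∈ [0,T]`,
`i (⟨w(t), φ⟩ - ⟨w₀, φ⟩) + ∫₀ᵗ ⟨w(s), Δφ⟩ ds = ∫₀ᵗ ⟨|u(s)|² u(s), φ⟩ ds`,
and the right-hand side is an absolutely convergent integral. -/
structure IsPerturbedNLSSolution (T : ℝ) (v₀ w₀ : L2Space) (w : ℝ → L2Space) : Prop where
  continuous_H1 : ContinuousInH1 T w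
  initial : w 0 = w₀
  nonlinearity_integrable : ∀ φ : 𝓢(Space3, ℂ),
    ∫⁻ s in Icc 0 T, ∫⁻ x, ‖(freeSchrodinger s v₀ + w s) x‖ₑ ^ 3 * ‖φ x‖ₑ < ∞
  equation : ∀ φ : 𝓢(Space3, ℂ), ∀ t ∈ Icc 0 T,
    Complex.I * ((∫ x, w t x * φ x) - ∫ x, w₀ x * φ x) +
        ∫ s in (0 : ℝ)..t, ∫ x, w s x * (Δ φ) x =
      ∫ s in (0 : ℝ)..t, ∫ x,
        ((‖(freeSchrodinger s v₀ + w s) x‖ ^ 2 : ℝ) : ℂ) * (freeSchrodinger s v₀ + w s) x * φ x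

end

noncomputable section

/-! ### Dominated convergence in `L²` -/

/-! This is the interaction Morawetz estimate for a perturbed defocusing cubic equation. With `a(z)
= √(|z|² + δ²)`, consider the action `M(t) = ∬ |w(y)|² ∇a(x - y) · Im(conj w ∇w)(x) dx dy`. Its
derivative along `∂ₜ w = h` is linear in `h` and, after an integration by parts, contains no
derivative of `h`; this expression is `morawetzDeriv`. For `h = iΔw - i|v+w|²(v+w)` it splits into
three pieces.

Free part. The virial identity and the continuity equation produce a Hessian term, nonnegative by a
Cauchy-Schwarz inequality for pairs of points (`interaction_form_nonneg`), and half the form with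
kernel `-Δ²a = 15δ⁴(|z|² + δ²)^{-7/2}` (`morawetzDeriv_free_ge`). This kernel dominates the
normalized indicator of the ball of radius `δ`, so Lebesgue differentiation and Fatou recover
`‖w‖₄⁴` as `δ → 0` (`lintegral_sq_le_liminf_convForm`).

Cubic part `-i|w|²w`. It contributes with a favourable sign, because `a` is convex and the potential
energy density is at most `|w|⁴` (`morawetzDeriv_cubic_nonneg`). The inequality is proved for a
Lipschitz truncation and passed to the limit.

Remainder `F = |v+w|²(v+w) - |w|²w`. Hardy's inequality gives `|morawetzDeriv| ≤ 30 ‖w‖₂² D ‖F‖₂`,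
where `D` bounds the components of `∇w` (`abs_morawetzDeriv_le`), and `‖F‖₂ ≤ 5‖v‖_∞(‖w‖₄² +
‖v‖₄²)`. Young's inequality makes the `‖w‖₄⁴` part absorbable.

The action itself is at most `72 ‖w‖₂² ‖w‖²_{Ḣ^{1/2}}`, by a dyadic frequency decomposition in which
the derivative is always moved to the low-frequency factor (`abs_radialCurrent_le_half`).

Since `w` is only in `H¹`, the differential inequality is proved for smooth frequency localizations,
which solve the equation strongly in `L²`, and only the integrated inequality is passed to the limit
(`interaction_morawetz`). Sobolev embedding enters only qualitatively: it makes `|w|²w` an `L²`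
function and the absorbed quantity finite. All quantitative bounds are uniform in `δ`. -/

theorem norm_sq_eq_integral_norm_sq (f : L2Space) : ‖f‖ ^ 2 = ∫ x, ‖f x‖ ^ 2 := by
  have h := L2.integral_inner_eq_sq_eLpNorm (𝕜 := ℂ) f
  have h2 := L2.inner_def (𝕜 := ℂ) f f
  rw [inner_self_eq_norm_sq_to_K] at h2
  have h3 : ((‖f‖ ^ 2 : ℝ) : ℂ) = ((∫ x, ‖f x‖ ^ 2 : ℝ) : ℂ) := by
    rw [← integral_complex_ofReal]
    simpa [inner_self_eq_norm_sq_to_K] using h2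
  exact_mod_cast h3

theorem integrable_norm_sq (f : L2Space) : Integrable (fun x => ‖f x‖ ^ 2) := by
  simpa using (Lp.memLp f).integrable_norm_pow (by norm_num)

/-- The limit inherits the bound `b`, so `‖F n - f‖²` is dominated by `4 b²`. This converts
pointwise convergence of symbols or of truncated nonlinearities into `L²` convergence. -/
theorem tendsto_L2_of_dominated {F : ℕ → L2Space} {f : L2Space} {b : Space3 → ℝ}
    (hb : Integrable (fun x => b x ^ 2)) (hF : ∀ n, ∀ᵐ x, ‖F n x‖ ≤ b x)
    (hlim : ∀ᵐ x, Filter.Tendsto (fun n => F n x) Filter.atTop (𝓝 (f x))) :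
    Filter.Tendsto F Filter.atTop (𝓝 f) := by
  rw [tendsto_iff_norm_sub_tendsto_zero]
  have hF' : ∀ᵐ x, ∀ n, ‖F n x‖ ≤ b x := ae_all_iff.2 hF
  have key : Filter.Tendsto (fun n => ∫ x, ‖F n x - f x‖ ^ 2) Filter.atTop
      (𝓝 (∫ _ : Space3, (0 : ℝ))) := by
    refine tendsto_integral_of_dominated_convergence (fun x => 4 * b x ^ 2) ?_ (hb.const_mul 4) ?_ ?_
    · intro n
      exact (((Lp.aestronglyMeasurable (F n)).sub (Lp.aestronglyMeasurable f)).norm.pow 2)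
    · intro n
      filter_upwards [hF', hlim] with x hx hl
      have h1 : ‖f x‖ ≤ b x := le_of_tendsto hl.norm (Filter.Eventually.of_forall hx)
      have h2 : ‖F n x - f x‖ ≤ 2 * b x := (norm_sub_le _ _).trans (by linarith [hx n])
      rw [Real.norm_of_nonneg (by positivity)]
      nlinarith [norm_nonneg (F n x - f x)]
    · filter_upwards [hlim] with x hl
      have := ((hl.sub_const (f x)).norm).pow 2
      simpa using this
  have h2 : ∀ n, ‖F n - f‖ = √(∫ x, ‖F n x - f x‖ ^ 2) := by
    intro n
    rw [← Real.sqrt_sq (norm_nonneg (F n - f)), norm_sq_eq_integral_norm_sq]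
    congr 1
    refine integral_congr_ae ?_
    filter_upwards [Lp.coeFn_sub (F n) f] with x hx
    rw [hx]; rfl
  simp_rw [h2]
  have := (Real.continuous_sqrt.tendsto _).comp key
  simpa [Function.comp_def] using this

/-! ### Products of `L²` functions and bilinear convolution forms -/

/-- The real part of `conj f * g`, as a bilinear map from `L²` to `L¹`. -/
def innerL1 : L2Space →L[ℝ] L2Space →L[ℝ] Lp (α := Space3) ℝ 1 volume :=
  (innerSL ℝ (E := ℂ)).holderL volume 2 2 1

theorem coeFn_innerL1 (f g : L2Space) :
    innerL1 f g =ᵐ[volume] fun x => inner ℝ (f x) (g x) :=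
  ContinuousLinearMap.coeFn_holder (innerSL ℝ (E := ℂ)) f g

theorem norm_innerL1_le (f g : L2Space) : ‖innerL1 f g‖ ≤ ‖f‖ * ‖g‖ := by
  have := ContinuousLinearMap.norm_holder_apply_apply_le (r := 1) (innerSL ℝ (E := ℂ)) f g
  refine this.trans ?_
  have h1 : ‖innerSL ℝ (E := ℂ)‖ ≤ 1 := norm_innerSL_le ℝ
  have : 0 ≤ ‖f‖ * ‖g‖ := by positivity
  nlinarith

theorem innerL1_comm (f g : L2Space) : innerL1 f g = innerL1 g f := by
  refine Lp.ext ?_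
  filter_upwards [coeFn_innerL1 f g, coeFn_innerL1 g f] with x h1 h2
  rw [h1, h2, real_inner_comm]

theorem inner_I_mul_left (z w : ℂ) :
    inner ℝ (Complex.I * z) w = -inner ℝ z (Complex.I * w) := by
  simp [Complex.inner]; ring

theorem innerL1_I_smul_left (f g : L2Space) :
    innerL1 (Complex.I • f) g = -innerL1 f (Complex.I • g) := by
  refine Lp.ext ?_
  filter_upwards [coeFn_innerL1 (Complex.I • f) g, coeFn_innerL1 f (Complex.I • g),
    Lp.coeFn_smul Complex.I f, Lp.coeFn_smul Complex.I g,
    Lp.coeFn_neg (innerL1 f (Complex.I • g))] with x h1 h2 h3 h4 h5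
  rw [h1, h5, Pi.neg_apply, h2, h3, h4, Pi.smul_apply, Pi.smul_apply, smul_eq_mul, smul_eq_mul,
    inner_I_mul_left]

theorem innerL1_I_smul_I_smul (f g : L2Space) :
    innerL1 (Complex.I • f) (Complex.I • g) = innerL1 f g := by
  rw [innerL1_I_smul_left, smul_smul, Complex.I_mul_I, neg_one_smul, map_neg, neg_neg]

/-- Antisymmetry of `Re(conj(i f) g)` makes the density equal to its own negative. It removes the
undifferentiated-weight term in the mass flux. -/
theorem innerL1_I_smul_self (f : L2Space) : innerL1 (Complex.I • f) f = 0 := by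
  have h := innerL1_I_smul_left f f
  rw [innerL1_comm f (Complex.I • f)] at h
  have h2 : (2 : ℝ) • innerL1 (Complex.I • f) f = 0 := by
    rw [two_smul, add_eq_zero_iff_eq_neg]; exact h
  simpa using h2

/-! ### Integration of `L¹` densities against bounded kernels -/

theorem integrable_bcf_mul {W : BoundedContinuousFunction Space3 ℝ} {q : Space3 → ℝ}
    (hq : Integrable q) : Integrable (fun x => W x * q x) :=
  hq.bdd_mul W.continuous.aestronglyMeasurable (Filter.Eventually.of_forall fun x => W.norm_coe_le_norm x)

theorem abs_integral_bcf_mul_le {W : BoundedContinuousFunction Space3 ℝ} (q : Lp (α := Space3) ℝ 1 volume) :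
    |∫ x, W x * q x| ≤ ‖W‖ * ‖q‖ := by
  rw [L1.norm_eq_integral_norm, ← integral_const_mul]
  refine (norm_integral_le_integral_norm (fun x => W x * q x)).trans ?_
  have hq := L1.integrable_coeFn q
  refine integral_mono (integrable_bcf_mul hq).norm (hq.norm.const_mul _) fun x => ?_
  simp only [norm_mul]
  gcongr
  exact W.norm_coe_le_norm x

/-- The translate `x ↦ k (x - y)`. -/
def BoundedContinuousFunction.translate (k : BoundedContinuousFunction Space3 ℝ) (y : Space3) :
    BoundedContinuousFunction Space3 ℝ :=
  k.compContinuous ⟨fun x => x - y, by fun_prop⟩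

theorem BoundedContinuousFunction.translate_apply (k : BoundedContinuousFunction Space3 ℝ)
    (y x : Space3) : k.translate y x = k (x - y) := rfl

theorem BoundedContinuousFunction.norm_translate_le (k : BoundedContinuousFunction Space3 ℝ)
    (y : Space3) : ‖k.translate y‖ ≤ ‖k‖ :=
  (BoundedContinuousFunction.norm_le (norm_nonneg _)).2 fun _ => k.norm_coe_le_norm _

/-- The integral `∫ k (x - y) q x dx` as a functional of `q ∈ L¹`. -/
def potential (k : BoundedContinuousFunction Space3 ℝ) (y : Space3) :
    Lp (α := Space3) ℝ 1 volume →L[ℝ] ℝ :=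
  LinearMap.mkContinuous
    { toFun := fun q => ∫ x, k.translate y x * q x
      map_add' := fun p q => by
        rw [← integral_add (integrable_bcf_mul (L1.integrable_coeFn p))
          (integrable_bcf_mul (L1.integrable_coeFn q))]
        refine integral_congr_ae ?_
        filter_upwards [Lp.coeFn_add p q] with x hx
        rw [hx, Pi.add_apply, mul_add]
      map_smul' := fun c q => by
        rw [RingHom.id_apply, smul_eq_mul, ← integral_const_mul]
        refine integral_congr_ae ?_
        filter_upwards [Lp.coeFn_smul c q] with x hx
        rw [hx, Pi.smul_apply, smul_eq_mul]; ring }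
    ‖k‖ fun q => (abs_integral_bcf_mul_le q).trans
      (mul_le_mul_of_nonneg_right (k.norm_translate_le y) (norm_nonneg _))

theorem potential_apply (k : BoundedContinuousFunction Space3 ℝ) (y : Space3)
    (q : Lp (α := Space3) ℝ 1 volume) : potential k y q = ∫ x, k (x - y) * q x := rfl

theorem abs_potential_le (k : BoundedContinuousFunction Space3 ℝ) (y : Space3)
    (q : Lp (α := Space3) ℝ 1 volume) : |potential k y q| ≤ ‖k‖ * ‖q‖ :=
  (abs_integral_bcf_mul_le q).trans
      (mul_le_mul_of_nonneg_right (k.norm_translate_le y) (norm_nonneg _))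

theorem continuous_potential (k : BoundedContinuousFunction Space3 ℝ)
    (q : Lp (α := Space3) ℝ 1 volume) : Continuous fun y => potential k y q := by
  have hq := L1.integrable_coeFn q
  simp only [potential_apply]
  refine continuous_of_dominated (bound := fun x => ‖k‖ * ‖q x‖) ?_ ?_ (hq.norm.const_mul _) ?_
  · intro y
    exact (integrable_bcf_mul (W := k.translate y) hq).aestronglyMeasurable
  · intro y
    refine Filter.Eventually.of_forall fun x => ?_
    rw [norm_mul]
    gcongr
    exact k.norm_coe_le_norm _
  · exact Filter.Eventually.of_forall fun x => by fun_prop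

theorem integrable_mul_potential (k : BoundedContinuousFunction Space3 ℝ)
    (p q : Lp (α := Space3) ℝ 1 volume) : Integrable fun y => p y * potential k y q :=
  (L1.integrable_coeFn p).mul_bdd (c := ‖k‖ * ‖q‖) (continuous_potential k q).aestronglyMeasurable
    (Filter.Eventually.of_forall fun y => abs_potential_le k y q)

theorem abs_integral_mul_potential_le {k : BoundedContinuousFunction Space3 ℝ}
    {p q : Lp (α := Space3) ℝ 1 volume} {K : ℝ} (hK : ∀ y, |potential k y q| ≤ K) :
    |∫ y, p y * potential k y q| ≤ K * ‖p‖ := by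
  rw [L1.norm_eq_integral_norm, ← integral_const_mul]
  refine (norm_integral_le_integral_norm (fun y => p y * potential k y q)).trans ?_
  refine integral_mono (integrable_mul_potential k p q).norm
    ((L1.integrable_coeFn p).norm.const_mul _) fun y => ?_
  simp only [norm_mul]
  rw [mul_comm]
  gcongr
  exact hK y

/-- The bilinear form `∫∫ p y * k (x - y) * q x dx dy` on `L¹`. -/
def convForm (k : BoundedContinuousFunction Space3 ℝ) :
    Lp (α := Space3) ℝ 1 volume →L[ℝ] Lp (α := Space3) ℝ 1 volume →L[ℝ] ℝ :=
  LinearMap.mkContinuous₂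
    (LinearMap.mk₂ ℝ (fun p q => ∫ y, p y * potential k y q)
      (fun p p' q => by
        rw [← integral_add (integrable_mul_potential k p q) (integrable_mul_potential k p' q)]
        refine integral_congr_ae ?_
        filter_upwards [Lp.coeFn_add p p'] with x hx
        rw [hx, Pi.add_apply, add_mul])
      (fun c p q => by
        rw [smul_eq_mul, ← integral_const_mul]
        refine integral_congr_ae ?_
        filter_upwards [Lp.coeFn_smul c p] with x hx
        rw [hx, Pi.smul_apply, smul_eq_mul]; ring)
      (fun p q q' => by
        rw [← integral_add (integrable_mul_potential k p q) (integrable_mul_potential k p q')]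
        simp only [map_add, mul_add])
      (fun c p q => by
        rw [smul_eq_mul, ← integral_const_mul]
        refine integral_congr_ae (Filter.Eventually.of_forall fun x => ?_)
        simp only [map_smul, smul_eq_mul]; ring))
    ‖k‖ fun p q => by
      simp only [LinearMap.mk₂_apply]
      have := abs_integral_mul_potential_le (p := p) (fun y => abs_potential_le k y q)
      rw [Real.norm_eq_abs]
      linarith

theorem convForm_apply (k : BoundedContinuousFunction Space3 ℝ)
    (p q : Lp (α := Space3) ℝ 1 volume) : convForm k p q = ∫ y, p y * potential k y q := rfl

theorem abs_convForm_le_of_potential_le {k : BoundedContinuousFunction Space3 ℝ}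
    {p q : Lp (α := Space3) ℝ 1 volume} {K : ℝ} (hK : ∀ y, |potential k y q| ≤ K) :
    |convForm k p q| ≤ K * ‖p‖ :=
  abs_integral_mul_potential_le hK

theorem abs_convForm_le (k : BoundedContinuousFunction Space3 ℝ)
    (p q : Lp (α := Space3) ℝ 1 volume) : |convForm k p q| ≤ ‖k‖ * ‖p‖ * ‖q‖ := by
  have := abs_convForm_le_of_potential_le (p := p) (fun y => abs_potential_le k y q)
  linarith

/-- Absolute integrability on the product justifies Fubini, needed both for exchanging the two
particles and for using inequalities that hold only pointwise in the pair `(y, x)`. -/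
theorem integrable_prod_convForm (k : BoundedContinuousFunction Space3 ℝ)
    (p q : Lp (α := Space3) ℝ 1 volume) :
    Integrable (fun z : Space3 × Space3 => p z.1 * (k (z.2 - z.1) * q z.2)) := by
  have h := (L1.integrable_coeFn p).mul_prod (L1.integrable_coeFn q)
  have h2 := h.bdd_mul (c := ‖k‖) (f := fun z : Space3 × Space3 => k (z.2 - z.1))
    (by have := k.continuous; exact (by fun_prop : Continuous _).aestronglyMeasurable)
    (Filter.Eventually.of_forall fun z => k.norm_coe_le_norm _)
  refine h2.congr (Filter.Eventually.of_forall fun z => ?_)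
  simp only []; ring

theorem convForm_eq_integral_prod (k : BoundedContinuousFunction Space3 ℝ)
    (p q : Lp (α := Space3) ℝ 1 volume) :
    convForm k p q = ∫ z : Space3 × Space3, p z.1 * (k (z.2 - z.1) * q z.2) := by
  rw [Measure.volume_eq_prod, integral_prod _ (integrable_prod_convForm k p q), convForm_apply]
  simp only [potential_apply, integral_const_mul]

/-- The reflected kernel `z ↦ k (-z)`. -/
def BoundedContinuousFunction.reflect (k : BoundedContinuousFunction Space3 ℝ) :
    BoundedContinuousFunction Space3 ℝ :=
  k.compContinuous ⟨fun x => -x, by fun_prop⟩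

theorem BoundedContinuousFunction.reflect_apply (k : BoundedContinuousFunction Space3 ℝ)
    (x : Space3) : k.reflect x = k (-x) := rfl

/-- Fubini and the exchange of `x` and `y`. Even kernels thus give symmetric forms, while the odd
radial field picks up a sign. -/
theorem convForm_swap (k : BoundedContinuousFunction Space3 ℝ)
    (p q : Lp (α := Space3) ℝ 1 volume) : convForm k p q = convForm k.reflect q p := by
  rw [convForm_eq_integral_prod, convForm_eq_integral_prod, Measure.volume_eq_prod,
    ← integral_prod_swap]
  refine integral_congr_ae (Filter.Eventually.of_forall fun z => ?_)
  simp only [Prod.fst_swap, Prod.snd_swap, BoundedContinuousFunction.reflect_apply, neg_sub]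
  ring

theorem Continuous.innerL1 {A : Type*} [TopologicalSpace A] {u v : A → L2Space}
    (hu : Continuous u) (hv : Continuous v) : Continuous fun a => innerL1 (u a) (v a) :=
  (_root_.innerL1.continuous.comp hu).clm_apply hv

theorem Continuous.potential {A : Type*} [TopologicalSpace A]
    {u : A → Lp (α := Space3) ℝ 1 volume} (hu : Continuous u)
    (k : BoundedContinuousFunction Space3 ℝ) (y : Space3) :
    Continuous fun a => potential k y (u a) :=
  (_root_.potential k y).continuous.comp hu

theorem Continuous.convForm {A : Type*} [TopologicalSpace A]
    {u v : A → Lp (α := Space3) ℝ 1 volume} (hu : Continuous u) (hv : Continuous v)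
    (k : BoundedContinuousFunction Space3 ℝ) : Continuous fun a => convForm k (u a) (v a) :=
  ((_root_.convForm k).continuous.comp hu).clm_apply hv

attribute [irreducible] innerL1 potential convForm

/-! ### Fourier multipliers on `L²` -/

/-- The `j`-th standard basis vector of `ℝ³`. -/
abbrev basisVec (j : Fin 3) : Space3 := EuclideanSpace.single j 1

theorem inner_basisVec (x : Space3) (j : Fin 3) : inner ℝ x (basisVec j) = x j := by
  simp [basisVec, EuclideanSpace.inner_single_right]

/-- Multiplication by a bounded function, as an operator on `L²`. -/
def mulLinf (m : Lp (α := Space3) ℂ ∞ volume) : L2Space →L[ℂ] L2Space :=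
  (ContinuousLinearMap.mul ℂ ℂ).holderL volume ∞ 2 2 m

theorem coeFn_mulLinf (m : Lp (α := Space3) ℂ ∞ volume) (f : L2Space) :
    mulLinf m f =ᵐ[volume] fun x => m x * f x :=
  ContinuousLinearMap.coeFn_holder (ContinuousLinearMap.mul ℂ ℂ) m f

/-- The Fourier multiplier with the bounded symbol `m`. -/
def fourierMul (m : Lp (α := Space3) ℂ ∞ volume) : L2Space →L[ℂ] L2Space :=
  (FourierTransform.fourierInvCLM ℂ L2Space).comp
    ((mulLinf m).comp (FourierTransform.fourierCLM ℂ L2Space))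

theorem fourierMul_apply (m : Lp (α := Space3) ℂ ∞ volume) (f : L2Space) :
    fourierMul m f = 𝓕⁻ (mulLinf m (𝓕 f)) := rfl

theorem fourier_fourierMul (m : Lp (α := Space3) ℂ ∞ volume) (f : L2Space) :
    𝓕 (fourierMul m f) = mulLinf m (𝓕 f) := by
  rw [fourierMul_apply, FourierTransform.fourier_fourierInv_eq]

theorem coeFn_fourier_fourierMul (m : Lp (α := Space3) ℂ ∞ volume) (f : L2Space) :
    (𝓕 (fourierMul m f) : L2Space) =ᵐ[volume] fun ξ => m ξ * (𝓕 f : L2Space) ξ := by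
  rw [fourier_fourierMul]; exact coeFn_mulLinf m _

theorem toTemperedDistribution_injective {f g : L2Space}
    (h : (f : 𝓢'(Space3, ℂ)) = (g : 𝓢'(Space3, ℂ))) : f = g := by
  have hk := Lp.ker_toTemperedDistributionCLM_eq_bot (E := Space3) (F := ℂ) (μ := volume) (p := 2)
  exact LinearMap.ker_eq_bot.1 hk (by simpa using h)

theorem L2_ext_of_integral_schwartz {f g : L2Space}
    (h : ∀ ψ : 𝓢(Space3, ℂ), ∫ x, ψ x * f x = ∫ x, ψ x * g x) : f = g := by
  apply toTemperedDistribution_injective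
  ext ψ
  simpa [Lp.toTemperedDistribution_apply] using h ψ

/-- The symbol `2πi ξ_j` of `∂_j`. -/
def gradSymbol (j : Fin 3) (ξ : Space3) : ℂ := (2 * Real.pi * Complex.I) * ((ξ j : ℝ) : ℂ)

theorem hasTemperateGrowth_gradSymbol (j : Fin 3) : (gradSymbol j).HasTemperateGrowth := by
  have h : gradSymbol j = fun ξ => (2 * Real.pi * Complex.I) * ((inner ℝ ξ (basisVec j) : ℝ) : ℂ) := by
    funext ξ; rw [inner_basisVec]; rfl
  rw [h]; fun_prop

theorem continuous_gradSymbol (j : Fin 3) : Continuous (gradSymbol j) := by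
  unfold gradSymbol; fun_prop

theorem norm_gradSymbol (j : Fin 3) (ξ : Space3) : ‖gradSymbol j ξ‖ = 2 * Real.pi * |ξ j| := by
  simp [gradSymbol, abs_of_pos Real.pi_pos]

theorem sum_norm_gradSymbol_sq (ξ : Space3) :
    ∑ j, ‖gradSymbol j ξ‖ ^ 2 = (2 * Real.pi * ‖ξ‖) ^ 2 := by
  simp only [norm_gradSymbol, mul_pow, sq_abs, EuclideanSpace.norm_sq_eq, Real.norm_eq_abs,
    Finset.mul_sum]

theorem fourier_toTemperedDistribution_lineDeriv (f : L2Space) (j : Fin 3) (φ : 𝓢(Space3, ℂ)) :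
    𝓕 (∂_{basisVec j} (f : 𝓢'(Space3, ℂ))) φ
      = ∫ ξ, φ ξ * (gradSymbol j ξ * (𝓕 f : L2Space) ξ) := by
  rw [TemperedDistribution.fourier_lineDerivOp_eq, Lp.fourier_toTemperedDistribution_eq]
  simp only [smul_apply, TemperedDistribution.smulLeftCLM_apply_apply,
    Lp.toTemperedDistribution_apply, smul_eq_mul]
  rw [← integral_const_mul]
  refine integral_congr_ae (Filter.Eventually.of_forall fun ξ => ?_)
  simp only []
  rw [SchwartzMap.smulLeftCLM_apply_apply (by fun_prop), inner_basisVec, gradSymbol, smul_eq_mul]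
  ring

/-- Differentiation becomes multiplication by a symbol, so sums, multipliers and uniqueness of
gradients reduce to almost-everywhere algebra in frequency. -/
theorem isGradient_iff_fourier {f : L2Space} {g : Fin 3 → L2Space} :
    IsGradient f g ↔ ∀ j, (𝓕 (g j) : L2Space) =ᵐ[volume] fun ξ => gradSymbol j ξ * (𝓕 f : L2Space) ξ := by
  refine forall_congr' fun j => ?_
  have hinj : ∀ a b : 𝓢'(Space3, ℂ), a = b ↔ 𝓕 a = 𝓕 b := fun a b =>
    ⟨fun h => h ▸ rfl, fun h => by
      have h2 := congrArg (fun c : 𝓢'(Space3, ℂ) => (𝓕⁻ c : 𝓢'(Space3, ℂ))) h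
      simpa only [FourierTransform.fourierInv_fourier_eq] using h2⟩
  rw [hinj, Lp.fourier_toTemperedDistribution_eq]
  constructor
  · intro h
    have hloc : LocallyIntegrable (fun ξ => gradSymbol j ξ * (𝓕 f : L2Space) ξ) volume :=
      ((Lp.memLp (𝓕 f : L2Space)).locallyIntegrable (by norm_num)).continuous_mul
        (continuous_gradSymbol j)
    -- The symbol is unbounded, so the product is only known to be locally integrable; compactly
    -- supported smooth tests suffice, and they are Schwartz functions.
    refine ae_eq_of_integral_contDiff_smul_eq
      ((Lp.memLp (𝓕 (g j) : L2Space)).locallyIntegrable (by norm_num)) hloc ?_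
    intro φ hφ hc
    have hg₁ : HasCompactSupport (Complex.ofRealCLM ∘ φ) := hc.comp_left rfl
    have hg₂ : ContDiff ℝ (⊤ : ℕ∞) (Complex.ofRealCLM ∘ φ) := Complex.ofRealCLM.contDiff.comp hφ
    have h2 := congrArg (fun d : 𝓢'(Space3, ℂ) => d (hg₁.toSchwartzMap hg₂)) h
    simp only [fourier_toTemperedDistribution_lineDeriv, Lp.toTemperedDistribution_apply] at h2
    simpa using h2.symm
  · intro h
    ext φ
    rw [fourier_toTemperedDistribution_lineDeriv, Lp.toTemperedDistribution_apply]
    refine integral_congr_ae ?_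
    filter_upwards [h] with ξ hξ
    rw [hξ, smul_eq_mul]

theorem IsGradient.unique {f : L2Space} {g g' : Fin 3 → L2Space} (h : IsGradient f g)
    (h' : IsGradient f g') : g = g' :=
  funext fun j => toTemperedDistribution_injective ((h j).symm.trans (h' j))

theorem IsGradient.fourierMul {f : L2Space} {g : Fin 3 → L2Space} (h : IsGradient f g)
    (m : Lp (α := Space3) ℂ ∞ volume) :
    IsGradient (fourierMul m f) (fun j => fourierMul m (g j)) := by
  rw [isGradient_iff_fourier] at h ⊢
  intro j
  filter_upwards [h j, coeFn_fourier_fourierMul m f, coeFn_fourier_fourierMul m (g j)] with ξ h1 h2 h3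
  rw [h2, h3, h1]; ring

theorem IsGradient.add {f f' : L2Space} {g g' : Fin 3 → L2Space} (h : IsGradient f g)
    (h' : IsGradient f' g') : IsGradient (f + f') (g + g') := by
  rw [isGradient_iff_fourier] at h h' ⊢
  intro j
  rw [Pi.add_apply, FourierTransform.fourier_add, FourierTransform.fourier_add]
  filter_upwards [h j, h' j, Lp.coeFn_add (𝓕 f) (𝓕 f'), Lp.coeFn_add (𝓕 (g j)) (𝓕 (g' j))]
    with ξ h1 h2 h3 h4
  rw [h3, h4, Pi.add_apply, Pi.add_apply, h1, h2]; ring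

theorem IsGradient.smul {f : L2Space} {g : Fin 3 → L2Space} (h : IsGradient f g) (a : ℂ) :
    IsGradient (a • f) (a • g) := by
  rw [isGradient_iff_fourier] at h ⊢
  intro j
  rw [Pi.smul_apply, FourierTransform.fourier_smul, FourierTransform.fourier_smul]
  filter_upwards [h j, Lp.coeFn_smul a (𝓕 f), Lp.coeFn_smul a (𝓕 (g j))] with ξ h1 h2 h3
  rw [h2, h3, Pi.smul_apply, Pi.smul_apply, h1]; simp only [smul_eq_mul]; ring

theorem IsGradient.sub {f f' : L2Space} {g g' : Fin 3 → L2Space} (h : IsGradient f g)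
    (h' : IsGradient f' g') : IsGradient (f - f') (g - g') := by
  simpa [sub_eq_add_neg] using h.add (h'.smul (-1))

/-! ### Multipliers with Schwartz symbols -/

/-- The Fourier multiplier with the Schwartz symbol `χ`. -/
def schwartzMul (χ : 𝓢(Space3, ℂ)) : L2Space →L[ℂ] L2Space := fourierMul (χ.toLp ∞)

theorem coeFn_fourier_schwartzMul (χ : 𝓢(Space3, ℂ)) (f : L2Space) :
    (𝓕 (schwartzMul χ f) : L2Space) =ᵐ[volume] fun ξ => χ ξ * (𝓕 f : L2Space) ξ := by
  filter_upwards [coeFn_fourier_fourierMul (χ.toLp ∞) f, χ.coeFn_toLp ∞ volume] with ξ h1 h2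
  rw [schwartzMul, h1, h2]

/-- The product of the symbol of `∂_j` and a Schwartz symbol. -/
def gradSchwartz (j : Fin 3) (χ : 𝓢(Space3, ℂ)) : 𝓢(Space3, ℂ) :=
  SchwartzMap.smulLeftCLM ℂ (gradSymbol j) χ

theorem gradSchwartz_apply (j : Fin 3) (χ : 𝓢(Space3, ℂ)) (ξ : Space3) :
    gradSchwartz j χ ξ = gradSymbol j ξ * χ ξ := by
  rw [gradSchwartz, SchwartzMap.smulLeftCLM_apply_apply (hasTemperateGrowth_gradSymbol j),
    smul_eq_mul]

/-- The symbol `-(2π|ξ|)²` of the Laplacian. -/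
def lapSymbol (ξ : Space3) : ℂ := ((-(2 * Real.pi) ^ 2 * ‖ξ‖ ^ 2 : ℝ) : ℂ)

theorem hasTemperateGrowth_lapSymbol : lapSymbol.HasTemperateGrowth := by
  unfold lapSymbol; fun_prop

/-- The product of the symbol of the Laplacian and a Schwartz symbol. -/
def lapSchwartz (χ : 𝓢(Space3, ℂ)) : 𝓢(Space3, ℂ) := SchwartzMap.smulLeftCLM ℂ lapSymbol χ

theorem lapSchwartz_apply (χ : 𝓢(Space3, ℂ)) (ξ : Space3) :
    lapSchwartz χ ξ = lapSymbol ξ * χ ξ := by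
  rw [lapSchwartz, SchwartzMap.smulLeftCLM_apply_apply hasTemperateGrowth_lapSymbol, smul_eq_mul]

theorem isGradient_schwartzMul (χ : 𝓢(Space3, ℂ)) (f : L2Space) :
    IsGradient (schwartzMul χ f) (fun j => schwartzMul (gradSchwartz j χ) f) := by
  rw [isGradient_iff_fourier]
  intro j
  filter_upwards [coeFn_fourier_schwartzMul χ f, coeFn_fourier_schwartzMul (gradSchwartz j χ) f]
    with ξ h1 h2
  rw [h1, h2, gradSchwartz_apply]; ring

theorem isGradient_toLp (φ : 𝓢(Space3, ℂ)) :
    IsGradient (φ.toLp 2) (fun j => (∂_{basisVec j} φ).toLp 2) := by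
  intro j
  rw [Lp.toTemperedDistribution_toLp_eq, Lp.toTemperedDistribution_toLp_eq]
  exact TemperedDistribution.lineDerivOp_toTemperedDistributionCLM_eq φ (basisVec j)

/-- The Schwartz function obtained from `φ` by the Fourier multiplier `χ`. -/
def schwartzMulSchwartz (χ φ : 𝓢(Space3, ℂ)) : 𝓢(Space3, ℂ) :=
  𝓕⁻ (SchwartzMap.smulLeftCLM ℂ χ (𝓕 φ))

theorem schwartzMul_toLp (χ φ : 𝓢(Space3, ℂ)) :
    schwartzMul χ (φ.toLp 2) = (schwartzMulSchwartz χ φ).toLp 2 := by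
  rw [schwartzMul, fourierMul_apply, SchwartzMap.toLp_fourier_eq, schwartzMulSchwartz,
    ← SchwartzMap.toLp_fourierInv_eq]
  congr 1
  refine Lp.ext ?_
  filter_upwards [coeFn_mulLinf (χ.toLp ∞) ((𝓕 φ).toLp 2), χ.coeFn_toLp ∞ volume,
    (𝓕 φ).coeFn_toLp 2 volume,
    (SchwartzMap.smulLeftCLM ℂ χ (𝓕 φ)).coeFn_toLp 2 volume] with ξ h1 h2 h3 h4
  rw [h1, h2, h3, h4, SchwartzMap.smulLeftCLM_apply_apply χ.hasTemperateGrowth, smul_eq_mul]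

/-- The classical derivative and the multiplier are both the distributional gradient, which is
unique. -/
theorem lineDeriv_schwartzMul_toLp (χ φ : 𝓢(Space3, ℂ)) (j : Fin 3) :
    (∂_{basisVec j} (schwartzMulSchwartz χ φ)).toLp 2 = schwartzMul (gradSchwartz j χ) (φ.toLp 2) := by
  have h1 := isGradient_schwartzMul χ (φ.toLp 2)
  rw [schwartzMul_toLp] at h1
  exact congrFun ((isGradient_toLp _).unique h1) j

/-- Testing the distributional Laplacian of an `L²` function against a Fourier transform. -/
theorem integral_mul_laplacian_fourier (f : L2Space) (ψ : 𝓢(Space3, ℂ)) :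
    ∫ x, f x * (Δ (𝓕 ψ) : 𝓢(Space3, ℂ)) x = ∫ ξ, ψ ξ * (lapSymbol ξ * (𝓕 f : L2Space) ξ) := by
  have h1 : ∫ x, f x * (Δ (𝓕 ψ) : 𝓢(Space3, ℂ)) x = (𝓕 (Δ (f : 𝓢'(Space3, ℂ))) : 𝓢'(Space3, ℂ)) ψ := by
    rw [TemperedDistribution.fourier_apply, TemperedDistribution.laplacian_apply_apply,
      Lp.toTemperedDistribution_apply]
    simp only [smul_eq_mul, mul_comm]
  rw [h1, TemperedDistribution.laplacian_eq_fourierMultiplierCLM,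
    TemperedDistribution.fourierMultiplierCLM_apply, TemperedDistribution.fourier_apply, smul_apply,
    ← TemperedDistribution.fourier_apply, FourierTransform.fourier_fourierInv_eq, Lp.fourier_toTemperedDistribution_eq]
  simp only [TemperedDistribution.smulLeftCLM_apply_apply, Lp.toTemperedDistribution_apply]
  rw [← integral_smul]
  refine integral_congr_ae (Filter.Eventually.of_forall fun ξ => ?_)
  simp only []
  rw [SchwartzMap.smulLeftCLM_apply_apply (by fun_prop)]
  simp only [lapSymbol, smul_eq_mul, Complex.real_smul, Complex.ofReal_mul, Complex.ofReal_neg,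
    Complex.ofReal_pow, Complex.ofReal_ofNat]
  ring

theorem integral_mul_fourier (f : L2Space) (ψ : 𝓢(Space3, ℂ)) :
    ∫ x, f x * (𝓕 ψ : 𝓢(Space3, ℂ)) x = ∫ ξ, ψ ξ * (𝓕 f : L2Space) ξ := by
  have h1 : ∫ x, f x * (𝓕 ψ : 𝓢(Space3, ℂ)) x = (𝓕 (f : 𝓢'(Space3, ℂ)) : 𝓢'(Space3, ℂ)) ψ := by
    rw [TemperedDistribution.fourier_apply, Lp.toTemperedDistribution_apply]
    simp only [smul_eq_mul, mul_comm]
  rw [h1, Lp.fourier_toTemperedDistribution_eq, Lp.toTemperedDistribution_apply]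
  simp only [smul_eq_mul]

/-- Smooth frequency cutoffs: `1` on the ball of radius `n + 1`. -/
def cutoffBump (n : ℕ) : ContDiffBump (0 : Space3) :=
  ⟨n + 1, n + 2, by positivity, by linarith⟩

/-- The Schwartz symbol of the smooth cutoff to frequencies `|ξ| ≲ n`. -/
def cutoffSymbol (n : ℕ) : 𝓢(Space3, ℂ) :=
  HasCompactSupport.toSchwartzMap (f := Complex.ofRealCLM ∘ (cutoffBump n))
    ((cutoffBump n).hasCompactSupport.comp_left rfl)
    (Complex.ofRealCLM.contDiff.comp (cutoffBump n).contDiff)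

theorem cutoffSymbol_apply (n : ℕ) (ξ : Space3) : cutoffSymbol n ξ = (cutoffBump n ξ : ℂ) := rfl

theorem norm_cutoffSymbol_le (n : ℕ) (ξ : Space3) : ‖cutoffSymbol n ξ‖ ≤ 1 := by
  rw [cutoffSymbol_apply, Complex.norm_real, Real.norm_of_nonneg (cutoffBump n).nonneg]
  exact (cutoffBump n).le_one

theorem tendsto_cutoffSymbol (ξ : Space3) :
    Filter.Tendsto (fun n => cutoffSymbol n ξ) Filter.atTop (𝓝 1) := by
  refine tendsto_const_nhds.congr' ?_
  obtain ⟨N, hN⟩ := exists_nat_ge ‖ξ‖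
  filter_upwards [Filter.eventually_ge_atTop N] with n hn
  rw [cutoffSymbol_apply, (cutoffBump n).one_of_mem_closedBall, Complex.ofReal_one]
  rw [mem_closedBall_zero_iff]
  have : (N : ℝ) ≤ n := by exact_mod_cast hn
  simp only [cutoffBump]; linarith

theorem tendsto_of_tendsto_fourier {F : ℕ → L2Space} {f : L2Space}
    (h : Filter.Tendsto (fun n => (𝓕 (F n) : L2Space)) Filter.atTop (𝓝 (𝓕 f))) :
    Filter.Tendsto F Filter.atTop (𝓝 f) := by
  have := ((FourierTransform.fourierInvCLM ℂ L2Space).continuous.tendsto _).comp h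
  simpa [Function.comp_def] using this

theorem norm_schwartzMul_cutoff_le (n : ℕ) (f : L2Space) :
    ‖schwartzMul (cutoffSymbol n) f‖ ≤ ‖f‖ := by
  rw [← Lp.norm_fourier_eq, ← Lp.norm_fourier_eq f]
  refine Lp.norm_le_norm_of_ae_le ?_
  filter_upwards [coeFn_fourier_schwartzMul (cutoffSymbol n) f] with ξ h
  rw [h, norm_mul]
  exact mul_le_of_le_one_left (norm_nonneg _) (norm_cutoffSymbol_le n ξ)

theorem tendsto_schwartzMul_cutoff (f : L2Space) :
    Filter.Tendsto (fun n => schwartzMul (cutoffSymbol n) f) Filter.atTop (𝓝 f) := by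
  apply tendsto_of_tendsto_fourier
  refine tendsto_L2_of_dominated (integrable_norm_sq (𝓕 f)) ?_ ?_
  · intro n
    filter_upwards [coeFn_fourier_schwartzMul (cutoffSymbol n) f] with ξ h
    rw [h, norm_mul]
    exact mul_le_of_le_one_left (norm_nonneg _) (norm_cutoffSymbol_le n ξ)
  · have h : ∀ᵐ ξ, ∀ n, (𝓕 (schwartzMul (cutoffSymbol n) f) : L2Space) ξ
        = cutoffSymbol n ξ * (𝓕 f : L2Space) ξ :=
      ae_all_iff.2 fun n => coeFn_fourier_schwartzMul (cutoffSymbol n) f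
    filter_upwards [h] with ξ hξ
    simp only [hξ]
    simpa using (tendsto_cutoffSymbol ξ).mul_const ((𝓕 f : L2Space) ξ)

theorem denseRange_schwartz_toLp : DenseRange fun φ : 𝓢(Space3, ℂ) => (φ.toLp 2 : L2Space) :=
  SchwartzMap.denseRange_toLpCLM (E := Space3) (F := ℂ) (μ := volume) (p := 2) (by norm_num)

/-- A closed property of the pair `(f, ∇f)` holds on `H¹` if it holds for Schwartz functions. -/
theorem IsGradient.induction_schwartz {p : L2Space → (Fin 3 → L2Space) → Prop}
    (hp : IsClosed {z : L2Space × (Fin 3 → L2Space) | p z.1 z.2})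
    (hs : ∀ φ : 𝓢(Space3, ℂ), p (φ.toLp 2) (fun j => (∂_{basisVec j} φ).toLp 2))
    {f : L2Space} {g : Fin 3 → L2Space} (h : IsGradient f g) : p f g := by
  -- After a fixed Schwartz multiplier, both the function and its gradient depend continuously on
  -- `f` in `L²` alone, so density of Schwartz functions in `L²` is enough. Closedness is used a
  -- second time to remove the cutoff.
  have step : ∀ (χ : 𝓢(Space3, ℂ)) (f : L2Space),
      p (schwartzMul χ f) (fun j => schwartzMul (gradSchwartz j χ) f) := by
    intro χ f
    refine denseRange_schwartz_toLp.induction_on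
      (p := fun f => p (schwartzMul χ f) (fun j => schwartzMul (gradSchwartz j χ) f)) f ?_ ?_
    · exact hp.preimage (f := fun f : L2Space =>
        (schwartzMul χ f, fun j => schwartzMul (gradSchwartz j χ) f)) (by fun_prop)
    · intro φ
      have := hs (schwartzMulSchwartz χ φ)
      simp only [lineDeriv_schwartzMul_toLp] at this
      rwa [schwartzMul_toLp]
  have hlim : Filter.Tendsto (fun n => ((schwartzMul (cutoffSymbol n) f,
      fun j => schwartzMul (cutoffSymbol n) (g j)) : L2Space × (Fin 3 → L2Space)))
      Filter.atTop (𝓝 (f, g)) :=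
    (tendsto_schwartzMul_cutoff f).prodMk_nhds
      (tendsto_pi_nhds.2 fun j => tendsto_schwartzMul_cutoff (g j))
  refine hp.mem_of_tendsto hlim (Filter.Eventually.of_forall fun n => ?_)
  have h1 : (fun j => schwartzMul (cutoffSymbol n) (g j)) =
      fun j => schwartzMul (gradSchwartz j (cutoffSymbol n)) f :=
    (h.fourierMul _).unique (isGradient_schwartzMul (cutoffSymbol n) f)
  rw [mem_ofPred_eq, h1]
  exact step (cutoffSymbol n) f

attribute [irreducible] mulLinf fourierMul schwartzMul

/-! ### Weights and integration by parts on `H¹` -/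

/-- Bounded continuous real functions on `ℝ³`. -/
abbrev Weight : Type := BoundedContinuousFunction Space3 ℝ

/-- `W'` is the `k`-th partial derivative of `W`. -/
def HasPartial (k : Fin 3) (W W' : Weight) : Prop :=
  ∀ x, HasLineDerivAt ℝ W (W' x) x (basisVec k)

theorem HasPartial.mul {k : Fin 3} {V V' W W' : Weight} (hV : HasPartial k V V')
    (hW : HasPartial k W W') : HasPartial k (V * W) (V' * W + V * W') := by
  intro x
  have h := HasDerivAt.mul (hV x) (hW x)
  simpa [HasLineDerivAt, Pi.mul_def] using h

theorem HasPartial.add {k : Fin 3} {V V' W W' : Weight} (hV : HasPartial k V V')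
    (hW : HasPartial k W W') : HasPartial k (V + W) (V' + W') := by
  intro x
  have h := HasDerivAt.add (hV x) (hW x)
  simpa [HasLineDerivAt, Pi.add_def] using h

theorem HasPartial.smul {k : Fin 3} {V V' : Weight} (hV : HasPartial k V V') (a : ℝ) :
    HasPartial k (a • V) (a • V') := by
  intro x
  have h := HasDerivAt.const_mul a (hV x)
  simpa [HasLineDerivAt] using h

theorem HasPartial.translate {k : Fin 3} {W W' : Weight} (h : HasPartial k W W') (y : Space3) :
    HasPartial k (W.translate y) (W'.translate y) := by
  intro x
  have := h (x - y)
  unfold HasLineDerivAt at this ⊢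
  simp only [BoundedContinuousFunction.translate_apply]
  convert this using 3
  abel

/-- The Schwartz function `Re (conj φ * ψ)`. -/
def schwartzInner (φ ψ : 𝓢(Space3, ℂ)) : 𝓢(Space3, ℝ) :=
  SchwartzMap.pairing (innerSL ℝ (E := ℂ)) φ ψ

theorem schwartzInner_apply (φ ψ : 𝓢(Space3, ℂ)) (x : Space3) :
    schwartzInner φ ψ x = inner ℝ (φ x) (ψ x) := rfl

theorem toLp_schwartzInner (φ ψ : 𝓢(Space3, ℂ)) :
    (schwartzInner φ ψ).toLp 1 = innerL1 (φ.toLp 2) (ψ.toLp 2) := by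
  refine Lp.ext ?_
  filter_upwards [(schwartzInner φ ψ).coeFn_toLp 1 volume, coeFn_innerL1 (φ.toLp 2) (ψ.toLp 2),
    φ.coeFn_toLp 2 volume, ψ.coeFn_toLp 2 volume] with x h1 h2 h3 h4
  rw [h1, h2, h3, h4, schwartzInner_apply]

theorem lineDeriv_schwartzInner (φ ψ : 𝓢(Space3, ℂ)) (v : Space3) :
    ∂_{v} (schwartzInner φ ψ) = schwartzInner (∂_{v} φ) ψ + schwartzInner φ (∂_{v} ψ) := by
  ext x
  rw [add_apply, schwartzInner_apply, schwartzInner_apply, SchwartzMap.lineDerivOp_apply_eq_fderiv,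
    SchwartzMap.lineDerivOp_apply_eq_fderiv, SchwartzMap.lineDerivOp_apply_eq_fderiv]
  have h : (schwartzInner φ ψ : Space3 → ℝ) = fun x => inner ℝ (φ x) (ψ x) := rfl
  rw [h, fderiv_inner_apply ℝ φ.differentiableAt ψ.differentiableAt, add_comm]

theorem potential_lineDeriv {k : Fin 3} {W W' : Weight} (h : HasPartial k W W') (y : Space3)
    (g : 𝓢(Space3, ℝ)) :
    potential W y ((∂_{basisVec k} g).toLp 1) = -potential W' y (g.toLp 1) := by
  have e1 : ∀ (V : Weight) (u : 𝓢(Space3, ℝ)),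
      potential V y (u.toLp 1) = ∫ x, V.translate y x * u x := by
    intro V u
    rw [potential_apply]
    refine integral_congr_ae ?_
    filter_upwards [u.coeFn_toLp 1 volume] with x hx
    rw [hx]; rfl
  rw [e1, e1]
  have := integral_bilinear_hasLineDerivAt_right_eq_neg_left_of_integrable (μ := volume)
    (f := W.translate y) (f' := W'.translate y) (g := g)
    (g' := fun x => (∂_{basisVec k} g : 𝓢(Space3, ℝ)) x) (v := basisVec k)
    (B := ContinuousLinearMap.mul ℝ ℝ)
    (integrable_bcf_mul g.integrable) (integrable_bcf_mul (SchwartzMap.integrable _))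
    (integrable_bcf_mul g.integrable) (fun x _ => h.translate y x)
    (fun x _ => by
      rw [SchwartzMap.lineDerivOp_apply_eq_fderiv]
      exact (g.hasFDerivAt x).hasLineDerivAt _)
  simpa using this

/-- Integration by parts against a weight, for `f, g ∈ H¹`. -/
theorem potential_innerL1_gradient_schwartz {k : Fin 3} {W W' : Weight} (h : HasPartial k W W')
    (y : Space3) (φ ψ : 𝓢(Space3, ℂ)) :
    potential W y (innerL1 ((∂_{basisVec k} φ).toLp 2) (ψ.toLp 2))
        + potential W y (innerL1 (φ.toLp 2) ((∂_{basisVec k} ψ).toLp 2))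
      = -potential W' y (innerL1 (φ.toLp 2) (ψ.toLp 2)) := by
  rw [← toLp_schwartzInner, ← toLp_schwartzInner, ← toLp_schwartzInner, ← potential_lineDeriv h,
    lineDeriv_schwartzInner, ← map_add]
  rfl

/-- Both sides are continuous in `(f, Df)` and in `(g, Dg)` for the `L²` topologies, so the Schwartz
case extends one argument at a time. -/
theorem potential_innerL1_gradient {k : Fin 3} {W W' : Weight} (h : HasPartial k W W') (y : Space3)
    {f g : L2Space} {Df Dg : Fin 3 → L2Space} (hf : IsGradient f Df) (hg : IsGradient g Dg) :
    potential W y (innerL1 (Df k) g) + potential W y (innerL1 f (Dg k))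
      = -potential W' y (innerL1 f g) := by
  have c1 : Continuous fun z : L2Space × (Fin 3 → L2Space) => z.1 := continuous_fst
  have c2 : Continuous fun z : L2Space × (Fin 3 → L2Space) => z.2 k :=
    (continuous_apply k).comp continuous_snd
  have step : ∀ φ : 𝓢(Space3, ℂ), potential W y (innerL1 ((∂_{basisVec k} φ).toLp 2) g)
        + potential W y (innerL1 (φ.toLp 2) (Dg k)) = -potential W' y (innerL1 (φ.toLp 2) g) := by
    intro φ
    generalize hφ : (φ.toLp 2 : L2Space) = u
    generalize hφ' : ((∂_{basisVec k} φ).toLp 2 : L2Space) = u'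
    refine hg.induction_schwartz (p := fun g Dg => potential W y (innerL1 u' g) +
      potential W y (innerL1 u (Dg k)) = -potential W' y (innerL1 u g)) ?_ ?_
    · exact isClosed_eq (((continuous_const.innerL1 c1).potential W y).add
        ((continuous_const.innerL1 c2).potential W y)) ((continuous_const.innerL1 c1).potential W' y).neg
    · intro ψ
      rw [← hφ, ← hφ']
      exact potential_innerL1_gradient_schwartz h y φ ψ
  refine hf.induction_schwartz (p := fun f Df => potential W y (innerL1 (Df k) g) +
    potential W y (innerL1 f (Dg k)) = -potential W' y (innerL1 f g)) ?_ step
  exact isClosed_eq (((c2.innerL1 continuous_const).potential W y).add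
    ((c1.innerL1 continuous_const).potential W y)) ((c1.innerL1 continuous_const).potential W' y).neg

/-! ### The regularized Morawetz weights -/

section Weights

variable (δ : ℝ) [hδ : Fact (0 < δ)]

/-- The regularized inverse distance `(|z|² + δ²)^{-1/2}`. -/
def invDist : Weight :=
  BoundedContinuousFunction.ofNormedAddCommGroup (fun z => (√(‖z‖ ^ 2 + δ ^ 2))⁻¹)
    (Continuous.inv₀ (by fun_prop) fun z => (Real.sqrt_pos.2 (by have := hδ.out; positivity)).ne')
    δ⁻¹ (fun z => by
      have := hδ.out
      rw [norm_inv, Real.norm_of_nonneg (Real.sqrt_nonneg _)]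
      gcongr
      exact Real.le_sqrt_of_sq_le (by nlinarith [sq_nonneg ‖z‖]))

theorem invDist_apply (z : Space3) : invDist δ z = (√(‖z‖ ^ 2 + δ ^ 2))⁻¹ := rfl

theorem invDist_pos (z : Space3) : 0 < invDist δ z := by
  have := hδ.out
  rw [invDist_apply]; positivity

theorem invDist_sq_mul (z : Space3) : invDist δ z ^ 2 * (‖z‖ ^ 2 + δ ^ 2) = 1 := by
  have := hδ.out
  rw [invDist_apply, inv_pow, Real.sq_sqrt (by positivity)]
  exact inv_mul_cancel₀ (by positivity)

theorem norm_sq_eq_sum (z : Space3) : ‖z‖ ^ 2 = ∑ j, z j ^ 2 := by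
  simp [EuclideanSpace.norm_sq_eq]

theorem abs_coord_mul_invDist_le (j : Fin 3) (z : Space3) : |z j * invDist δ z| ≤ 1 := by
  have h := invDist_sq_mul δ z
  rw [norm_sq_eq_sum] at h
  have h2 : z j ^ 2 ≤ ∑ i, z i ^ 2 :=
    Finset.single_le_sum (f := fun i => z i ^ 2) (fun i _ => sq_nonneg _) (Finset.mem_univ j)
  rw [← sq_le_one_iff_abs_le_one, mul_pow]
  nlinarith [mul_le_mul_of_nonneg_left h2 (sq_nonneg (invDist δ z)), sq_nonneg (invDist δ z * δ)]

/-- The component `z_j / √(|z|² + δ²)` of the regularized radial direction. -/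
def radial (j : Fin 3) : Weight :=
  BoundedContinuousFunction.ofNormedAddCommGroup (fun z => z j * invDist δ z)
    (by have := (invDist δ).continuous; fun_prop) 1 (abs_coord_mul_invDist_le δ j)

theorem radial_apply (j : Fin 3) (z : Space3) : radial δ j z = z j * invDist δ z := rfl

theorem norm_radial_le (j : Fin 3) : ‖radial δ j‖ ≤ 1 :=
  (BoundedContinuousFunction.norm_le zero_le_one).2 (abs_coord_mul_invDist_le δ j)

/-- The regularized radial vector falls short of unit length by exactly this amount. With this one
relation, every trace of derivatives of the weight becomes polynomial algebra in `invDist`. -/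
theorem sum_radial_sq (z : Space3) : ∑ j, radial δ j z ^ 2 = 1 - δ ^ 2 * invDist δ z ^ 2 := by
  simp only [radial_apply, mul_pow, ← Finset.sum_mul]
  rw [← norm_sq_eq_sum]
  linarith [invDist_sq_mul δ z]

theorem hasPartial_invDist (k : Fin 3) : HasPartial k (invDist δ) (-(radial δ k * invDist δ ^ 2)) := by
  intro x
  have hδ' := hδ.out
  have h1 : HasDerivAt (fun t : ℝ => ‖x + t • basisVec k‖ ^ 2 + δ ^ 2) (2 * x k) 0 := by
    have h2 : (fun t : ℝ => ‖x + t • basisVec k‖ ^ 2 + δ ^ 2) =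
        fun t => ‖x‖ ^ 2 + 2 * t * x k + t ^ 2 + δ ^ 2 := by
      funext t
      rw [norm_add_sq_real, inner_smul_right, inner_basisVec, norm_smul]
      simp [basisVec]; ring
    rw [h2]
    have := (((hasDerivAt_id (0 : ℝ)).const_mul (2 : ℝ)).mul_const (x k)).const_add (‖x‖ ^ 2)
    have h3 := (this.add (hasDerivAt_pow 2 (0 : ℝ))).add_const (δ ^ 2)
    simpa using h3
  have hpos : 0 < ‖x + (0 : ℝ) • basisVec k‖ ^ 2 + δ ^ 2 := by positivity
  have h4 := (h1.sqrt hpos.ne').inv (Real.sqrt_pos.2 hpos).ne'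
  refine HasDerivAt.congr_deriv (f := fun t : ℝ => invDist δ (x + t • basisVec k)) h4 ?_
  simp only [zero_smul, add_zero]
  simp only [BoundedContinuousFunction.coe_neg, BoundedContinuousFunction.coe_mul,
    BoundedContinuousFunction.coe_pow, Pi.neg_apply, Pi.mul_apply, Pi.pow_apply, radial_apply,
    invDist_apply]
  have : √(‖x‖ ^ 2 + δ ^ 2) ≠ 0 := (Real.sqrt_pos.2 (by positivity)).ne'
  field_simp

/-- The Kronecker symbol. -/
def kron (j k : Fin 3) : ℝ := if j = k then 1 else 0

/-- The Hessian of `√(|z|² + δ²)`. -/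
def radialHess (j k : Fin 3) : Weight := (kron j k) • invDist δ - radial δ j * radial δ k * invDist δ

theorem hasPartial_radial (j k : Fin 3) : HasPartial k (radial δ j) (radialHess δ j k) := by
  intro x
  have h1 : HasDerivAt (fun t : ℝ => (x + t • basisVec k) j) (kron j k) 0 := by
    have h2 : (fun t : ℝ => (x + t • basisVec k) j) = fun t => x j + t * kron j k := by
      funext t
      simp [basisVec, kron]
    rw [h2]
    simpa using ((hasDerivAt_id (0 : ℝ)).mul_const (kron j k)).const_add (x j)
  have h3 := h1.mul (hasPartial_invDist δ k x)
  refine HasDerivAt.congr_deriv (f := fun t : ℝ => radial δ j (x + t • basisVec k)) h3 ?_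
  simp [radialHess, radial_apply]
  ring

/-- The Laplacian of `√(|z|² + δ²)`. -/
def radialDiv : Weight := invDist δ * (2 + δ ^ 2 • invDist δ ^ 2)

theorem radialDiv_apply (z : Space3) :
    radialDiv δ z = 2 * invDist δ z + δ ^ 2 * invDist δ z ^ 3 := by
  simp [radialDiv]; ring

theorem sum_radialHess : ∑ j, radialHess δ j j = radialDiv δ := by
  ext z
  have h := sum_radial_sq δ z
  rw [Fin.sum_univ_three] at h
  simp only [Fin.sum_univ_three, radialHess, kron, radialDiv_apply]
  simp
  linear_combination (-invDist δ z) * h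

/-- The gradient of `radialDiv`. -/
def radialDivGrad (k : Fin 3) : Weight :=
  -(radial δ k * ((2 : ℝ) • invDist δ ^ 2 + (3 * δ ^ 2) • invDist δ ^ 4))

/-- The second derivatives `∂_k ∂_k` of `radialDiv`. -/
def radialDivHess (k : Fin 3) : Weight :=
  radial δ k * radial δ k * ((4 : ℝ) • invDist δ ^ 3 + (12 * δ ^ 2) • invDist δ ^ 5)
    - radialHess δ k k * ((2 : ℝ) • invDist δ ^ 2 + (3 * δ ^ 2) • invDist δ ^ 4)

/-- The bi-Laplacian of `-√(|z|² + δ²)`. -/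
def bilapWeight : Weight := (15 * δ ^ 4) • invDist δ ^ 7

theorem bilapWeight_apply (z : Space3) : bilapWeight δ z = 15 * δ ^ 4 * invDist δ z ^ 7 := by
  simp [bilapWeight]

/-- The terms in `invDist ^ 3` and `δ² invDist ^ 5` cancel in dimension three, and only the
concentrating term `-15 δ⁴ invDist ^ 7` survives. -/
theorem sum_radialDivHess : ∑ k, radialDivHess δ k = -bilapWeight δ := by
  ext z
  have h := sum_radial_sq δ z
  rw [Fin.sum_univ_three] at h
  simp only [Fin.sum_univ_three, radialDivHess, radialHess, kron]
  simp [bilapWeight_apply]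
  linear_combination (4 * invDist δ z ^ 3 + 12 * δ ^ 2 * invDist δ z ^ 5
    + invDist δ z * (2 * invDist δ z ^ 2 + 3 * δ ^ 2 * invDist δ z ^ 4)) * h

theorem HasPartial.invDist_pow (k : Fin 3) (n : ℕ) :
    HasPartial k (invDist δ ^ n) (-((n : ℝ) • (radial δ k * invDist δ ^ (n + 1)))) := by
  intro x
  have h := (hasPartial_invDist δ k x).pow n
  refine HasDerivAt.congr_deriv (f := fun t : ℝ => (invDist δ ^ n) (x + t • basisVec k)) h ?_
  rcases n with _ | n
  · simp
  · simp; ring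

theorem HasPartial.congr {k : Fin 3} {V W V' W' : Weight} (h : HasPartial k V V')
    (h1 : ∀ z, V z = W z) (h2 : ∀ z, V' z = W' z) : HasPartial k W W' := by
  obtain rfl : V = W := BoundedContinuousFunction.ext h1
  obtain rfl : V' = W' := BoundedContinuousFunction.ext h2
  exact h

theorem hasPartial_radialDiv (k : Fin 3) : HasPartial k (radialDiv δ) (radialDivGrad δ k) := by
  refine (((hasPartial_invDist δ k).smul 2).add
    ((HasPartial.invDist_pow δ k 3).smul (δ ^ 2))).congr ?_ ?_
  · intro z; simp [radialDiv_apply]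
  · intro z; simp [radialDivGrad]; ring

theorem hasPartial_radialDivGrad (k : Fin 3) :
    HasPartial k (radialDivGrad δ k) (radialDivHess δ k) := by
  refine (((hasPartial_radial δ k k).mul (((HasPartial.invDist_pow δ k 2).smul 2).add
    ((HasPartial.invDist_pow δ k 4).smul (3 * δ ^ 2)))).smul (-1)).congr ?_ ?_
  · intro z; simp [radialDivGrad]
  · intro z; simp [radialDivHess]; ring

/-- The vector field `z_j / (|z|² + δ²)`. -/
def hardyField (j : Fin 3) : Weight := radial δ j * invDist δ

/-- The `j`-th diagonal derivative of `hardyField`. -/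
def hardyFieldDeriv (j : Fin 3) : Weight :=
  invDist δ ^ 2 - (2 : ℝ) • (radial δ j * radial δ j * invDist δ ^ 2)

theorem hasPartial_hardyField (j : Fin 3) :
    HasPartial j (hardyField δ j) (hardyFieldDeriv δ j) := by
  refine ((hasPartial_radial δ j j).mul (hasPartial_invDist δ j)).congr (fun z => rfl) ?_
  intro z; simp [hardyFieldDeriv, radialHess, kron]; ring

theorem sum_hardyFieldDeriv_apply (z : Space3) :
    (∑ j, hardyFieldDeriv δ j) z = invDist δ z ^ 2 + 2 * δ ^ 2 * invDist δ z ^ 4 := by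
  have h := sum_radial_sq δ z
  rw [Fin.sum_univ_three] at h
  simp only [Fin.sum_univ_three, hardyFieldDeriv]
  simp
  linear_combination (-2 * invDist δ z ^ 2) * h

end Weights

attribute [irreducible] schwartzInner invDist radial radialHess radialDiv radialDivGrad radialDivHess
  bilapWeight hardyField hardyFieldDeriv

/-! ### Hardy's inequality -/

theorem potential_add_kernel (V W : Weight) (y : Space3) (q : Lp (α := Space3) ℝ 1 volume) :
    potential (V + W) y q = potential V y q + potential W y q := by
  have hq := L1.integrable_coeFn q
  have h1 := integrable_bcf_mul (W := V.translate y) hq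
  have h2 := integrable_bcf_mul (W := W.translate y) hq
  simp only [BoundedContinuousFunction.translate_apply] at h1 h2
  simp only [potential_apply]
  rw [← integral_add h1 h2]
  simp only [BoundedContinuousFunction.coe_add, Pi.add_apply, add_mul]

theorem potential_neg_kernel (W : Weight) (y : Space3) (q : Lp (α := Space3) ℝ 1 volume) :
    potential (-W) y q = -potential W y q := by
  simp only [potential_apply, ← integral_neg, BoundedContinuousFunction.coe_neg, Pi.neg_apply,
    neg_mul]

theorem potential_sum_kernel (W : Fin 3 → Weight) (y : Space3)
    (q : Lp (α := Space3) ℝ 1 volume) :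
    potential (∑ j, W j) y q = ∑ j, potential (W j) y q := by
  rw [Fin.sum_univ_three, Fin.sum_univ_three, potential_add_kernel, potential_add_kernel]

theorem potential_nonneg {W : Weight} (hW : ∀ z, 0 ≤ W z) (y : Space3)
    {q : Lp (α := Space3) ℝ 1 volume} (hq : ∀ᵐ x, 0 ≤ q x) : 0 ≤ potential W y q := by
  rw [potential_apply]
  refine integral_nonneg_of_ae ?_
  filter_upwards [hq] with x hx
  exact mul_nonneg (hW _) hx

theorem potential_mono_kernel {V W : Weight} (h : ∀ z, V z ≤ W z) (y : Space3)
    {q : Lp (α := Space3) ℝ 1 volume} (hq : ∀ᵐ x, 0 ≤ q x) : potential V y q ≤ potential W y q := by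
  have h1 : W = V + (W - V) := by abel
  have h2 : 0 ≤ potential (W - V) y q := potential_nonneg (fun z => by simpa using h z) y hq
  rw [h1, potential_add_kernel]; linarith

theorem innerL1_self_nonneg (f : L2Space) : ∀ᵐ x, 0 ≤ innerL1 f f x := by
  filter_upwards [coeFn_innerL1 f f] with x hx
  rw [hx]; exact real_inner_self_nonneg

theorem memLp_weight_mul (W : Weight) (y : Space3) (f : L2Space) :
    MemLp (fun x => ((W (x - y) : ℝ) : ℂ) * f x) 2 volume := by
  have hc : Continuous fun x => ((W (x - y) : ℝ) : ℂ) := by have := W.continuous; fun_prop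
  refine (Lp.memLp f).of_le_mul (c := ‖W‖) (hc.aestronglyMeasurable.mul (Lp.aestronglyMeasurable f)) ?_
  filter_upwards with x
  rw [norm_mul, Complex.norm_real]
  gcongr
  exact W.norm_coe_le_norm _

/-- Multiplication of an `L²` function by the translated weight `W (x - y)`. -/
def weightMul (W : Weight) (y : Space3) (f : L2Space) : L2Space := (memLp_weight_mul W y f).toLp

theorem coeFn_weightMul (W : Weight) (y : Space3) (f : L2Space) :
    weightMul W y f =ᵐ[volume] fun x => ((W (x - y) : ℝ) : ℂ) * f x := MemLp.coeFn_toLp _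

theorem inner_ofReal_mul_left (a : ℝ) (z w : ℂ) : inner ℝ ((a : ℂ) * z) w = a * inner ℝ z w := by
  rw [← Complex.real_smul, real_inner_smul_left]

theorem potential_mul_kernel (V W : Weight) (y : Space3) (f g : L2Space) :
    potential (V * W) y (innerL1 f g) = potential W y (innerL1 (weightMul V y f) g) := by
  rw [potential_apply, potential_apply]
  refine integral_congr_ae ?_
  filter_upwards [coeFn_innerL1 f g, coeFn_innerL1 (weightMul V y f) g, coeFn_weightMul V y f]
    with x h1 h2 h3
  rw [h1, h2, h3, inner_ofReal_mul_left]
  simp only [BoundedContinuousFunction.coe_mul, Pi.mul_apply]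
  ring

theorem norm_weightMul_sq (W : Weight) (y : Space3) (f : L2Space) :
    ‖weightMul W y f‖ ^ 2 = potential (W ^ 2) y (innerL1 f f) := by
  rw [norm_sq_eq_integral_norm_sq, potential_apply]
  refine integral_congr_ae ?_
  filter_upwards [coeFn_innerL1 f f, coeFn_weightMul W y f] with x h1 h2
  rw [h1, h2, norm_mul, Complex.norm_real, mul_pow, real_inner_self_eq_norm_sq, Real.norm_eq_abs,
    sq_abs]
  rfl

/-- Cauchy-Schwarz with the factor `V` attached to `f`. This is how a weight of size `1/|x - y|` is
handled uniformly in `δ`: Hardy controls `V f`, and only `W` is bounded in the supremum norm. -/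
theorem abs_potential_mul_le (V W : Weight) (y : Space3) (f g : L2Space) :
    |potential (V * W) y (innerL1 f g)| ≤ ‖W‖ * (‖weightMul V y f‖ * ‖g‖) := by
  rw [potential_mul_kernel]
  exact (abs_potential_le _ _ _).trans (by gcongr; exact norm_innerL1_le _ _)

section Morawetz

variable (δ : ℝ) [hδ : Fact (0 < δ)]

/-- The divergence of `z / (|z|² + δ²)` is at least `1 / (|z|² + δ²)` in dimension three.
Integrating it against `|f|²` by parts puts one derivative on `f`, and Cauchy-Schwarz closes the
estimate uniformly in `δ` and `y`. -/
theorem hardy_inequality {f : L2Space} {Df : Fin 3 → L2Space} (hf : IsGradient f Df) {D : ℝ}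
    (hD : ∀ j, ‖Df j‖ ≤ D) (y : Space3) : ‖weightMul (invDist δ) y f‖ ≤ 6 * D := by
  set H := ‖weightMul (invDist δ) y f‖ with hH
  have h1 : H ^ 2 ≤ potential (∑ j, hardyFieldDeriv δ j) y (innerL1 f f) := by
    rw [hH, norm_weightMul_sq]
    refine potential_mono_kernel (fun z => ?_) y (innerL1_self_nonneg f)
    rw [sum_hardyFieldDeriv_apply]
    have := invDist_pos δ z
    simp only [BoundedContinuousFunction.coe_pow, Pi.pow_apply]
    nlinarith [mul_nonneg (sq_nonneg δ) (pow_nonneg this.le 4)]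
  have h2 : ∀ j, potential (hardyFieldDeriv δ j) y (innerL1 f f) ≤ 2 * (D * H) := by
    intro j
    have h3 := potential_innerL1_gradient (hasPartial_hardyField δ j) y hf hf
    rw [innerL1_comm (Df j) f] at h3
    have h4 : |potential (hardyField δ j) y (innerL1 f (Df j))| ≤ 1 * (H * D) := by
      rw [hardyField, mul_comm]
      refine (abs_potential_mul_le _ _ _ _ _).trans ?_
      gcongr
      · exact norm_radial_le δ j
      · exact hD j
    have := (abs_le.1 h4).1
    linarith
  -- The three coordinates contribute `2 D H` each, so `H² ≤ 6 D H`.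
  simp only [Fin.sum_univ_three, potential_add_kernel] at h1
  have := h2 0; have := h2 1; have := h2 2
  have hH0 : 0 ≤ H := norm_nonneg _
  by_contra hc
  push Not at hc
  have hD0 : 0 ≤ D := (norm_nonneg _).trans (hD 0)
  nlinarith

theorem norm_radialDiv_factor_le : ‖(2 + δ ^ 2 • invDist δ ^ 2 : Weight)‖ ≤ 3 := by
  refine (BoundedContinuousFunction.norm_le (by norm_num)).2 fun z => ?_
  have h := invDist_sq_mul δ z
  have h2 : δ ^ 2 * invDist δ z ^ 2 ≤ 1 := by
    nlinarith [mul_nonneg (sq_nonneg ‖z‖) (sq_nonneg (invDist δ z))]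
  simp
  rw [abs_of_nonneg (by positivity)]
  linarith

/-- The Laplacian of the weight is `invDist` times a factor bounded by 3, and Hardy contributes the
constant 6. -/
theorem abs_potential_radialDiv_le {f : L2Space} {Df : Fin 3 → L2Space} (hf : IsGradient f Df)
    {D : ℝ} (hD : ∀ j, ‖Df j‖ ≤ D) (y : Space3) (g : L2Space) :
    |potential (radialDiv δ) y (innerL1 f g)| ≤ 18 * D * ‖g‖ := by
  rw [radialDiv]
  refine (abs_potential_mul_le _ _ _ _ _).trans ?_
  have h1 := hardy_inequality δ hf hD y
  have h2 := norm_radialDiv_factor_le δ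
  calc _ ≤ 3 * (6 * D * ‖g‖) := by gcongr
    _ = _ := by ring

theorem sum_potential_radial {f g : L2Space} {Df Dg : Fin 3 → L2Space} (hf : IsGradient f Df)
    (hg : IsGradient g Dg) (y : Space3) :
    ∑ j, potential (radial δ j) y (innerL1 (Df j) g) + ∑ j, potential (radial δ j) y (innerL1 f (Dg j))
      = -potential (radialDiv δ) y (innerL1 f g) := by
  rw [← sum_radialHess, ← Finset.sum_add_distrib, potential_sum_kernel, ← Finset.sum_neg_distrib]
  exact Finset.sum_congr rfl fun j _ =>
    potential_innerL1_gradient (hasPartial_radial δ j j) y hf hg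

theorem abs_potential_radial_le (j : Fin 3) (y : Space3) (f g : L2Space) :
    |potential (radial δ j) y (innerL1 f g)| ≤ ‖f‖ * ‖g‖ := by
  refine (abs_potential_le _ _ _).trans ?_
  have := norm_innerL1_le f g
  have h2 := norm_radial_le δ j
  have : 0 ≤ ‖innerL1 f g‖ := norm_nonneg _
  nlinarith

/-! ### The Morawetz action and its derivative -/

/-- The interaction Morawetz action `∫∫ |f(y)|² a_j(x - y) Im(conj f ∂_j f)(x) dx dy`. -/
def morawetzAction (f : L2Space) (Df : Fin 3 → L2Space) : ℝ :=
  ∑ j, convForm (radial δ j) (innerL1 f f) (innerL1 (Complex.I • f) (Df j))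

/-- The derivative of the Morawetz action in the direction `h`, after integration by parts. -/
def morawetzDeriv (f : L2Space) (Df : Fin 3 → L2Space) (h : L2Space) : ℝ :=
  ∑ j, (2 * convForm (radial δ j) (innerL1 f h) (innerL1 (Complex.I • f) (Df j)) +
      2 * convForm (radial δ j) (innerL1 f f) (innerL1 (Complex.I • h) (Df j))) -
    convForm (radialDiv δ) (innerL1 f f) (innerL1 (Complex.I • f) h)

theorem norm_I_smul (f : L2Space) : ‖Complex.I • f‖ = ‖f‖ := by
  rw [norm_smul, Complex.norm_I, one_mul]

theorem abs_convForm_radial_le (j : Fin 3) (f g f' g' : L2Space) :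
    |convForm (radial δ j) (innerL1 f g) (innerL1 f' g')| ≤ ‖f‖ * ‖g‖ * (‖f'‖ * ‖g'‖) := by
  refine (abs_convForm_le _ _ _).trans ?_
  have h1 := norm_radial_le δ j
  calc _ ≤ 1 * (‖f‖ * ‖g‖) * (‖f'‖ * ‖g'‖) := by
        gcongr
        · exact norm_innerL1_le _ _
        · exact norm_innerL1_le _ _
    _ = _ := by ring

/-- Since `h` enters undifferentiated, its `L²` norm suffices. The radial terms cost 4 for each of
three coordinates and the divergence term 18, by Hardy, whence 30. -/
theorem abs_morawetzDeriv_le {f : L2Space} {Df : Fin 3 → L2Space} (hf : IsGradient f Df) {D : ℝ}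
    (hD : ∀ j, ‖Df j‖ ≤ D) (h : L2Space) :
    |morawetzDeriv δ f Df h| ≤ 30 * (‖f‖ ^ 2 * D * ‖h‖) := by
  have hD0 : 0 ≤ D := (norm_nonneg _).trans (hD 0)
  have h1 : ∀ j, |2 * convForm (radial δ j) (innerL1 f h) (innerL1 (Complex.I • f) (Df j)) +
      2 * convForm (radial δ j) (innerL1 f f) (innerL1 (Complex.I • h) (Df j))|
      ≤ 4 * (‖f‖ ^ 2 * D * ‖h‖) := by
    intro j
    have e1 : |convForm (radial δ j) (innerL1 f h) (innerL1 (Complex.I • f) (Df j))| ≤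
        ‖f‖ ^ 2 * D * ‖h‖ :=
      (abs_convForm_radial_le δ j _ _ _ _).trans (by
        rw [norm_I_smul]
        calc _ ≤ ‖f‖ * ‖h‖ * (‖f‖ * D) := by gcongr; exact hD j
          _ = _ := by ring)
    have e2 : |convForm (radial δ j) (innerL1 f f) (innerL1 (Complex.I • h) (Df j))| ≤
        ‖f‖ ^ 2 * D * ‖h‖ :=
      (abs_convForm_radial_le δ j _ _ _ _).trans (by
        rw [norm_I_smul]
        calc _ ≤ ‖f‖ * ‖f‖ * (‖h‖ * D) := by gcongr; exact hD j
          _ = _ := by ring)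
    rw [abs_le] at e1 e2 ⊢
    constructor <;> linarith [e1.1, e1.2, e2.1, e2.2]
  have h2 : |convForm (radialDiv δ) (innerL1 f f) (innerL1 (Complex.I • f) h)| ≤
      18 * (‖f‖ ^ 2 * D * ‖h‖) := by
    have hI : ∀ j, ‖(Complex.I • Df) j‖ ≤ D := fun j => by
      rw [Pi.smul_apply, norm_I_smul]; exact hD j
    refine (abs_convForm_le_of_potential_le fun y =>
      abs_potential_radialDiv_le δ (hf.smul Complex.I) hI y h).trans ?_
    have := norm_innerL1_le f f
    calc _ ≤ 18 * D * ‖h‖ * (‖f‖ * ‖f‖) := by gcongr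
      _ = _ := by ring
  rw [morawetzDeriv, Fin.sum_univ_three]
  have a0 := h1 0; have a1 := h1 1; have a2 := h1 2
  rw [abs_le] at a0 a1 a2 h2 ⊢
  constructor <;> linarith [a0.1, a0.2, a1.1, a1.2, a2.1, a2.2, h2.1, h2.2]

theorem morawetzDeriv_add (f : L2Space) (Df : Fin 3 → L2Space) (h h' : L2Space) :
    morawetzDeriv δ f Df (h + h') = morawetzDeriv δ f Df h + morawetzDeriv δ f Df h' := by
  simp only [morawetzDeriv, smul_add, map_add, add_apply, Fin.sum_univ_three]
  ring

theorem continuous_morawetzAction :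
    Continuous fun z : L2Space × (Fin 3 → L2Space) => morawetzAction δ z.1 z.2 := by
  unfold morawetzAction
  have c1 : Continuous fun z : L2Space × (Fin 3 → L2Space) => z.1 := continuous_fst
  refine continuous_finsetSum _ fun j _ => ?_
  have c2 : Continuous fun z : L2Space × (Fin 3 → L2Space) => z.2 j :=
    (continuous_apply j).comp continuous_snd
  exact (c1.innerL1 c1).convForm ((c1.const_smul Complex.I).innerL1 c2) _

theorem continuous_morawetzDeriv :
    Continuous fun z : L2Space × (Fin 3 → L2Space) × L2Space => morawetzDeriv δ z.1 z.2.1 z.2.2 := by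
  unfold morawetzDeriv
  have c1 : Continuous fun z : L2Space × (Fin 3 → L2Space) × L2Space => z.1 := continuous_fst
  have c3 : Continuous fun z : L2Space × (Fin 3 → L2Space) × L2Space => z.2.2 :=
    continuous_snd.comp continuous_snd
  refine (continuous_finsetSum _ fun j _ => ?_).sub
    ((c1.innerL1 c1).convForm ((c1.const_smul Complex.I).innerL1 c3) _)
  have c2 : Continuous fun z : L2Space × (Fin 3 → L2Space) × L2Space => z.2.1 j :=
    (continuous_apply j).comp (continuous_fst.comp continuous_snd)
  exact (((c1.innerL1 c3).convForm ((c1.const_smul Complex.I).innerL1 c2) _).const_mul 2).add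
    (((c1.innerL1 c1).convForm ((c3.const_smul Complex.I).innerL1 c2) _).const_mul 2)

/-! ### Monotonicity for the free flow -/

/-- The linear bookkeeping of the virial identity: `e1` to `e4` are integrations by parts, `e5` and
`e6` are traces of weights. The trace term `E` from the momentum cancels that from `L`. -/
theorem virial_algebra (A B H : Fin 3 → Fin 3 → ℝ) (Hd : Fin 3 → Fin 3 → ℝ) (E L G Q : Fin 3 → ℝ)
    (K : ℝ) (e1 : ∀ j k, A j k + B j k = -H j k) (e2 : ∀ j k, 2 * B j k = -Hd j k)
    (e3 : ∀ k, E k + L k = -G k) (e4 : ∀ k, 2 * G k = -Q k) (e5 : ∀ k, ∑ j, Hd j k = E k)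
    (e6 : ∑ k, Q k = -K) :
    -2 * ∑ j, ∑ k, A j k - ∑ k, L k = 2 * ∑ j, ∑ k, H j k + 1 / 2 * K := by
  simp only [Fin.sum_univ_three] at e5 e6 ⊢
  linear_combination (-2) * (e1 0 0 + e1 0 1 + e1 0 2 + e1 1 0 + e1 1 1 + e1 1 2 + e1 2 0 + e1 2 1
      + e1 2 2) + (e2 0 0 + e2 0 1 + e2 0 2 + e2 1 0 + e2 1 1 + e2 1 2 + e2 2 0 + e2 2 1 + e2 2 2)
    - (e3 0 + e3 1 + e3 2) + 1 / 2 * (e4 0 + e4 1 + e4 2) - e5 0 - e5 1 - e5 2 - 1 / 2 * e6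

set_option maxHeartbeats 1000000 in
/-- The virial identity for the weight `√(|x - y|² + δ²)`. -/
theorem virial_identity {f : L2Space} {f₁ : Fin 3 → L2Space} {f₂ : Fin 3 → Fin 3 → L2Space}
    (h₁ : IsGradient f f₁) (h₂ : ∀ k, IsGradient (f₁ k) (f₂ k)) (hs : ∀ j k, f₂ j k = f₂ k j)
    (y : Space3) :
    -2 * ∑ j, potential (radial δ j) y (innerL1 (∑ k, f₂ k k) (f₁ j)) -
        potential (radialDiv δ) y (innerL1 f (∑ k, f₂ k k)) =
      2 * ∑ j, ∑ k, potential (radialHess δ j k) y (innerL1 (f₁ k) (f₁ j)) +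
        1 / 2 * potential (bilapWeight δ) y (innerL1 f f) := by
  have e1 : ∀ j k, potential (radial δ j) y (innerL1 (f₂ k k) (f₁ j)) +
      potential (radial δ j) y (innerL1 (f₁ k) (f₂ j k)) =
      -potential (radialHess δ j k) y (innerL1 (f₁ k) (f₁ j)) := fun j k =>
    potential_innerL1_gradient (hasPartial_radial δ j k) y (h₂ k) (h₂ j)
  -- By symmetry of second derivatives the integrand is a total derivative, `2 Re(conj ∂ₖf ∂ⱼ∂ₖf) =
  -- ∂ⱼ|∂ₖf|²`.
  have e2 : ∀ j k, 2 * potential (radial δ j) y (innerL1 (f₁ k) (f₂ j k)) =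
      -potential (radialHess δ j j) y (innerL1 (f₁ k) (f₁ k)) := fun j k => by
    rw [← potential_innerL1_gradient (hasPartial_radial δ j j) y (h₂ k) (h₂ k), hs k j,
      innerL1_comm (f₂ j k) (f₁ k)]
    ring
  have e3 : ∀ k, potential (radialDiv δ) y (innerL1 (f₁ k) (f₁ k)) +
      potential (radialDiv δ) y (innerL1 f (f₂ k k)) =
      -potential (radialDivGrad δ k) y (innerL1 f (f₁ k)) := fun k =>
    potential_innerL1_gradient (hasPartial_radialDiv δ k) y h₁ (h₂ k)
  have e4 : ∀ k, 2 * potential (radialDivGrad δ k) y (innerL1 f (f₁ k)) =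
      -potential (radialDivHess δ k) y (innerL1 f f) := fun k => by
    rw [← potential_innerL1_gradient (hasPartial_radialDivGrad δ k) y h₁ h₁,
      innerL1_comm (f₁ k) f]
    ring
  have e5 : ∀ k, ∑ j, potential (radialHess δ j j) y (innerL1 (f₁ k) (f₁ k)) =
      potential (radialDiv δ) y (innerL1 (f₁ k) (f₁ k)) := fun k => by
    rw [← potential_sum_kernel (fun j => radialHess δ j j), sum_radialHess]
  have e6 : ∑ k, potential (radialDivHess δ k) y (innerL1 f f) =
      -potential (bilapWeight δ) y (innerL1 f f) := by
    rw [← potential_sum_kernel (fun k => radialDivHess δ k), sum_radialDivHess,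
      potential_neg_kernel]
  have h := virial_algebra _ _ _ _ _ _ _ _ _ e1 e2 e3 e4 e5 e6
  rw [← h, map_sum, map_sum]
  simp only [map_sum, sum_apply]

/-! ### Pointwise positivity of the two-particle form -/

/-- The form is `|u|² - (n · u)²`, so this is Cauchy-Schwarz, that is, convexity of the regularized
distance. -/
theorem quadForm_nonneg {n : Fin 3 → ℝ} (hn : ∑ j, n j ^ 2 ≤ 1) (u : Fin 3 → ℝ) :
    0 ≤ ∑ j, ∑ k, (kron j k - n j * n k) * (u j * u k) := by
  have h := Finset.sum_mul_sq_le_sq_mul_sq Finset.univ n u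
  have h1 : ∑ j, ∑ k, (kron j k - n j * n k) * (u j * u k) = ∑ j, u j ^ 2 - (∑ j, n j * u j) ^ 2 := by
    simp [Fin.sum_univ_three, kron]; ring
  have h2 : 0 ≤ ∑ j, u j ^ 2 := Finset.sum_nonneg fun j _ => sq_nonneg _
  nlinarith

/-- Here `a = f(y)`, `b = f(x)`, and `a'`, `b'` are the gradients. The expression is half the sum of
the Hessian form on the real and imaginary parts of `(∇ₓ - ∇_y)(f(y) f(x))` and `(∇ₓ + ∇_y)(conj
f(y) f(x))`; in this combination the unwanted cross terms cancel and only the product of momenta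
remains. -/
theorem interaction_form_nonneg {n : Fin 3 → ℝ} (hn : ∑ j, n j ^ 2 ≤ 1) (a b : ℂ)
    (a' b' : Fin 3 → ℂ) :
    0 ≤ ∑ j, ∑ k, (kron j k - n j * n k) * (inner ℝ a a * inner ℝ (b' k) (b' j) +
      inner ℝ (a' k) (a' j) * inner ℝ b b -
      2 * (inner ℝ (Complex.I * a) (a' j) * inner ℝ (Complex.I * b) (b' k))) := by
  have q1 := quadForm_nonneg hn (fun j => (a * b' j - b * a' j).re)
  have q2 := quadForm_nonneg hn (fun j => (a * b' j - b * a' j).im)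
  have q3 := quadForm_nonneg hn (fun j => (star a * b' j + b * star (a' j)).re)
  have q4 := quadForm_nonneg hn (fun j => (star a * b' j + b * star (a' j)).im)
  have h := add_nonneg (add_nonneg q1 q2) (add_nonneg q3 q4)
  have e : ∀ j k : Fin 3,
      (a * b' j - b * a' j).re * (a * b' k - b * a' k).re +
      (a * b' j - b * a' j).im * (a * b' k - b * a' k).im +
      ((star a * b' j + b * star (a' j)).re * (star a * b' k + b * star (a' k)).re +
      (star a * b' j + b * star (a' j)).im * (star a * b' k + b * star (a' k)).im) =
      2 * (inner ℝ a a * inner ℝ (b' k) (b' j) + inner ℝ (a' k) (a' j) * inner ℝ b b) -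
      2 * (inner ℝ (Complex.I * a) (a' j) * inner ℝ (Complex.I * b) (b' k) +
        inner ℝ (Complex.I * a) (a' k) * inner ℝ (Complex.I * b) (b' j)) := by
    intro j k
    simp [Complex.inner, Complex.sq_norm, Complex.normSq_apply]
    ring
  simp only [← Finset.sum_add_distrib, ← mul_add, e] at h
  -- Symmetry of the coefficients identifies the two orderings of the momentum product after
  -- summation.
  have hc : ∀ j k, kron j k - n j * n k = kron k j - n k * n j := fun j k => by
    simp only [kron, eq_comm (a := j), mul_comm (n j)]
  generalize (fun j k => kron j k - n j * n k) = c at h hc ⊢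
  simp only [Fin.sum_univ_three, hc 1 0, hc 2 0, hc 2 1] at h ⊢
  simp only [real_inner_comm (b' 0) (b' 1), real_inner_comm (b' 0) (b' 2),
    real_inner_comm (b' 1) (b' 2), real_inner_comm (a' 0) (a' 1), real_inner_comm (a' 0) (a' 2),
    real_inner_comm (a' 1) (a' 2)] at h ⊢
  linarith

end Morawetz

attribute [irreducible] morawetzDeriv morawetzAction

/-! ### From identities at fixed `y` to double integrals -/

theorem sum_convForm_eq_integral {ι : Type*} [Fintype ι] (k : ι → Weight)
    (p : Lp (α := Space3) ℝ 1 volume) (q : ι → Lp (α := Space3) ℝ 1 volume) :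
    ∑ i, convForm (k i) p (q i) = ∫ y, p y * ∑ i, potential (k i) y (q i) := by
  simp only [convForm_apply, Finset.mul_sum]
  rw [integral_finsetSum _ fun i _ => integrable_mul_potential _ _ _]

theorem integrable_mul_sum_potential {ι : Type*} [Fintype ι] (k : ι → Weight)
    (p : Lp (α := Space3) ℝ 1 volume) (q : ι → Lp (α := Space3) ℝ 1 volume) :
    Integrable fun y => p y * ∑ i, potential (k i) y (q i) := by
  simp only [Finset.mul_sum]
  exact integrable_finsetSum _ fun i _ => integrable_mul_potential _ _ _

theorem convForm_neg_kernel (k : Weight) (p q : Lp (α := Space3) ℝ 1 volume) :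
    convForm (-k) p q = -convForm k p q := by
  simp only [convForm_apply, potential_neg_kernel, mul_neg, integral_neg]

theorem sum_integral_nonneg {A B C : Fin 3 → Fin 3 → Space3 × Space3 → ℝ}
    (hA : ∀ j k, Integrable (A j k)) (hB : ∀ j k, Integrable (B j k))
    (hC : ∀ j k, Integrable (C j k))
    (h : ∀ᵐ z, 0 ≤ ∑ j, ∑ k, (A j k z + B j k z - 2 * C j k z)) :
    0 ≤ ∑ j, ∑ k, ((∫ z, A j k z) + (∫ z, B j k z) - 2 * ∫ z, C j k z) := by
  have hi : ∀ j k, Integrable fun z => A j k z + B j k z - 2 * C j k z := fun j k =>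
    ((hA j k).add (hB j k)).sub ((hC j k).const_mul 2)
  refine (integral_nonneg_of_ae h).trans_eq ?_
  rw [integral_finsetSum _ fun j _ => integrable_finsetSum _ fun k _ => hi j k]
  refine Finset.sum_congr rfl fun j _ => ?_
  rw [integral_finsetSum _ fun k _ => hi j k]
  refine Finset.sum_congr rfl fun k _ => ?_
  have h1 := integral_sub ((hA j k).add (hB j k)) ((hC j k).const_mul 2)
  have h2 := integral_add (hA j k) (hB j k)
  rw [← integral_const_mul, ← h2]
  exact h1

theorem integral_comb {a b c d : Space3 → ℝ} (ha : Integrable a) (hb : Integrable b)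
    (hc : Integrable c) (hd : Integrable d)
    (h : ∀ y, -2 * a y - b y = 2 * c y + 1 / 2 * d y) :
    -2 * (∫ y, a y) - ∫ y, b y = 2 * (∫ y, c y) + 1 / 2 * ∫ y, d y := by
  rw [← integral_const_mul, ← integral_const_mul, ← integral_const_mul,
    ← integral_sub (ha.const_mul _) hb, ← integral_add (hc.const_mul _) (hd.const_mul _)]
  exact integral_congr_ae (Filter.Eventually.of_forall h)

section Morawetz

variable (δ : ℝ) [hδ : Fact (0 < δ)]

theorem radialHess_apply (j k : Fin 3) (z : Space3) :
    radialHess δ j k z = (kron j k - radial δ j z * radial δ k z) * invDist δ z := by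
  rw [radialHess]; simp; ring

theorem invDist_neg (z : Space3) : invDist δ (-z) = invDist δ z := by
  rw [invDist_apply, invDist_apply, norm_neg]

theorem radial_neg (j : Fin 3) (z : Space3) : radial δ j (-z) = -radial δ j z := by
  rw [radial_apply, radial_apply, invDist_neg, PiLp.neg_apply, neg_mul]

theorem reflect_radial (j : Fin 3) : (radial δ j).reflect = -radial δ j := by
  ext z
  rw [BoundedContinuousFunction.reflect_apply, radial_neg]; rfl

theorem reflect_radialHess (j k : Fin 3) : (radialHess δ j k).reflect = radialHess δ j k := by
  ext z
  rw [BoundedContinuousFunction.reflect_apply, radialHess_apply, radialHess_apply, radial_neg,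
    radial_neg, invDist_neg, neg_mul_neg]

theorem convForm_radialHess_swap (j k : Fin 3) (p q : Lp (α := Space3) ℝ 1 volume) :
    convForm (radialHess δ j k) p q = convForm (radialHess δ j k) q p := by
  rw [convForm_swap, reflect_radialHess]

theorem sum_radial_sq_le_one (z : Space3) : ∑ j, radial δ j z ^ 2 ≤ 1 := by
  rw [sum_radial_sq]; nlinarith [mul_nonneg (sq_nonneg δ) (sq_nonneg (invDist δ z))]

set_option maxHeartbeats 1000000 in
/-- Pointwise positivity of the interaction between the density and the momentum. -/
theorem interaction_nonneg_ae (f : L2Space) (f₁ : Fin 3 → L2Space) :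
    ∀ᵐ z : Space3 × Space3, 0 ≤ ∑ j, ∑ k,
      (innerL1 f f z.1 * (radialHess δ j k (z.2 - z.1) * innerL1 (f₁ k) (f₁ j) z.2) +
        innerL1 (f₁ k) (f₁ j) z.1 * (radialHess δ j k (z.2 - z.1) * innerL1 f f z.2) -
        2 * (innerL1 (Complex.I • f) (f₁ j) z.1 *
          (radialHess δ j k (z.2 - z.1) * innerL1 (Complex.I • f) (f₁ k) z.2))) := by
  have hpt : ∀ᵐ x, innerL1 f f x = inner ℝ (f x) (f x) ∧
      (∀ k j, innerL1 (f₁ k) (f₁ j) x = inner ℝ (f₁ k x) (f₁ j x)) ∧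
      ∀ j, innerL1 (Complex.I • f) (f₁ j) x = inner ℝ (Complex.I * f x) (f₁ j x) := by
    have h1 : ∀ᵐ x, ∀ k j, innerL1 (f₁ k) (f₁ j) x = inner ℝ (f₁ k x) (f₁ j x) :=
      ae_all_iff.2 fun k => ae_all_iff.2 fun j => coeFn_innerL1 _ _
    have h2 : ∀ᵐ x, ∀ j, innerL1 (Complex.I • f) (f₁ j) x = inner ℝ ((Complex.I • f) x) (f₁ j x) :=
      ae_all_iff.2 fun j => coeFn_innerL1 _ _
    filter_upwards [coeFn_innerL1 f f, h1, h2, Lp.coeFn_smul Complex.I f] with x a b c d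
    exact ⟨a, b, fun j => by rw [c, d]; rfl⟩
  rw [Measure.volume_eq_prod]
  filter_upwards [Measure.quasiMeasurePreserving_fst.ae hpt,
    Measure.quasiMeasurePreserving_snd.ae hpt] with z hy hx
  have h := interaction_form_nonneg (sum_radial_sq_le_one δ (z.2 - z.1)) (f z.1) (f z.2)
    (fun j => f₁ j z.1) (fun j => f₁ j z.2)
  have h2 := mul_nonneg (invDist_pos δ (z.2 - z.1)).le h
  refine h2.trans_eq ?_
  simp only [Finset.mul_sum]
  refine Finset.sum_congr rfl fun j _ => Finset.sum_congr rfl fun k _ => ?_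
  rw [hy.1, hx.1, hy.2.1, hx.2.1, hy.2.2, hx.2.2, radialHess_apply]
  ring

set_option maxHeartbeats 1000000 in
-- Integrating the pointwise positivity over both particles; the Hessian kernel is even, so the two
-- mass-stress terms coincide and a common factor 2 drops out.
theorem interaction_nonneg (f : L2Space) (f₁ : Fin 3 → L2Space) :
    ∑ j, ∑ k, convForm (radialHess δ j k) (innerL1 (Complex.I • f) (f₁ j))
        (innerL1 (Complex.I • f) (f₁ k)) ≤
      ∑ j, ∑ k, convForm (radialHess δ j k) (innerL1 f f) (innerL1 (f₁ k) (f₁ j)) := by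
  have h := sum_integral_nonneg (fun j k => integrable_prod_convForm _ _ _)
    (fun j k => integrable_prod_convForm _ _ _) (fun j k => integrable_prod_convForm _ _ _)
    (interaction_nonneg_ae δ f f₁)
  simp only [← convForm_eq_integral_prod] at h
  have e : ∀ j k, convForm (radialHess δ j k) (innerL1 f f) (innerL1 (f₁ k) (f₁ j)) +
      convForm (radialHess δ j k) (innerL1 (f₁ k) (f₁ j)) (innerL1 f f) -
      2 * convForm (radialHess δ j k) (innerL1 (Complex.I • f) (f₁ j))
        (innerL1 (Complex.I • f) (f₁ k)) =
      2 * convForm (radialHess δ j k) (innerL1 f f) (innerL1 (f₁ k) (f₁ j)) -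
      2 * convForm (radialHess δ j k) (innerL1 (Complex.I • f) (f₁ j))
        (innerL1 (Complex.I • f) (f₁ k)) := fun j k => by
    rw [convForm_radialHess_swap δ j k (innerL1 (f₁ k) (f₁ j)), ← two_mul]
  simp only [e, Finset.sum_sub_distrib, ← Finset.mul_sum] at h
  linarith

set_option maxHeartbeats 1000000 in
-- The continuity equation `∂ₜ|f|² = -2 div Im(conj f ∇f)` of the free flow, tested against the
-- radial field.
theorem potential_radial_mass_flux {f : L2Space} {f₁ : Fin 3 → L2Space}
    {f₂ : Fin 3 → Fin 3 → L2Space}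
    (h₁ : IsGradient f f₁) (h₂ : ∀ k, IsGradient (f₁ k) (f₂ k)) (j : Fin 3) (y : Space3) :
    potential (radial δ j) y (innerL1 f (Complex.I • ∑ k, f₂ k k)) =
      ∑ k, potential (radialHess δ j k) y (innerL1 (Complex.I • f) (f₁ k)) := by
  have h0 : innerL1 f (Complex.I • ∑ k, f₂ k k) = -∑ k, innerL1 (Complex.I • f) (f₂ k k) := by
    rw [← map_sum, innerL1_I_smul_left, neg_neg]
  rw [h0, map_neg, map_sum, ← Finset.sum_neg_distrib]
  refine Finset.sum_congr rfl fun k _ => ?_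
  have h := potential_innerL1_gradient (hasPartial_radial δ j k) y (h₁.smul Complex.I) (h₂ k)
  rw [Pi.smul_apply, innerL1_I_smul_self, map_zero, zero_add] at h
  rw [h, neg_neg]

/-- The density being differentiated sits at `y`, so the variables are exchanged first; oddness of
the radial field is the source of the minus sign. -/
theorem convForm_mass_flux {f : L2Space} {f₁ : Fin 3 → L2Space}
    {f₂ : Fin 3 → Fin 3 → L2Space}
    (h₁ : IsGradient f f₁) (h₂ : ∀ k, IsGradient (f₁ k) (f₂ k)) (j : Fin 3)
    (p : Lp (α := Space3) ℝ 1 volume) :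
    convForm (radial δ j) (innerL1 f (Complex.I • ∑ k, f₂ k k)) p =
      -∑ k, convForm (radialHess δ j k) p (innerL1 (Complex.I • f) (f₁ k)) := by
  rw [convForm_swap, reflect_radial, convForm_neg_kernel, convForm_apply, sum_convForm_eq_integral]
  simp only [potential_radial_mass_flux δ h₁ h₂]

set_option maxHeartbeats 1000000 in
theorem convForm_virial {f : L2Space} {f₁ : Fin 3 → L2Space} {f₂ : Fin 3 → Fin 3 → L2Space}
    (h₁ : IsGradient f f₁) (h₂ : ∀ k, IsGradient (f₁ k) (f₂ k)) (hs : ∀ j k, f₂ j k = f₂ k j)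
    (p : Lp (α := Space3) ℝ 1 volume) :
    -2 * ∑ j, convForm (radial δ j) p (innerL1 (∑ k, f₂ k k) (f₁ j)) -
        convForm (radialDiv δ) p (innerL1 f (∑ k, f₂ k k)) =
      2 * ∑ j, ∑ k, convForm (radialHess δ j k) p (innerL1 (f₁ k) (f₁ j)) +
        1 / 2 * convForm (bilapWeight δ) p (innerL1 f f) := by
  have e1 : ∑ j, ∑ k, convForm (radialHess δ j k) p (innerL1 (f₁ k) (f₁ j)) =
      ∫ y, p y * ∑ i : Fin 3 × Fin 3, potential (radialHess δ i.1 i.2) y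
        (innerL1 (f₁ i.2) (f₁ i.1)) := by
    rw [← sum_convForm_eq_integral, Fintype.sum_prod_type]
  rw [e1, sum_convForm_eq_integral, convForm_apply, convForm_apply]
  refine integral_comb (integrable_mul_sum_potential _ _ _) (integrable_mul_potential _ _ _)
    (integrable_mul_sum_potential _ _ _) (integrable_mul_potential _ _ _) fun y => ?_
  have h := virial_identity δ h₁ h₂ hs y
  rw [Fintype.sum_prod_type]
  generalize p y = r at *
  linear_combination r * h

set_option maxHeartbeats 1000000 in
/-- The interaction Morawetz inequality for the free flow, in differential form. -/
theorem morawetzDeriv_free_ge {f : L2Space} {f₁ : Fin 3 → L2Space} {f₂ : Fin 3 → Fin 3 → L2Space}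
    (h₁ : IsGradient f f₁) (h₂ : ∀ k, IsGradient (f₁ k) (f₂ k)) (hs : ∀ j k, f₂ j k = f₂ k j) :
    1 / 2 * convForm (bilapWeight δ) (innerL1 f f) (innerL1 f f) ≤
      morawetzDeriv δ f f₁ (Complex.I • ∑ k, f₂ k k) := by
  have h := convForm_virial δ h₁ h₂ hs (innerL1 f f)
  have h' := interaction_nonneg δ f f₁
  have e2 : ∀ j, innerL1 (Complex.I • Complex.I • ∑ k, f₂ k k) (f₁ j) =
      -innerL1 (∑ k, f₂ k k) (f₁ j) := fun j => by
    rw [smul_smul, Complex.I_mul_I, neg_one_smul, map_neg, neg_apply]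
  -- The mass flux gives `-2` times the interaction of momenta and the virial identity `+2` times
  -- the stress term. Their sum is nonnegative by `interaction_nonneg`, which leaves half the
  -- bi-Laplacian form.
  rw [morawetzDeriv]
  simp only [convForm_mass_flux δ h₁ h₂, e2, map_neg, innerL1_I_smul_I_smul,
    Finset.sum_add_distrib, ← Finset.mul_sum, Finset.sum_neg_distrib]
  linarith

end Morawetz

/-! ### The `Ḣ^{1/2}` bound for the Morawetz action -/

theorem memLp_sharpSymbol (r : ℝ) :
    MemLp (indicator {ξ : Space3 | 2 * Real.pi * ‖ξ‖ ≤ r} fun _ => (1 : ℂ)) ∞ volume := by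
  have hm : MeasurableSet {ξ : Space3 | 2 * Real.pi * ‖ξ‖ ≤ r} :=
    measurableSet_le (by fun_prop) measurable_const
  refine memLp_top_of_bound (aestronglyMeasurable_const.indicator hm) 1
    (Filter.Eventually.of_forall fun ξ => ?_)
  exact (norm_indicator_le_norm_self _ _).trans (by simp)

/-- The sharp cutoff to frequencies `2π|ξ| ≤ r`. -/
def sharpCut (r : ℝ) : L2Space →L[ℂ] L2Space := fourierMul (memLp_sharpSymbol r).toLp

theorem coeFn_fourier_sharpCut (r : ℝ) (f : L2Space) :
    (𝓕 (sharpCut r f) : L2Space) =ᵐ[volume]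
      fun ξ => if 2 * Real.pi * ‖ξ‖ ≤ r then (𝓕 f : L2Space) ξ else 0 := by
  filter_upwards [coeFn_fourier_fourierMul (memLp_sharpSymbol r).toLp f,
    (memLp_sharpSymbol r).coeFn_toLp] with ξ h1 h2
  rw [sharpCut, h1, h2, indicator_apply]
  simp only [mem_ofPred_eq]
  split_ifs <;> simp

theorem norm_sq_eq_integral_fourier (f : L2Space) : ‖f‖ ^ 2 = ∫ ξ, ‖(𝓕 f : L2Space) ξ‖ ^ 2 := by
  rw [← Lp.norm_fourier_eq, norm_sq_eq_integral_norm_sq]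

theorem tendsto_sharpCut {r : ℕ → ℝ} (hr : Filter.Tendsto r Filter.atTop Filter.atTop) (f : L2Space) :
    Filter.Tendsto (fun n => sharpCut (r n) f) Filter.atTop (𝓝 f) := by
  apply tendsto_of_tendsto_fourier
  refine tendsto_L2_of_dominated (integrable_norm_sq (𝓕 f)) ?_ ?_
  · intro n
    filter_upwards [coeFn_fourier_sharpCut (r n) f] with ξ h
    rw [h]
    split_ifs <;> simp
  · have h : ∀ᵐ ξ, ∀ n, (𝓕 (sharpCut (r n) f) : L2Space) ξ =
        if 2 * Real.pi * ‖ξ‖ ≤ r n then (𝓕 f : L2Space) ξ else 0 :=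
      ae_all_iff.2 fun n => coeFn_fourier_sharpCut (r n) f
    filter_upwards [h] with ξ hξ
    refine tendsto_const_nhds.congr' ?_
    filter_upwards [hr.eventually_ge_atTop (2 * Real.pi * ‖ξ‖)] with n hn
    rw [hξ, if_pos hn]

theorem integrable_ite_mul {s : Space3 → Prop} [DecidablePred s] (hs : MeasurableSet {ξ | s ξ})
    {w : Space3 → ℝ} (hw : Continuous w) {b : ℝ} (hb : ∀ ξ, s ξ → |w ξ| ≤ b) (hb0 : 0 ≤ b)
    (f : L2Space) :
    Integrable fun ξ => (if s ξ then w ξ else 0) * ‖f ξ‖ ^ 2 := by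
  refine (integrable_norm_sq f).bdd_mul (c := b)
    (Measurable.ite hs hw.measurable measurable_const).aestronglyMeasurable
    (Filter.Eventually.of_forall fun ξ => ?_)
  split_ifs with h
  · exact hb ξ h
  · simpa using hb0

theorem measurableSet_freq_le (r : ℝ) : MeasurableSet {ξ : Space3 | 2 * Real.pi * ‖ξ‖ ≤ r} :=
  measurableSet_le (by fun_prop) measurable_const

theorem measurableSet_freq_annulus (r s : ℝ) :
    MeasurableSet {ξ : Space3 | r < 2 * Real.pi * ‖ξ‖ ∧ 2 * Real.pi * ‖ξ‖ ≤ s} :=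
  (measurableSet_lt (f := fun _ => r) measurable_const
    (by fun_prop : Measurable fun ξ : Space3 => 2 * Real.pi * ‖ξ‖)).inter (measurableSet_freq_le s)

/-- The squared `L²` norm of the gradient of the low frequency part. -/
def lowEnergy (r : ℝ) (f : L2Space) : ℝ :=
  ∫ ξ, (if 2 * Real.pi * ‖ξ‖ ≤ r then (2 * Real.pi * ‖ξ‖) ^ 2 else 0) * ‖(𝓕 f : L2Space) ξ‖ ^ 2

theorem integrable_lowEnergy (r : ℝ) (f : L2Space) : Integrable fun ξ : Space3 =>
    (if 2 * Real.pi * ‖ξ‖ ≤ r then (2 * Real.pi * ‖ξ‖) ^ 2 else 0) * ‖(𝓕 f : L2Space) ξ‖ ^ 2 := by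
  refine integrable_ite_mul (measurableSet_freq_le r) (by fun_prop) (b := r ^ 2) (fun ξ h => ?_)
    (by positivity) _
  rw [abs_of_nonneg (by positivity)]
  have : 0 ≤ 2 * Real.pi * ‖ξ‖ := by positivity
  gcongr

theorem lowEnergy_nonneg (r : ℝ) (f : L2Space) : 0 ≤ lowEnergy r f :=
  integral_nonneg fun ξ => by
    have : (0 : ℝ) ≤ if 2 * Real.pi * ‖ξ‖ ≤ r then (2 * Real.pi * ‖ξ‖) ^ 2 else 0 := by
      split_ifs <;> positivity
    positivity

theorem lowEnergy_mono {r s : ℝ} (h : r ≤ s) (f : L2Space) : lowEnergy r f ≤ lowEnergy s f := by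
  refine integral_mono (integrable_lowEnergy r f) (integrable_lowEnergy s f) fun ξ => ?_
  simp only []
  gcongr
  split_ifs with h1 h2
  · exact le_rfl
  · exact absurd (h1.trans h) h2
  · positivity
  · exact le_rfl

theorem lowEnergy_le {r : ℝ} (f : L2Space) : lowEnergy r f ≤ r ^ 2 * ‖f‖ ^ 2 := by
  rw [norm_sq_eq_integral_fourier, ← integral_const_mul]
  refine integral_mono (integrable_lowEnergy r f) ((integrable_norm_sq _).const_mul _) fun ξ => ?_
  simp only []
  gcongr
  split_ifs with h1
  · have : 0 ≤ 2 * Real.pi * ‖ξ‖ := by positivity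
    gcongr
  · positivity

theorem norm_gradient_sharpCut_sq_le {f : L2Space} {Df : Fin 3 → L2Space} (hf : IsGradient f Df)
    (r : ℝ) (j : Fin 3) : ‖sharpCut r (Df j)‖ ^ 2 ≤ lowEnergy r f := by
  rw [norm_sq_eq_integral_fourier]
  refine integral_mono_ae (integrable_norm_sq _) (integrable_lowEnergy r f) ?_
  filter_upwards [coeFn_fourier_sharpCut r (Df j), isGradient_iff_fourier.1 hf j] with ξ h1 h2
  rw [h1, h2]
  have h3 : ‖gradSymbol j ξ‖ ^ 2 ≤ (2 * Real.pi * ‖ξ‖) ^ 2 := by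
    rw [← sum_norm_gradSymbol_sq]
    exact Finset.single_le_sum (f := fun i => ‖gradSymbol i ξ‖ ^ 2) (fun i _ => sq_nonneg _)
      (Finset.mem_univ j)
  split_ifs
  · rw [norm_mul, mul_pow]; gcongr
  · simp

theorem norm_sharpCut_sub_sq {r s : ℝ} (h : r ≤ s) (f : L2Space) :
    ‖sharpCut s f - sharpCut r f‖ ^ 2 =
      ∫ ξ, (if r < 2 * Real.pi * ‖ξ‖ ∧ 2 * Real.pi * ‖ξ‖ ≤ s then 1 else 0) *
        ‖(𝓕 f : L2Space) ξ‖ ^ 2 := by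
  have e : (𝓕 (sharpCut s f - sharpCut r f) : L2Space) = 𝓕 (sharpCut s f) - 𝓕 (sharpCut r f) :=
    map_sub (FourierTransform.fourierCLM ℂ L2Space) _ _
  rw [norm_sq_eq_integral_fourier, e]
  refine integral_congr_ae ?_
  filter_upwards [coeFn_fourier_sharpCut s f, coeFn_fourier_sharpCut r f,
    Lp.coeFn_sub (𝓕 (sharpCut s f) : L2Space) (𝓕 (sharpCut r f))] with ξ h1 h2 h3
  rw [h3, Pi.sub_apply, h1, h2]
  by_cases a : 2 * Real.pi * ‖ξ‖ ≤ r
  · simp [a, a.trans h]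
  · by_cases b : 2 * Real.pi * ‖ξ‖ ≤ s
    · simp [a, b, not_le.1 a]
    · simp [a, b]

theorem integrable_annulus (r s : ℝ) (f : L2Space) : Integrable fun ξ : Space3 =>
    (if r < 2 * Real.pi * ‖ξ‖ ∧ 2 * Real.pi * ‖ξ‖ ≤ s then 1 else 0) * ‖(𝓕 f : L2Space) ξ‖ ^ 2 :=
  integrable_ite_mul (measurableSet_freq_annulus r s) continuous_const (b := 1) (by simp) (by simp) _

/-! ### Telescoping bounds for dyadic sums -/

/-- Equality holds on the annulus. The majorant is an increment of `q ↦ min t q` between `q / 2` and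
`q`, so its dyadic sum telescopes. -/
theorem dyadic_annulus_le {t q : ℝ} (hq : 0 < q) :
    2 * q * (if q < t ∧ t ≤ 2 * q then 1 else 0) ≤ 4 * (min t q - min t (q / 2)) := by
  split_ifs with h
  · rw [min_eq_right h.1.le, min_eq_right (by linarith)]; linarith
  · have : min t (q / 2) ≤ min t q := min_le_min le_rfl (by linarith)
    linarith

/-- The same device for the low-frequency energy, with `min t (t² / q)`, which decreases in `q`;
equality holds when `t ≤ q`. -/
theorem dyadic_low_le {t q : ℝ} (ht : 0 ≤ t) (hq : 0 < q) :
    q⁻¹ * (if t ≤ q then t ^ 2 else 0) ≤ 2 * (min t (t ^ 2 * q⁻¹) - min t (t ^ 2 * (2 * q)⁻¹)) := by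
  have e : (2 * q)⁻¹ = q⁻¹ / 2 := by rw [mul_inv]; ring
  rw [e]
  have hq' : 0 < q⁻¹ := inv_pos.2 hq
  split_ifs with h
  · have h1 : t * q⁻¹ ≤ 1 := by rw [← div_eq_mul_inv]; exact (div_le_one hq).2 h
    have h2 : t ^ 2 * q⁻¹ ≤ t := by nlinarith
    have h3 : 0 ≤ t ^ 2 * q⁻¹ := by positivity
    rw [min_eq_right h2, min_eq_right (by linarith)]; linarith
  · have : min t (t ^ 2 * (q⁻¹ / 2)) ≤ min t (t ^ 2 * q⁻¹) :=
      min_le_min le_rfl (by have : 0 ≤ t ^ 2 * q⁻¹ := by positivity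
                            linarith)
    linarith

/-- After telescoping only the end terms are left. Each minimum is at most `t`, so the annuli
contribute `4 t` and the low frequencies `2 t`, independently of `M` and `a`. -/
theorem sum_dyadic_le {t a : ℝ} (ht : 0 ≤ t) (ha : 0 < a) (M : ℕ) :
    ∑ n ∈ Finset.range M, (2 * (2 ^ n * a) * (if 2 ^ n * a < t ∧ t ≤ 2 * (2 ^ n * a) then 1 else 0) +
      (2 * (2 ^ n * a))⁻¹ * (if t ≤ 2 * (2 ^ n * a) then t ^ 2 else 0)) ≤ 6 * t := by
  have h : ∀ n ∈ Finset.range M, (2 * (2 ^ n * a) *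
      (if 2 ^ n * a < t ∧ t ≤ 2 * (2 ^ n * a) then 1 else 0) +
      (2 * (2 ^ n * a))⁻¹ * (if t ≤ 2 * (2 ^ n * a) then t ^ 2 else 0)) ≤
      (4 * min t (2 ^ (n + 1) * a / 2) - 2 * min t (t ^ 2 * (2 * (2 ^ (n + 1) * a))⁻¹)) -
      (4 * min t (2 ^ n * a / 2) - 2 * min t (t ^ 2 * (2 * (2 ^ n * a))⁻¹)) := by
    intro n _
    have h1 := dyadic_annulus_le (t := t) (q := 2 ^ n * a) (by positivity)
    have h2 := dyadic_low_le (q := 2 * (2 ^ n * a)) ht (by positivity)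
    have e1 : (2 : ℝ) ^ (n + 1) * a / 2 = 2 ^ n * a := by ring
    have e2 : (2 : ℝ) ^ (n + 1) * a = 2 * (2 ^ n * a) := by ring
    rw [e1, e2]
    linarith
  refine (Finset.sum_le_sum h).trans ?_
  rw [Finset.sum_range_sub (fun n => 4 * min t (2 ^ n * a / 2) -
    2 * min t (t ^ 2 * (2 * (2 ^ n * a))⁻¹))]
  have h1 : min t (2 ^ M * a / 2) ≤ t := min_le_left _ _
  have h2 : min t (t ^ 2 * (2 * (2 ^ 0 * a))⁻¹) ≤ t := min_le_left _ _
  have h3 : 0 ≤ min t (t ^ 2 * (2 * (2 ^ M * a))⁻¹) := le_min ht (by positivity)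
  have h4 : 0 ≤ min t (2 ^ 0 * a / 2) := le_min ht (by positivity)
  linarith

/-- Square function bound for the dyadic pieces of `f`. -/
theorem sum_dyadic_norm_le {f : L2Space}
    (hH : Integrable fun ξ : Space3 => 2 * Real.pi * ‖ξ‖ * ‖(𝓕 f : L2Space) ξ‖ ^ 2)
    {a : ℝ} (ha : 0 < a) (M : ℕ) :
    ∑ n ∈ Finset.range M,
        (2 * (2 ^ n * a) * ‖sharpCut (2 * (2 ^ n * a)) f - sharpCut (2 ^ n * a) f‖ ^ 2 +
          (2 * (2 ^ n * a))⁻¹ * lowEnergy (2 * (2 ^ n * a)) f) ≤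
      6 * ∫ ξ : Space3, 2 * Real.pi * ‖ξ‖ * ‖(𝓕 f : L2Space) ξ‖ ^ 2 := by
  have hq : ∀ n : ℕ, (2 : ℝ) ^ n * a ≤ 2 * (2 ^ n * a) := fun n => by
    have : 0 < (2 : ℝ) ^ n * a := by positivity
    linarith
  have e : ∀ n : ℕ, 2 * (2 ^ n * a) * ‖sharpCut (2 * (2 ^ n * a)) f - sharpCut (2 ^ n * a) f‖ ^ 2 +
      (2 * (2 ^ n * a))⁻¹ * lowEnergy (2 * (2 ^ n * a)) f =
      ∫ ξ : Space3, (2 * (2 ^ n * a) * (if 2 ^ n * a < 2 * Real.pi * ‖ξ‖ ∧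
        2 * Real.pi * ‖ξ‖ ≤ 2 * (2 ^ n * a) then 1 else 0) + (2 * (2 ^ n * a))⁻¹ *
        (if 2 * Real.pi * ‖ξ‖ ≤ 2 * (2 ^ n * a) then (2 * Real.pi * ‖ξ‖) ^ 2 else 0)) *
        ‖(𝓕 f : L2Space) ξ‖ ^ 2 := by
    intro n
    rw [norm_sharpCut_sub_sq (hq n), lowEnergy, ← integral_const_mul, ← integral_const_mul,
      ← integral_add ((integrable_annulus _ _ f).const_mul _) ((integrable_lowEnergy _ f).const_mul _)]
    simp only [add_mul, mul_assoc]
  have hi : ∀ n ∈ Finset.range M, Integrable fun ξ : Space3 => (2 * (2 ^ n * a) *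
        (if 2 ^ n * a < 2 * Real.pi * ‖ξ‖ ∧
        2 * Real.pi * ‖ξ‖ ≤ 2 * (2 ^ n * a) then 1 else 0) + (2 * (2 ^ n * a))⁻¹ *
        (if 2 * Real.pi * ‖ξ‖ ≤ 2 * (2 ^ n * a) then (2 * Real.pi * ‖ξ‖) ^ 2 else 0)) *
        ‖(𝓕 f : L2Space) ξ‖ ^ 2 := by
    intro n _
    have := ((integrable_annulus (2 ^ n * a) (2 * (2 ^ n * a)) f).const_mul (2 * (2 ^ n * a))).add
      ((integrable_lowEnergy (2 * (2 ^ n * a)) f).const_mul (2 * (2 ^ n * a))⁻¹)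
    refine this.congr (Filter.Eventually.of_forall fun ξ => ?_)
    simp only [Pi.add_apply, add_mul, mul_assoc]
  simp only [e]
  rw [← integral_finsetSum _ hi, ← integral_const_mul]
  refine integral_mono (integrable_finsetSum _ hi) (hH.const_mul 6) fun ξ => ?_
  simp only [← Finset.sum_mul]
  rw [← mul_assoc]
  gcongr
  exact sum_dyadic_le (by positivity) ha M

section Morawetz

variable (δ : ℝ) [hδ : Fact (0 < δ)]

/-- The pairing of the current `Im (conj f ∇g)` with the radial field centered at `y`. -/
def radialCurrent (y : Space3) (f : L2Space) (Dg : Fin 3 → L2Space) : ℝ :=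
  ∑ j, potential (radial δ j) y (innerL1 (Complex.I • f) (Dg j))

theorem abs_sum_three_le {a : Fin 3 → ℝ} {b : ℝ} (h : ∀ j, |a j| ≤ b) : |∑ j, a j| ≤ 3 * b := by
  refine (Finset.abs_sum_le_sum_abs _ _).trans ((Finset.sum_le_sum fun j _ => h j).trans_eq ?_)
  simp

theorem abs_radialCurrent_le (y : Space3) (f : L2Space) {Dg : Fin 3 → L2Space} {E : ℝ}
    (hE : ∀ j, ‖Dg j‖ ≤ E) : |radialCurrent δ y f Dg| ≤ 3 * (‖f‖ * E) := by
  refine abs_sum_three_le fun j => (abs_potential_radial_le δ j y _ _).trans ?_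
  rw [norm_I_smul]
  gcongr
  exact hE j

/-- For use when `g` carries the higher frequencies: the derivative is moved from `g` to `f`. The
transferred derivative costs 3 and the divergence of the radial field, through Hardy, costs 18. -/
theorem abs_radialCurrent_le' (y : Space3) {f g : L2Space} {Df Dg : Fin 3 → L2Space}
    (hf : IsGradient f Df) (hg : IsGradient g Dg) {E : ℝ} (hE : ∀ j, ‖Df j‖ ≤ E) :
    |radialCurrent δ y f Dg| ≤ 21 * (E * ‖g‖) := by
  have hI : ∀ j, ‖(Complex.I • Df) j‖ ≤ E := fun j => by
    rw [Pi.smul_apply, norm_I_smul]; exact hE j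
  have h := sum_potential_radial δ (hf.smul Complex.I) hg y
  have h1 : |∑ j, potential (radial δ j) y (innerL1 ((Complex.I • Df) j) g)| ≤ 3 * (E * ‖g‖) := by
    refine abs_sum_three_le fun j => (abs_potential_radial_le δ j y _ _).trans ?_
    gcongr
    exact hI j
  have h2 := abs_potential_radialDiv_le δ (hf.smul Complex.I) hI y g
  rw [abs_le] at h1 h2
  rw [radialCurrent, abs_le]
  simp only [Pi.smul_apply] at h h1
  constructor <;> linarith [h1.1, h1.2, h2.1, h2.2]

theorem radialCurrent_add_left (y : Space3) (f g : L2Space) (Dh : Fin 3 → L2Space) :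
    radialCurrent δ y (f + g) Dh = radialCurrent δ y f Dh + radialCurrent δ y g Dh := by
  simp only [radialCurrent, smul_add, map_add, add_apply, Finset.sum_add_distrib]

theorem radialCurrent_add_right (y : Space3) (f : L2Space) (Dg Dh : Fin 3 → L2Space) :
    radialCurrent δ y f (Dg + Dh) = radialCurrent δ y f Dg + radialCurrent δ y f Dh := by
  simp only [radialCurrent, Pi.add_apply, map_add, Finset.sum_add_distrib]

theorem continuous_radialCurrent (y : Space3) :
    Continuous fun z : L2Space × (Fin 3 → L2Space) => radialCurrent δ y z.1 z.2 := by
  unfold radialCurrent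
  have c1 : Continuous fun z : L2Space × (Fin 3 → L2Space) => z.1 := continuous_fst
  refine continuous_finsetSum _ fun j _ => ?_
  have c2 : Continuous fun z : L2Space × (Fin 3 → L2Space) => z.2 j :=
    (continuous_apply j).comp continuous_snd
  exact ((c1.const_smul Complex.I).innerL1 c2).potential _ y

/-- The increment is split so that one factor is always the dyadic shell and the other one carries a
derivative controlled by the low-frequency energy. -/
theorem abs_radialCurrent_sub_le (y : Space3) {f : L2Space} {Df : Fin 3 → L2Space}
    (hf : IsGradient f Df) {q : ℝ} (hq : 0 < q) :
    |radialCurrent δ y (sharpCut (2 * q) f) (fun j => sharpCut (2 * q) (Df j)) -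
      radialCurrent δ y (sharpCut q f) (fun j => sharpCut q (Df j))| ≤
      12 * (2 * q * ‖sharpCut (2 * q) f - sharpCut q f‖ ^ 2 + (2 * q)⁻¹ * lowEnergy (2 * q) f) := by
  have g2 : IsGradient (sharpCut (2 * q) f) fun j => sharpCut (2 * q) (Df j) := hf.fourierMul _
  have g1 : IsGradient (sharpCut q f) fun j => sharpCut q (Df j) := hf.fourierMul _
  have gd := g2.sub g1
  set E := √(lowEnergy (2 * q) f) with hE
  have hE2 : E ^ 2 = lowEnergy (2 * q) f := Real.sq_sqrt (lowEnergy_nonneg _ _)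
  have b2 : ∀ j, ‖sharpCut (2 * q) (Df j)‖ ≤ E := fun j =>
    Real.le_sqrt_of_sq_le (norm_gradient_sharpCut_sq_le hf _ j)
  have b1 : ∀ j, ‖sharpCut q (Df j)‖ ≤ E := fun j =>
    Real.le_sqrt_of_sq_le ((norm_gradient_sharpCut_sq_le hf _ j).trans
      (lowEnergy_mono (by linarith) f))
  set F2 := sharpCut (2 * q) f
  set F1 := sharpCut q f
  set D2 := fun j => sharpCut (2 * q) (Df j)
  set D1 := fun j => sharpCut q (Df j)
  have e1 : radialCurrent δ y F2 D2 = radialCurrent δ y F2 (D2 - D1) + radialCurrent δ y F2 D1 := by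
    rw [← radialCurrent_add_right, sub_add_cancel]
  have e2 : radialCurrent δ y F2 D1 = radialCurrent δ y (F2 - F1) D1 + radialCurrent δ y F1 D1 := by
    rw [← radialCurrent_add_left, sub_add_cancel]
  have h1 := abs_radialCurrent_le' δ y g2 gd b2
  have h2 := abs_radialCurrent_le δ y (F2 - F1) b1
  have h3 : radialCurrent δ y F2 D2 - radialCurrent δ y F1 D1 =
      radialCurrent δ y F2 (D2 - D1) + radialCurrent δ y (F2 - F1) D1 := by rw [e1, e2]; ring
  rw [h3, ← hE2]
  refine (abs_add_le _ _).trans ?_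
  -- The constant is `24 = 21 + 3`; the arithmetic-geometric mean is weighted by `2 q` so that both
  -- terms scale like the squared `Ḣ^{1/2}` norm.
  have h4 : 24 * (E * ‖F2 - F1‖) ≤ 12 * (2 * q * ‖F2 - F1‖ ^ 2 + (2 * q)⁻¹ * E ^ 2) := by
    have h5 : 0 ≤ (2 * q)⁻¹ * (2 * q * ‖F2 - F1‖ - E) ^ 2 := by positivity
    have h6 : (2 * q)⁻¹ * (2 * q * ‖F2 - F1‖ - E) ^ 2 =
        2 * q * ‖F2 - F1‖ ^ 2 + (2 * q)⁻¹ * E ^ 2 - 2 * (E * ‖F2 - F1‖) := by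
      field_simp; ring
    linarith
  linarith

attribute [irreducible] sharpCut radialCurrent

theorem tendsto_radialCurrent_sharpCut (y : Space3) (f : L2Space) (Df : Fin 3 → L2Space)
    {r : ℕ → ℝ} (hr : Filter.Tendsto r Filter.atTop Filter.atTop) :
    Filter.Tendsto (fun M => radialCurrent δ y (sharpCut (r M) f) fun j => sharpCut (r M) (Df j))
      Filter.atTop (𝓝 (radialCurrent δ y f Df)) := by
  let F : ℕ → L2Space × (Fin 3 → L2Space) :=
    fun M => (sharpCut (r M) f, fun j => sharpCut (r M) (Df j))
  have h1 : Filter.Tendsto (fun M => (F M).1) Filter.atTop (𝓝 f) := tendsto_sharpCut hr f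
  have h2 : Filter.Tendsto (fun M => (F M).2) Filter.atTop (𝓝 Df) :=
    tendsto_pi_nhds.2 fun j => tendsto_sharpCut hr (Df j)
  have h3 : Filter.Tendsto F Filter.atTop (𝓝 (f, Df)) := h1.prodMk_nhds h2
  have h4 := (continuous_radialCurrent δ y).tendsto (f, Df)
  have h5 := Filter.Tendsto.comp h4 h3
  exact h5

/-- The current of the frequency truncations is telescoped over dyadic scales from `a` to infinity,
where the square-function bound gives `12 · 6 = 72`; the starting term vanishes as `a → 0`. The
bound does not depend on `y` or `δ`. -/
theorem abs_radialCurrent_le_half (y : Space3) {f : L2Space} {Df : Fin 3 → L2Space}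
    (hf : IsGradient f Df)
    (hH : Integrable fun ξ : Space3 => 2 * Real.pi * ‖ξ‖ * ‖(𝓕 f : L2Space) ξ‖ ^ 2) :
    |radialCurrent δ y f Df| ≤
      72 * ∫ ξ : Space3, 2 * Real.pi * ‖ξ‖ * ‖(𝓕 f : L2Space) ξ‖ ^ 2 := by
  set S := ∫ ξ : Space3, 2 * Real.pi * ‖ξ‖ * ‖(𝓕 f : L2Space) ξ‖ ^ 2 with hS
  set β : ℝ → ℝ := fun r => radialCurrent δ y (sharpCut r f) (fun j => sharpCut r (Df j)) with hβ
  have htel : ∀ (a : ℝ), 0 < a → ∀ M : ℕ, |β (2 ^ M * a) - β a| ≤ 72 * S := by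
    intro a ha M
    have h1 : β (2 ^ M * a) - β a = ∑ n ∈ Finset.range M, (β (2 * (2 ^ n * a)) - β (2 ^ n * a)) := by
      have := Finset.sum_range_sub (fun n : ℕ => β (2 ^ n * a)) M
      simp only [pow_zero, one_mul, pow_succ'] at this
      rw [← this]
      simp only [mul_assoc]
    rw [h1]
    refine (Finset.abs_sum_le_sum_abs _ _).trans ((Finset.sum_le_sum fun n _ =>
      abs_radialCurrent_sub_le δ y hf (q := 2 ^ n * a) (by positivity)).trans ?_)
    rw [← Finset.mul_sum]
    have := sum_dyadic_norm_le hH ha M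
    linarith
  -- Below frequency `a` the gradient has norm at most `a ‖f‖`.
  have hsmall : ∀ a : ℝ, 0 < a → |β a| ≤ 3 * (‖f‖ * (a * ‖f‖)) := by
    intro a ha
    have hn : ‖sharpCut a f‖ ≤ ‖f‖ := by
      rw [← Lp.norm_fourier_eq, ← Lp.norm_fourier_eq f]
      refine Lp.norm_le_norm_of_ae_le ?_
      filter_upwards [coeFn_fourier_sharpCut a f] with ξ h
      rw [h]; split_ifs <;> simp
    refine (abs_radialCurrent_le δ y _ (E := a * ‖f‖) fun j => ?_).trans (by gcongr)
    refine abs_le_of_sq_le_sq' ?_ (by positivity) |>.2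
    rw [mul_pow]
    exact (norm_gradient_sharpCut_sq_le hf _ j).trans (lowEnergy_le f)
  have hfull : ∀ a : ℝ, 0 < a → |radialCurrent δ y f Df| ≤ 72 * S + 3 * (‖f‖ * (a * ‖f‖)) := by
    intro a ha
    have hr : Filter.Tendsto (fun M : ℕ => (2 : ℝ) ^ M * a) Filter.atTop Filter.atTop :=
      (tendsto_pow_atTop_atTop_of_one_lt (by norm_num)).atTop_mul_const ha
    have hl : Filter.Tendsto (fun M : ℕ => β (2 ^ M * a)) Filter.atTop (𝓝 (radialCurrent δ y f Df)) :=
      tendsto_radialCurrent_sharpCut δ y f Df hr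
    refine le_of_tendsto hl.abs (Filter.Eventually.of_forall fun M => ?_)
    have h1 := htel a ha M
    have h2 := hsmall a ha
    rw [abs_le] at h1 h2 ⊢
    constructor <;> linarith [h1.1, h1.2, h2.1, h2.2]
  refine le_of_forall_pos_le_add fun ε hε => ?_
  -- The starting frequency is chosen so that the initial term is at most `ε`; the `+ 1` covers `f =
  -- 0`.
  have h := hfull (ε / (3 * ‖f‖ ^ 2 + 1)) (by positivity)
  refine h.trans ?_
  have : 3 * (‖f‖ * (ε / (3 * ‖f‖ ^ 2 + 1) * ‖f‖)) ≤ ε := by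
    have e : 3 * (‖f‖ * (ε / (3 * ‖f‖ ^ 2 + 1) * ‖f‖)) = ε * (3 * ‖f‖ ^ 2 / (3 * ‖f‖ ^ 2 + 1)) := by
      ring
    rw [e]
    refine mul_le_of_le_one_right hε.le ((div_le_one (by positivity)).2 (by linarith))
  linarith

theorem abs_morawetzAction_le {f : L2Space} {Df : Fin 3 → L2Space} (hf : IsGradient f Df)
    (hH : Integrable fun ξ : Space3 => 2 * Real.pi * ‖ξ‖ * ‖(𝓕 f : L2Space) ξ‖ ^ 2) :
    |morawetzAction δ f Df| ≤
      72 * (∫ ξ : Space3, 2 * Real.pi * ‖ξ‖ * ‖(𝓕 f : L2Space) ξ‖ ^ 2) * ‖f‖ ^ 2 := by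
  rw [morawetzAction, sum_convForm_eq_integral]
  set K := 72 * ∫ ξ : Space3, 2 * Real.pi * ‖ξ‖ * ‖(𝓕 f : L2Space) ξ‖ ^ 2 with hK
  have hK0 : 0 ≤ K := mul_nonneg (by norm_num) (integral_nonneg fun ξ => by positivity)
  have h1 : K * ‖innerL1 f f‖ ≤ K * ‖f‖ ^ 2 := by
    rw [sq]; gcongr; exact norm_innerL1_le f f
  refine le_trans ?_ h1
  rw [L1.norm_eq_integral_norm, ← integral_const_mul]
  refine (norm_integral_le_integral_norm (fun y => innerL1 f f y *
    ∑ j, potential (radial δ j) y (innerL1 (Complex.I • f) (Df j)))).trans ?_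
  refine integral_mono (integrable_mul_sum_potential _ _ _).norm
    ((L1.integrable_coeFn _).norm.const_mul _) fun y => ?_
  simp only [norm_mul]
  rw [mul_comm]
  gcongr
  have h2 := abs_radialCurrent_le_half δ y hf hH
  rwa [radialCurrent] at h2

end Morawetz

theorem abs_morawetzAction_le_homSobolevNorm (δ : ℝ) [hδ : Fact (0 < δ)] {f : L2Space}
    {Df : Fin 3 → L2Space} (hf : IsGradient f Df) {H : ℝ} (hH0 : 0 ≤ H)
    (hH : homSobolevNorm (1 / 2) f ≤ ENNReal.ofReal H) :
    |morawetzAction δ f Df| ≤ 72 * H ^ 2 * ‖f‖ ^ 2 := by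
  have hm : MemLp (fun ξ : Space3 => (((2 * Real.pi * ‖ξ‖) ^ (1 / 2 : ℝ) : ℝ) : ℂ) *
      (𝓕 f : L2Space) ξ) 2 volume := by
    refine ⟨?_, hH.trans_lt ENNReal.ofReal_lt_top⟩
    have : Continuous fun ξ : Space3 => (((2 * Real.pi * ‖ξ‖) ^ (1 / 2 : ℝ) : ℝ) : ℂ) :=
      Complex.continuous_ofReal.comp
        ((by fun_prop : Continuous fun ξ : Space3 => 2 * Real.pi * ‖ξ‖).rpow_const
          fun ξ => Or.inr (by norm_num))
    exact this.aestronglyMeasurable.mul (Lp.aestronglyMeasurable _)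
  have hsq : ∀ ξ : Space3, ‖(((2 * Real.pi * ‖ξ‖) ^ (1 / 2 : ℝ) : ℝ) : ℂ) *
      (𝓕 f : L2Space) ξ‖ ^ 2 = 2 * Real.pi * ‖ξ‖ * ‖(𝓕 f : L2Space) ξ‖ ^ 2 := by
    intro ξ
    have h0 : 0 ≤ 2 * Real.pi * ‖ξ‖ := by positivity
    rw [norm_mul, Complex.norm_real, mul_pow, Real.norm_of_nonneg (by positivity),
      ← Real.sqrt_eq_rpow, Real.sq_sqrt h0]
  have hi : Integrable fun ξ : Space3 => 2 * Real.pi * ‖ξ‖ * ‖(𝓕 f : L2Space) ξ‖ ^ 2 := by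
    have := hm.integrable_norm_pow (by norm_num)
    simpa only [ENNReal.toReal_ofNat, hsq] using this
  have hval : ∫ ξ : Space3, 2 * Real.pi * ‖ξ‖ * ‖(𝓕 f : L2Space) ξ‖ ^ 2 ≤ H ^ 2 := by
    have h1 : ‖hm.toLp‖ ≤ H := by
      rw [Lp.norm_toLp]
      exact ENNReal.toReal_le_of_le_ofReal hH0 hH
    have h2 : ‖hm.toLp‖ ^ 2 = ∫ ξ : Space3, 2 * Real.pi * ‖ξ‖ * ‖(𝓕 f : L2Space) ξ‖ ^ 2 := by
      rw [norm_sq_eq_integral_norm_sq]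
      refine integral_congr_ae ?_
      filter_upwards [hm.coeFn_toLp] with ξ h
      rw [h, hsq]
    rw [← h2]; gcongr
  refine (abs_morawetzAction_le δ hf hi).trans ?_
  gcongr

/-! ### The truncated cubic nonlinearity -/

/-- The inversion identity `||w|² z - |z|² w| = |z||w||z - w|` reduces the claim to `1 + ε|z||w| ≤
(1 + ε|z|²)(1 + ε|w|²)`. -/
theorem norm_resolvent_sub_le {ε : ℝ} (hε : 0 ≤ ε) (z w : ℂ) :
    ‖(((1 + ε * ‖z‖ ^ 2)⁻¹ : ℝ) : ℂ) * z - (((1 + ε * ‖w‖ ^ 2)⁻¹ : ℝ) : ℂ) * w‖ ≤ ‖z - w‖ := by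
  have ha : 0 < 1 + ε * ‖z‖ ^ 2 := by positivity
  have hb : 0 < 1 + ε * ‖w‖ ^ 2 := by positivity
  have hinv : ‖((‖w‖ ^ 2 : ℝ) : ℂ) * z - ((‖z‖ ^ 2 : ℝ) : ℂ) * w‖ = ‖z‖ * ‖w‖ * ‖z - w‖ := by
    refine (sq_eq_sq₀ (norm_nonneg _) (by positivity)).1 ?_
    rw [mul_pow, mul_pow]
    simp only [Complex.sq_norm, Complex.normSq_apply, Complex.sub_re, Complex.sub_im,
      Complex.re_ofReal_mul, Complex.im_ofReal_mul]
    ring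
  have e : (((1 + ε * ‖z‖ ^ 2)⁻¹ : ℝ) : ℂ) * z - (((1 + ε * ‖w‖ ^ 2)⁻¹ : ℝ) : ℂ) * w =
      (((1 + ε * ‖z‖ ^ 2)⁻¹ * (1 + ε * ‖w‖ ^ 2)⁻¹ : ℝ) : ℂ) *
        ((z - w) + (ε : ℂ) * (((‖w‖ ^ 2 : ℝ) : ℂ) * z - ((‖z‖ ^ 2 : ℝ) : ℂ) * w)) := by
    have ha' : ((1 + ε * ‖z‖ ^ 2 : ℝ) : ℂ) ≠ 0 := by exact_mod_cast ha.ne'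
    have hb' : ((1 + ε * ‖w‖ ^ 2 : ℝ) : ℂ) ≠ 0 := by exact_mod_cast hb.ne'
    rw [Complex.ofReal_mul, Complex.ofReal_inv, Complex.ofReal_inv]
    field_simp
    push_cast
    ring
  rw [e, norm_mul, Complex.norm_real, Real.norm_of_nonneg (by positivity)]
  have h1 : ‖(z - w) + (ε : ℂ) * (((‖w‖ ^ 2 : ℝ) : ℂ) * z - ((‖z‖ ^ 2 : ℝ) : ℂ) * w)‖ ≤
      (1 + ε * (‖z‖ * ‖w‖)) * ‖z - w‖ := by
    refine (norm_add_le _ _).trans ?_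
    rw [norm_mul, hinv, Complex.norm_real, Real.norm_of_nonneg hε]
    linarith
  have h2 : 1 + ε * (‖z‖ * ‖w‖) ≤ (1 + ε * ‖z‖ ^ 2) * (1 + ε * ‖w‖ ^ 2) := by
    have h3 : 0 ≤ ε * (‖z‖ - ‖w‖) ^ 2 := by positivity
    have h4 : 0 ≤ ε * ‖z‖ ^ 2 * (ε * ‖w‖ ^ 2) := by positivity
    have h5 : 0 ≤ ε * (‖z‖ * ‖w‖) := by positivity
    nlinarith
  rw [← mul_inv, inv_mul_le_iff₀ (by positivity)]
  exact h1.trans (by gcongr)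

/-- The truncation `|z|² z / (1 + ε |z|²)` of the cubic nonlinearity, with `ε = 1 / (n + 1)`. -/
def truncCubic (n : ℕ) (z : ℂ) : ℂ := ((‖z‖ ^ 2 / (1 + (n + 1 : ℝ)⁻¹ * ‖z‖ ^ 2) : ℝ) : ℂ) * z

/-- A Yosida-type form: the truncation is `(n + 1)` times the difference between the identity and
the nonexpansive map `z / (1 + ε|z|²)`. A global Lipschitz bound makes its superposition operator
continuous on `L²`. -/
theorem lipschitzWith_truncCubic (n : ℕ) : LipschitzWith (2 * (n + 1)) (truncCubic n) := by
  refine LipschitzWith.of_dist_le_mul fun z w => ?_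
  have hn : (0 : ℝ) < n + 1 := by positivity
  have e : ∀ z : ℂ, truncCubic n z =
      ((n + 1 : ℝ) : ℂ) * (z - (((1 + (n + 1 : ℝ)⁻¹ * ‖z‖ ^ 2)⁻¹ : ℝ) : ℂ) * z) := by
    intro z
    have h1 : ‖z‖ ^ 2 / (1 + (n + 1 : ℝ)⁻¹ * ‖z‖ ^ 2) =
        (n + 1 : ℝ) * (1 - (1 + (n + 1 : ℝ)⁻¹ * ‖z‖ ^ 2)⁻¹) := by
      have : (1 + (n + 1 : ℝ)⁻¹ * ‖z‖ ^ 2) ≠ 0 := by positivity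
      field_simp
      ring
    rw [truncCubic, h1]
    push_cast
    ring
  rw [dist_eq_norm, dist_eq_norm, e, e, ← mul_sub, norm_mul, Complex.norm_real,
    Real.norm_of_nonneg hn.le]
  have h := norm_resolvent_sub_le (ε := (n + 1 : ℝ)⁻¹) (by positivity) z w
  have h2 : ‖z - (((1 + (n + 1 : ℝ)⁻¹ * ‖z‖ ^ 2)⁻¹ : ℝ) : ℂ) * z -
      (w - (((1 + (n + 1 : ℝ)⁻¹ * ‖w‖ ^ 2)⁻¹ : ℝ) : ℂ) * w)‖ ≤ 2 * ‖z - w‖ := by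
    have e2 : ∀ a b c d : ℂ, a - b - (c - d) = (a - c) - (b - d) := fun a b c d => by ring
    rw [e2]
    refine (norm_sub_le _ _).trans ?_
    linarith
  have h3 : (((2 * (n + 1) : ℝ≥0)) : ℝ) = 2 * (n + 1) := by push_cast; ring
  rw [h3]
  calc _ ≤ (n + 1 : ℝ) * (2 * ‖z - w‖) := by gcongr
    _ = _ := by ring

theorem truncCubic_zero (n : ℕ) : truncCubic n 0 = 0 := by simp [truncCubic]

theorem norm_truncCubic_le (n : ℕ) (z : ℂ) : ‖truncCubic n z‖ ≤ ‖z‖ ^ 3 := by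
  rw [truncCubic, norm_mul, Complex.norm_real, Real.norm_of_nonneg (by positivity)]
  have : ‖z‖ ^ 2 / (1 + (n + 1 : ℝ)⁻¹ * ‖z‖ ^ 2) ≤ ‖z‖ ^ 2 :=
    div_le_self (by positivity) (by have : 0 ≤ (n + 1 : ℝ)⁻¹ * ‖z‖ ^ 2 := by positivity
                                    linarith)
  calc _ ≤ ‖z‖ ^ 2 * ‖z‖ := by gcongr
    _ = _ := by ring

theorem tendsto_truncCubic (z : ℂ) :
    Filter.Tendsto (fun n => truncCubic n z) Filter.atTop (𝓝 (((‖z‖ ^ 2 : ℝ) : ℂ) * z)) := by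
  unfold truncCubic
  have h1 : Filter.Tendsto (fun n : ℕ => (n + 1 : ℝ)⁻¹) Filter.atTop (𝓝 0) := by
    simpa using tendsto_one_div_add_atTop_nhds_zero_nat (𝕜 := ℝ)
  have h2 : Filter.Tendsto (fun n : ℕ => ‖z‖ ^ 2 / (1 + (n + 1 : ℝ)⁻¹ * ‖z‖ ^ 2)) Filter.atTop
      (𝓝 (‖z‖ ^ 2)) := by
    have h3 := (h1.mul_const (‖z‖ ^ 2)).const_add 1
    have := (tendsto_const_nhds (x := ‖z‖ ^ 2) (f := Filter.atTop (α := ℕ))).div h3 (by simp)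
    rw [zero_mul, add_zero, div_one] at this
    exact this
  exact ((Complex.continuous_ofReal.tendsto _).comp h2).mul_const z

/-- The Nemytskii operator of `truncCubic` on `L²`. -/
def truncCubicLp (n : ℕ) (f : L2Space) : L2Space :=
  (lipschitzWith_truncCubic n).compLp (truncCubic_zero n) f

theorem coeFn_truncCubicLp (n : ℕ) (f : L2Space) :
    truncCubicLp n f =ᵐ[volume] fun x => truncCubic n (f x) :=
  (lipschitzWith_truncCubic n).coeFn_compLp (truncCubic_zero n) f

theorem continuous_truncCubicLp (n : ℕ) : Continuous (truncCubicLp n) :=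
  (lipschitzWith_truncCubic n).continuous_compLp (truncCubic_zero n)

/-- The truncations increase in modulus no further than `|f|³ = |g|`, which serves as the dominating
function. -/
theorem tendsto_truncCubicLp {f g : L2Space}
    (hg : ∀ᵐ x, g x = ((‖f x‖ ^ 2 : ℝ) : ℂ) * f x) :
    Filter.Tendsto (fun n => truncCubicLp n f) Filter.atTop (𝓝 g) := by
  refine tendsto_L2_of_dominated (b := fun x => ‖g x‖) (integrable_norm_sq g) (fun n => ?_) ?_
  · filter_upwards [hg, coeFn_truncCubicLp n f] with x h1 h2
    rw [h1, h2, norm_mul, Complex.norm_real, Real.norm_of_nonneg (by positivity)]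
    exact (norm_truncCubic_le n _).trans_eq (by ring)
  · have h : ∀ᵐ x, ∀ n, truncCubicLp n f x = truncCubic n (f x) :=
      ae_all_iff.2 fun n => coeFn_truncCubicLp n f
    filter_upwards [hg, h] with x h1 h2
    simp only [h1, h2]
    exact tendsto_truncCubic (f x)

attribute [irreducible] truncCubicLp

/-- The potential density `∫₀ˢ r / (1 + ε r) dr` of the truncated cubic nonlinearity. -/
def truncPotential (n : ℕ) (s : ℝ) : ℝ :=
  (n + 1) * s - (n + 1) ^ 2 * Real.log (1 + (n + 1 : ℝ)⁻¹ * s)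

theorem hasDerivAt_truncPotential (n : ℕ) {s : ℝ} (hs : 0 ≤ s) :
    HasDerivAt (truncPotential n) (s / (1 + (n + 1 : ℝ)⁻¹ * s)) s := by
  have hp : (1 + (n + 1 : ℝ)⁻¹ * s) ≠ 0 := by positivity
  have h1 : HasDerivAt (fun s : ℝ => 1 + (n + 1 : ℝ)⁻¹ * s) ((n + 1 : ℝ)⁻¹) s := by
    simpa using ((hasDerivAt_id s).const_mul ((n + 1 : ℝ)⁻¹)).const_add 1
  have h2 := ((hasDerivAt_id s).const_mul (n + 1 : ℝ)).sub ((h1.log hp).const_mul ((n + 1 : ℝ) ^ 2))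
  refine h2.congr_deriv ?_
  field_simp
  ring

theorem truncPotential_nonneg (n : ℕ) {s : ℝ} (hs : 0 ≤ s) : 0 ≤ truncPotential n s := by
  have h := Real.log_le_sub_one_of_pos (x := 1 + (n + 1 : ℝ)⁻¹ * s) (by positivity)
  have h2 : ((n : ℝ) + 1) ^ 2 * Real.log (1 + (n + 1 : ℝ)⁻¹ * s) ≤
      ((n : ℝ) + 1) ^ 2 * ((n + 1 : ℝ)⁻¹ * s) := by
    gcongr; linarith
  have h3 : ((n : ℝ) + 1) ^ 2 * ((n + 1 : ℝ)⁻¹ * s) = (n + 1) * s := by field_simp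
  rw [truncPotential]
  linarith

/-- The integrand `r / (1 + ε r)` is nondecreasing, so its integral over `[0, s]` is at most `s`
times its final value; in closed form this is `1 - 1/x ≤ log x`. -/
theorem truncPotential_le (n : ℕ) {s : ℝ} (hs : 0 ≤ s) :
    truncPotential n s ≤ s * (s / (1 + (n + 1 : ℝ)⁻¹ * s)) := by
  have hp : 0 < 1 + (n + 1 : ℝ)⁻¹ * s := by positivity
  have h := Real.one_sub_inv_le_log_of_pos hp
  have h2 : ((n : ℝ) + 1) ^ 2 * (1 - (1 + (n + 1 : ℝ)⁻¹ * s)⁻¹) ≤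
      ((n : ℝ) + 1) ^ 2 * Real.log (1 + (n + 1 : ℝ)⁻¹ * s) := by gcongr
  have h3 : (n + 1) * s - ((n : ℝ) + 1) ^ 2 * (1 - (1 + (n + 1 : ℝ)⁻¹ * s)⁻¹) =
      s * (s / (1 + (n + 1 : ℝ)⁻¹ * s)) := by
    have := hp.ne'
    field_simp
    ring
  rw [truncPotential]
  linarith

/-! ### Sign of the nonlinear contribution -/

theorem integral_weight_lineDeriv {k : Fin 3} {W W' : Weight} (h : HasPartial k W W') (y : Space3)
    {G G' : Space3 → ℝ} (hG : Integrable G) (hG' : Integrable G')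
    (hd : ∀ x, HasLineDerivAt ℝ G (G' x) x (basisVec k)) :
    ∫ x, W.translate y x * G' x = -∫ x, W'.translate y x * G x := by
  have := integral_bilinear_hasLineDerivAt_right_eq_neg_left_of_integrable (μ := volume)
    (f := W.translate y) (f' := W'.translate y) (g := G) (g' := G') (v := basisVec k)
    (B := ContinuousLinearMap.mul ℝ ℝ)
    (integrable_bcf_mul hG) (integrable_bcf_mul hG') (integrable_bcf_mul hG)
    (fun x _ => h.translate y x) (fun x _ => hd x)
  simpa using this

theorem hasLineDerivAt_truncPotential (n : ℕ) (φ : 𝓢(Space3, ℂ)) (v x : Space3) :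
    HasLineDerivAt ℝ (fun x => truncPotential n (‖φ x‖ ^ 2))
      (2 * inner ℝ (truncCubic n (φ x)) (∂_{v} φ x)) x v := by
  have h1 := (φ.hasFDerivAt x).norm_sq
  have h2 := ((hasDerivAt_truncPotential n (sq_nonneg ‖φ x‖)).comp_hasFDerivAt x h1).hasLineDerivAt v
  refine h2.congr_deriv ?_
  rw [truncCubic, inner_ofReal_mul_left, SchwartzMap.lineDerivOp_apply_eq_fderiv]
  simp
  ring


theorem integral_mul_two_mul_add {p b c : Space3 → ℝ} (hb : Integrable fun y => p y * b y)
    (hc : Integrable fun y => p y * c y) :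
    ∫ y, p y * (2 * b y + c y) = 2 * (∫ y, p y * b y) + ∫ y, p y * c y := by
  rw [← integral_const_mul, ← integral_add (hb.const_mul 2) hc]
  refine integral_congr_ae (Filter.Eventually.of_forall fun y => ?_)
  simp only []
  ring

theorem two_mul_potential (W : Weight) (y : Space3) {q : Lp (α := Space3) ℝ 1 volume}
    {g : Space3 → ℝ} (h : ∀ᵐ x, 2 * q x = g x) :
    2 * potential W y q = ∫ x, W.translate y x * g x := by
  rw [potential_apply, ← integral_const_mul]
  refine integral_congr_ae ?_
  filter_upwards [h] with x hx
  rw [← hx]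
  exact mul_left_comm _ _ _

theorem sum_two_mul_add_sub {a b : Fin 3 → ℝ} {c d : ℝ} (ha : ∀ j, a j = 0) (hc : c = -d) :
    ∑ j, (2 * a j + 2 * b j) - c = 2 * ∑ j, b j + d := by
  simp only [ha, hc, Finset.mul_sum]
  simp

section Morawetz

variable (δ : ℝ) [hδ : Fact (0 < δ)]

/-- Integrating the gradient of the potential density `G` by parts gives `-∫ Δa G`. Because `Δa ≥
0`, it is outweighed by `∫ Δa p` as soon as `G ≤ p`. -/
theorem two_mul_sum_potential_radial_nonneg (y : Space3) {G : Space3 → ℝ}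
    {G' : Fin 3 → Space3 → ℝ} {p : Lp (α := Space3) ℝ 1 volume}
    {q : Fin 3 → Lp (α := Space3) ℝ 1 volume} (iG : Integrable G)
    (hq : ∀ j, ∀ᵐ x, 2 * q j x = G' j x) (hp : ∀ᵐ x, G x ≤ p x)
    (hd : ∀ j x, HasLineDerivAt ℝ G (G' j x) x (basisVec j)) :
    0 ≤ 2 * ∑ j, potential (radial δ j) y (q j) + potential (radialDiv δ) y p := by
  have iG' : ∀ j, Integrable (G' j) := fun j =>
    ((L1.integrable_coeFn (q j)).const_mul 2).congr (hq j)
  have hj : ∀ j, 2 * potential (radial δ j) y (q j) =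
      -∫ x, (radialHess δ j j).translate y x * G x := by
    intro j
    rw [← integral_weight_lineDeriv (hasPartial_radial δ j j) y iG (iG' j) (hd j)]
    exact two_mul_potential _ y (hq j)
  have hs : ∑ j, ∫ x, (radialHess δ j j).translate y x * G x =
      ∫ x, (radialDiv δ).translate y x * G x := by
    rw [← integral_finsetSum _ fun j _ => integrable_bcf_mul iG]
    refine integral_congr_ae (Filter.Eventually.of_forall fun x => ?_)
    simp only [BoundedContinuousFunction.translate_apply]
    rw [← Finset.sum_mul, ← sum_radialHess, BoundedContinuousFunction.sum_apply]
  rw [Finset.mul_sum, Finset.sum_congr rfl fun j _ => hj j, Finset.sum_neg_distrib, hs,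
    potential_apply, neg_add_eq_sub, sub_nonneg]
  refine integral_mono_ae (integrable_bcf_mul (W := (radialDiv δ).translate y) iG)
    (integrable_bcf_mul (W := (radialDiv δ).translate y) (L1.integrable_coeFn p)) ?_
  filter_upwards [hp] with x h
  rw [BoundedContinuousFunction.translate_apply]
  refine mul_le_mul_of_nonneg_left h ?_
  rw [radialDiv_apply]
  have := invDist_pos δ (x - y)
  positivity

theorem potential_innerL1_truncCubic_schwartz_nonneg (n : ℕ) (y : Space3) (φ : 𝓢(Space3, ℂ))
    {F : L2Space} (hFφ : ∀ᵐ x, F x = truncCubic n (φ x)) :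
    0 ≤ 2 * ∑ j, potential (radial δ j) y (innerL1 F ((∂_{basisVec j} φ).toLp 2)) +
        potential (radialDiv δ) y (innerL1 (φ.toLp 2) F) := by
  let G : Space3 → ℝ := fun x => truncPotential n (‖φ x‖ ^ 2)
  have q1 : ∀ᵐ x, innerL1 (φ.toLp 2) F x =
      ‖φ x‖ ^ 2 * (‖φ x‖ ^ 2 / (1 + (n + 1 : ℝ)⁻¹ * ‖φ x‖ ^ 2)) := by
    filter_upwards [coeFn_innerL1 (φ.toLp 2) F, hFφ, φ.coeFn_toLp 2 volume] with x h1 h2 h3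
    rw [h1, h2, h3, real_inner_comm, truncCubic, inner_ofReal_mul_left, real_inner_self_eq_norm_sq]
    ring
  have q2 : ∀ j, ∀ᵐ x, 2 * innerL1 F ((∂_{basisVec j} φ).toLp 2) x =
      2 * inner ℝ (truncCubic n (φ x)) ((∂_{basisVec j} φ : 𝓢(Space3, ℂ)) x) := by
    intro j
    filter_upwards [coeFn_innerL1 F ((∂_{basisVec j} φ).toLp 2), hFφ,
      (∂_{basisVec j} φ : 𝓢(Space3, ℂ)).coeFn_toLp 2 volume] with x h1 h2 h3
    rw [h1, h2, h3]
  have iF : Integrable (innerL1 (φ.toLp 2) F) := L1.integrable_coeFn _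
  have hGm : Continuous G := by
    refine continuous_iff_continuousAt.2 fun x => ?_
    exact ContinuousAt.comp (f := fun x => ‖φ x‖ ^ 2)
      (hasDerivAt_truncPotential n (sq_nonneg ‖φ x‖)).continuousAt
      (φ.continuous.norm.pow 2).continuousAt
  have iG : Integrable G := by
    refine iF.mono' hGm.aestronglyMeasurable ?_
    filter_upwards [q1] with x h
    rw [h, Real.norm_of_nonneg (truncPotential_nonneg n (sq_nonneg _))]
    exact truncPotential_le n (sq_nonneg _)
  refine two_mul_sum_potential_radial_nonneg δ y iG q2 ?_
    fun j x => hasLineDerivAt_truncPotential n φ _ x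
  filter_upwards [q1] with x h
  rw [h]
  exact truncPotential_le n (sq_nonneg _)

/-- Continuity of the truncated nonlinearity on `L²` makes the inequality a closed condition on `(f,
Df)`, so it extends from Schwartz functions. -/
theorem potential_innerL1_truncCubic_nonneg (n : ℕ) (y : Space3) {f : L2Space}
    {Df : Fin 3 → L2Space} (hf : IsGradient f Df) :
    0 ≤ 2 * ∑ j, potential (radial δ j) y (innerL1 (truncCubicLp n f) (Df j)) +
        potential (radialDiv δ) y (innerL1 f (truncCubicLp n f)) := by
  have c1 : Continuous fun z : L2Space × (Fin 3 → L2Space) => z.1 := continuous_fst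
  have c2 : ∀ j, Continuous fun z : L2Space × (Fin 3 → L2Space) => z.2 j := fun j =>
    (continuous_apply j).comp continuous_snd
  have c3 : Continuous fun z : L2Space × (Fin 3 → L2Space) => truncCubicLp n z.1 :=
    (continuous_truncCubicLp n).comp c1
  have c4 : Continuous fun z : L2Space × (Fin 3 → L2Space) =>
      2 * ∑ j, potential (radial δ j) y (innerL1 (truncCubicLp n z.1) (z.2 j)) +
        potential (radialDiv δ) y (innerL1 z.1 (truncCubicLp n z.1)) :=
    (continuous_const.mul (continuous_finsetSum _ fun j _ => (c3.innerL1 (c2 j)).potential _ y)).add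
      ((c1.innerL1 c3).potential _ y)
  refine hf.induction_schwartz (p := fun f Df =>
    0 ≤ 2 * ∑ j, potential (radial δ j) y (innerL1 (truncCubicLp n f) (Df j)) +
        potential (radialDiv δ) y (innerL1 f (truncCubicLp n f))) ?_ ?_
  · exact isClosed_le continuous_const c4
  · intro φ
    refine potential_innerL1_truncCubic_schwartz_nonneg δ n y φ ?_
    filter_upwards [coeFn_truncCubicLp n (φ.toLp 2), φ.coeFn_toLp 2 volume] with x h1 h2
    rw [h1, h2]

theorem innerL1_I_smul_truncCubicLp (n : ℕ) (f : L2Space) :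
    innerL1 f (Complex.I • truncCubicLp n f) = 0 := by
  refine Lp.ext ?_
  filter_upwards [coeFn_innerL1 f (Complex.I • truncCubicLp n f), coeFn_truncCubicLp n f,
    Lp.coeFn_smul Complex.I (truncCubicLp n f), Lp.coeFn_zero ℝ 1 volume] with x h1 h2 h3 h4
  rw [h1, h3, h4, Pi.smul_apply, h2, truncCubic, smul_eq_mul, mul_left_comm]
  generalize ‖f x‖ ^ 2 / (1 + (n + 1 : ℝ)⁻¹ * ‖f x‖ ^ 2) = a
  simp only [Complex.inner, Complex.mul_re, Complex.conj_re, Complex.conj_im, Complex.ofReal_re,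
    Complex.ofReal_im, Complex.I_re, Complex.I_im, Complex.mul_im, Pi.zero_apply]
  ring

theorem convForm_zero_left (k : Weight) (q : Lp (α := Space3) ℝ 1 volume) :
    convForm k 0 q = 0 := by
  rw [map_zero]; rfl

/-- Hypothesis `hz` says that `h` does not change the mass density. Only the momentum terms remain,
and they are integrated against that density. -/
theorem morawetzDeriv_eq_integral {f F h : L2Space} (Df : Fin 3 → L2Space)
    (hz : innerL1 f h = 0) (hF : Complex.I • h = F)
    (hn : innerL1 (Complex.I • f) h = -innerL1 f F) :
    morawetzDeriv δ f Df h = ∫ y, innerL1 f f y *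
      (2 * ∑ j, potential (radial δ j) y (innerL1 F (Df j)) +
        potential (radialDiv δ) y (innerL1 f F)) := by
  have h1 := integral_mul_two_mul_add
    (integrable_mul_sum_potential (radial δ) (innerL1 f f) fun j => innerL1 F (Df j))
    (integrable_mul_potential (radialDiv δ) (innerL1 f f) (innerL1 f F))
  subst hF
  have e1 : ∀ j, convForm (radial δ j) (innerL1 f h) (innerL1 (Complex.I • f) (Df j)) = 0 :=
    fun j => (congrArg (fun p => convForm (radial δ j) p (innerL1 (Complex.I • f) (Df j))) hz).trans
      (convForm_zero_left _ _)
  have e2 : convForm (radialDiv δ) (innerL1 f f) (innerL1 (Complex.I • f) h) =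
      -convForm (radialDiv δ) (innerL1 f f) (innerL1 f (Complex.I • h)) :=
    (congrArg (convForm (radialDiv δ) (innerL1 f f)) hn).trans (map_neg _ _)
  rw [h1, ← sum_convForm_eq_integral, ← convForm_apply, morawetzDeriv]
  exact sum_two_mul_add_sub e1 e2

theorem morawetzDeriv_neg_I_smul (f F : L2Space) (Df : Fin 3 → L2Space)
    (hz : innerL1 f (Complex.I • F) = 0) :
    morawetzDeriv δ f Df (-(Complex.I • F)) = ∫ y, innerL1 f f y *
      (2 * ∑ j, potential (radial δ j) y (innerL1 F (Df j)) +
        potential (radialDiv δ) y (innerL1 f F)) := by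
  refine morawetzDeriv_eq_integral δ Df ?_ ?_ ?_
  · rw [map_neg, hz, neg_zero]
  · rw [smul_neg, smul_smul, Complex.I_mul_I, neg_one_smul, neg_neg]
  · rw [map_neg, innerL1_I_smul_I_smul]

theorem morawetzDeriv_truncCubic_nonneg (n : ℕ) {f : L2Space} {Df : Fin 3 → L2Space}
    (hf : IsGradient f Df) : 0 ≤ morawetzDeriv δ f Df (-(Complex.I • truncCubicLp n f)) := by
  rw [morawetzDeriv_neg_I_smul δ f _ Df (innerL1_I_smul_truncCubicLp n f)]
  refine integral_nonneg_of_ae ?_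
  filter_upwards [innerL1_self_nonneg f] with y h
  exact mul_nonneg h (potential_innerL1_truncCubic_nonneg δ n y hf)

theorem continuous_morawetzDeriv_right (f : L2Space) (Df : Fin 3 → L2Space) :
    Continuous fun h : L2Space => morawetzDeriv δ f Df h := by
  let F : L2Space → L2Space × (Fin 3 → L2Space) × L2Space := fun h => (f, Df, h)
  have c : Continuous F := continuous_const.prodMk (continuous_const.prodMk continuous_id)
  exact (continuous_morawetzDeriv δ).comp c

/-- The cubic nonlinearity has the defocusing sign in the interaction Morawetz identity. -/
theorem morawetzDeriv_cubic_nonneg {f g : L2Space} {Df : Fin 3 → L2Space} (hf : IsGradient f Df)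
    (hg : ∀ᵐ x, g x = ((‖f x‖ ^ 2 : ℝ) : ℂ) * f x) :
    0 ≤ morawetzDeriv δ f Df (-(Complex.I • g)) := by
  have h1 := tendsto_truncCubicLp hg
  have c : Continuous fun h : L2Space => -(Complex.I • h) := (continuous_const_smul Complex.I).neg
  have h2 := (continuous_morawetzDeriv_right δ f Df).comp c
  have h3 := (h2.tendsto g).comp h1
  -- Only the forcing argument is approximated, `f` and its gradient stay fixed; that is why `g ∈
  -- L²` suffices here.
  refine ge_of_tendsto' h3 fun n => ?_
  exact morawetzDeriv_truncCubic_nonneg δ n hf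

end Morawetz

/-! ### Primitives of integrable functions -/

section Primitive

variable {E F G : Type*} [NormedAddCommGroup E] [NormedSpace ℝ E] [NormedAddCommGroup F]
  [NormedSpace ℝ F] [NormedAddCommGroup G] [NormedSpace ℝ G]

/-- `u` is absolutely continuous on `[0, T]`, with the integrable derivative `u'`. -/
structure IsPrimitive (T : ℝ) (u u' : ℝ → E) : Prop where
  integrable : IntegrableOn u' (Ioc 0 T)
  eq : ∀ t ∈ Icc 0 T, u t = u 0 + ∫ s in Ioc 0 t, u' s

theorem IsPrimitive.continuousOn {T : ℝ} {u u' : ℝ → E} (h : IsPrimitive T u u') :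
    ContinuousOn u (Icc 0 T) := by
  have h1 := intervalIntegral.continuousOn_primitive ((integrableOn_Icc_iff_integrableOn_Ioc (by simp)).2 h.1)
  exact (continuousOn_const.add h1).congr h.2

theorem IsPrimitive.congr_deriv {T : ℝ} {u u' v' : ℝ → E} (h : IsPrimitive T u u')
    (hv : ∀ s ∈ Ioc 0 T, u' s = v' s) : IsPrimitive T u v' := by
  refine ⟨h.1.congr_fun hv measurableSet_Ioc, fun t ht => ?_⟩
  rw [h.2 t ht]
  congr 1
  exact setIntegral_congr_fun measurableSet_Ioc fun s hs => hv s ⟨hs.1, hs.2.trans ht.2⟩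

theorem IsPrimitive.finsetSum {ι : Type*} {T : ℝ} {u u' : ι → ℝ → E} (S : Finset ι)
    (h : ∀ i, IsPrimitive T (u i) (u' i)) :
    IsPrimitive T (fun t => ∑ i ∈ S, u i t) (fun t => ∑ i ∈ S, u' i t) := by
  refine ⟨integrable_finsetSum _ fun i _ => (h i).1, fun t ht => ?_⟩
  rw [integral_finsetSum _ fun i _ => (h i).1.mono_set (Ioc_subset_Ioc_right ht.2),
    ← Finset.sum_add_distrib]
  exact Finset.sum_congr rfl fun i _ => (h i).2 t ht

/-- Fubini turns the second term into the other triangle of the square; the diagonal is null. -/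
theorem integral_triangle_add_integral_triangle [CompleteSpace G] {t : ℝ} {Φ : ℝ → ℝ → G}
    (hΦ : Integrable (fun z : ℝ × ℝ => Φ z.1 z.2)
      ((volume.restrict (Ioc 0 t)).prod (volume.restrict (Ioc 0 t)))) :
    (∫ s in Ioc 0 t, ∫ r in Ioc 0 s, Φ s r) + ∫ s in Ioc 0 t, ∫ r in Ioc 0 s, Φ r s =
      ∫ s in Ioc 0 t, ∫ r in Ioc 0 t, Φ s r := by
  set μ : Measure ℝ := volume.restrict (Ioc 0 t) with hμ
  have e : ∀ (f : ℝ → ℝ → G), ∫ s in Ioc 0 t, ∫ r in Ioc 0 s, f s r =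
      ∫ s, ∫ r, (Iic s).indicator (fun r => f s r) r ∂μ ∂μ := by
    intro f
    refine setIntegral_congr_fun measurableSet_Ioc fun s hs => ?_
    rw [integral_indicator measurableSet_Iic, hμ, Measure.restrict_restrict measurableSet_Iic]
    congr 2
    ext r
    simp only [mem_inter_iff, mem_Iic, mem_Ioc]
    constructor
    · exact fun h => ⟨h.2, h.1, h.2.trans hs.2⟩
    · exact fun h => ⟨h.2.1, h.1⟩
  have m1 : MeasurableSet {z : ℝ × ℝ | z.2 ≤ z.1} := measurableSet_le measurable_snd measurable_fst
  have m2 : MeasurableSet {z : ℝ × ℝ | z.1 ≤ z.2} := measurableSet_le measurable_fst measurable_snd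
  have i1 := hΦ.indicator m1
  have i2 := hΦ.indicator m2
  have e1 : ∫ s, ∫ r, (Iic s).indicator (fun r => Φ s r) r ∂μ ∂μ =
      ∫ s, ∫ r, ({z : ℝ × ℝ | z.2 ≤ z.1}.indicator (fun z : ℝ × ℝ => Φ z.1 z.2)) (s, r) ∂μ ∂μ := rfl
  have e2 : ∫ s, ∫ r, (Iic s).indicator (fun r => Φ r s) r ∂μ ∂μ =
      ∫ s, ∫ r, ({z : ℝ × ℝ | z.1 ≤ z.2}.indicator (fun z : ℝ × ℝ => Φ z.1 z.2)) (s, r) ∂μ ∂μ := by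
    rw [integral_integral_swap (f := fun s r =>
      ({z : ℝ × ℝ | z.1 ≤ z.2}.indicator (fun z : ℝ × ℝ => Φ z.1 z.2)) (s, r)) i2]
    rfl
  rw [e Φ, e fun s r => Φ r s, e1, e2, ← integral_add i1.integral_prod_left i2.integral_prod_left]
  refine integral_congr_ae ?_
  filter_upwards [i1.prod_right_ae, i2.prod_right_ae] with s h1 h2
  rw [← integral_add h1 h2]
  refine integral_congr_ae ?_
  have hne : ∀ᵐ r ∂μ, r ≠ s := ae_restrict_of_ae (Measure.ae_ne volume s)
  filter_upwards [hne] with r hr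
  rcases lt_or_gt_of_ne hr with h | h
  · rw [indicator_of_mem (by exact h.le), indicator_of_notMem (by simpa using h), add_zero]
  · rw [indicator_of_notMem (by simpa using h), indicator_of_mem (by exact h.le), zero_add]

/-- The product rule for a bilinear map. -/
theorem IsPrimitive.bilinear [CompleteSpace E] [CompleteSpace F] [CompleteSpace G] {T : ℝ}
    {u u' : ℝ → E} {v v' : ℝ → F} (hu : IsPrimitive T u u') (hv : IsPrimitive T v v')
    (B : E →L[ℝ] F →L[ℝ] G) :
    IsPrimitive T (fun t => B (u t) (v t)) (fun t => B (u' t) (v t) + B (u t) (v' t)) := by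
  have hi : ∀ (f : ℝ → E) (g : ℝ → F), IntegrableOn f (Ioc 0 T) → ContinuousOn g (Icc 0 T) →
      IntegrableOn (fun t => B (f t) (g t)) (Ioc 0 T) := by
    intro f g hf hg
    obtain ⟨C, hC⟩ := isCompact_Icc.exists_bound_of_continuousOn hg
    have hgm := (hg.mono Ioc_subset_Icc_self).aestronglyMeasurable (μ := volume) measurableSet_Ioc
    refine (hf.norm.const_mul (‖B‖ * C)).mono'
      (B.aestronglyMeasurable_comp₂ hf.aestronglyMeasurable hgm) ?_
    filter_upwards [ae_restrict_mem measurableSet_Ioc] with s hs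
    refine (B.le_opNorm₂ _ _).trans ?_
    have := hC s (Ioc_subset_Icc_self hs)
    calc _ ≤ ‖B‖ * ‖f s‖ * C := by gcongr
      _ = _ := by ring
  have i1 := hi u' v hu.1 hv.continuousOn
  have i2 : IntegrableOn (fun t => B (u t) (v' t)) (Ioc 0 T) := by
    obtain ⟨C, hC⟩ := isCompact_Icc.exists_bound_of_continuousOn hu.continuousOn
    have hgm := (hu.continuousOn.mono Ioc_subset_Icc_self).aestronglyMeasurable (μ := volume)
      measurableSet_Ioc
    refine (hv.1.norm.const_mul (‖B‖ * C)).mono'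
      (B.aestronglyMeasurable_comp₂ hgm hv.1.aestronglyMeasurable) ?_
    filter_upwards [ae_restrict_mem measurableSet_Ioc] with s hs
    refine (B.le_opNorm₂ _ _).trans ?_
    have := hC s (Ioc_subset_Icc_self hs)
    gcongr
  refine ⟨i1.add i2, fun t ht => ?_⟩
  have hsub : Ioc 0 t ⊆ Ioc 0 T := Ioc_subset_Ioc_right ht.2
  have iu : IntegrableOn u' (Ioc 0 t) := hu.1.mono_set hsub
  have iv : IntegrableOn v' (Ioc 0 t) := hv.1.mono_set hsub
  have iΦ : Integrable (fun z : ℝ × ℝ => B (u' z.1) (v' z.2))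
      ((volume.restrict (Ioc 0 t)).prod (volume.restrict (Ioc 0 t))) :=
    iu.op_fst_snd (op := fun x y => B x y) (by fun_prop) ⟨‖B‖, B.le_opNorm₂⟩ iv
  -- Inserting the primitives of `v` and `u` into the two product-rule terms leaves exactly the two
  -- triangle integrals of `B (u' s) (v' r)`.
  have htri := integral_triangle_add_integral_triangle (Φ := fun s r => B (u' s) (v' r)) iΦ
  have a1 : ∫ s in Ioc 0 t, B (u' s) (v s) =
      B (∫ s in Ioc 0 t, u' s) (v 0) + ∫ s in Ioc 0 t, ∫ r in Ioc 0 s, B (u' s) (v' r) := by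
    have h1 : ∀ s ∈ Ioc 0 t, B (u' s) (v s) = B.flip (v 0) (u' s) + ∫ r in Ioc 0 s, B (u' s) (v' r) := by
      intro s hs
      have hs' : s ∈ Icc 0 T := ⟨hs.1.le, hs.2.trans ht.2⟩
      rw [(B (u' s)).integral_comp_comm (hv.1.mono_set (Ioc_subset_Ioc_right hs'.2)), hv.2 s hs',
        map_add]
      rfl
    have i3 : IntegrableOn (fun s => B.flip (v 0) (u' s)) (Ioc 0 t) :=
      (B.flip (v 0)).integrable_comp iu
    have i4 : IntegrableOn (fun s => ∫ r in Ioc 0 s, B (u' s) (v' r)) (Ioc 0 t) := by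
      refine ((i1.mono_set hsub).sub i3).congr_fun (fun s hs => ?_) measurableSet_Ioc
      simp only [Pi.sub_apply]
      rw [h1 s hs, add_sub_cancel_left]
    rw [setIntegral_congr_fun measurableSet_Ioc h1, integral_add i3 i4,
      (B.flip (v 0)).integral_comp_comm iu]
    rfl
  have a2 : ∫ s in Ioc 0 t, B (u s) (v' s) =
      B (u 0) (∫ s in Ioc 0 t, v' s) + ∫ s in Ioc 0 t, ∫ r in Ioc 0 s, B (u' r) (v' s) := by
    have h1 : ∀ s ∈ Ioc 0 t, B (u s) (v' s) = B (u 0) (v' s) + ∫ r in Ioc 0 s, B (u' r) (v' s) := by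
      intro s hs
      have hs' : s ∈ Icc 0 T := ⟨hs.1.le, hs.2.trans ht.2⟩
      have h2 := (B.flip (v' s)).integral_comp_comm (hu.1.mono_set (Ioc_subset_Ioc_right hs'.2))
      simp only [ContinuousLinearMap.flip_apply] at h2
      rw [h2, hu.2 s hs', map_add]
      rfl
    have i3 : IntegrableOn (fun s => B (u 0) (v' s)) (Ioc 0 t) := (B (u 0)).integrable_comp iv
    have i4 : IntegrableOn (fun s => ∫ r in Ioc 0 s, B (u' r) (v' s)) (Ioc 0 t) := by
      refine ((i2.mono_set hsub).sub i3).congr_fun (fun s hs => ?_) measurableSet_Ioc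
      simp only [Pi.sub_apply]
      rw [h1 s hs, add_sub_cancel_left]
    rw [setIntegral_congr_fun measurableSet_Ioc h1, integral_add i3 i4,
      (B (u 0)).integral_comp_comm iv]
  have a3 : ∫ s in Ioc 0 t, ∫ r in Ioc 0 t, B (u' s) (v' r) =
      B (∫ s in Ioc 0 t, u' s) (∫ s in Ioc 0 t, v' s) := by
    have h1 : ∀ s, ∫ r in Ioc 0 t, B (u' s) (v' r) = B.flip (∫ r in Ioc 0 t, v' r) (u' s) :=
      fun s => (B (u' s)).integral_comp_comm iv
    simp only [h1]
    exact (B.flip _).integral_comp_comm iu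
  rw [integral_add (i1.mono_set hsub) (i2.mono_set hsub), a1, a2, hu.2 t ht, hv.2 t ht]
  simp only [map_add, add_apply]
  rw [← a3, ← htri]
  abel

end Primitive

/-! ### The equation, localized in frequency -/

/-- The functional `f ↦ ∫ ψ 𝓕f` on `L²`. -/
def fourierPairing (ψ : 𝓢(Space3, ℂ)) : L2Space →L[ℂ] ℂ :=
  (PointwiseConvergenceCLM.evalCLM (RingHom.id ℂ) ℂ ψ).comp
    ((Lp.toTemperedDistributionCLM ℂ volume 2).comp (FourierTransform.fourierCLM ℂ L2Space))

theorem fourierPairing_apply (ψ : 𝓢(Space3, ℂ)) (f : L2Space) :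
    fourierPairing ψ f = ∫ ξ, ψ ξ * (𝓕 f : L2Space) ξ := by
  have : fourierPairing ψ f = ((𝓕 f : L2Space) : 𝓢'(Space3, ℂ)) ψ := rfl
  rw [this, Lp.toTemperedDistribution_apply]
  simp only [smul_eq_mul]

theorem eq_of_fourierPairing {f g : L2Space} (h : ∀ ψ, fourierPairing ψ f = fourierPairing ψ g) :
    f = g := by
  simp only [fourierPairing_apply] at h
  have h1 := L2_ext_of_integral_schwartz h
  exact (FourierTransform.fourierCLE ℂ L2Space).injective h1

theorem fourierPairing_schwartzMul (ψ χ : 𝓢(Space3, ℂ)) (f : L2Space) :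
    fourierPairing ψ (schwartzMul χ f) =
      ∫ x, f x * (𝓕 (SchwartzMap.pairing (ContinuousLinearMap.mul ℂ ℂ) χ ψ) : 𝓢(Space3, ℂ)) x := by
  rw [fourierPairing_apply, integral_mul_fourier]
  refine integral_congr_ae ?_
  filter_upwards [coeFn_fourier_schwartzMul χ f] with ξ h
  rw [h, SchwartzMap.pairing_apply_apply, ContinuousLinearMap.mul_apply']
  ring

theorem fourierPairing_schwartzMul_lapSchwartz (ψ χ : 𝓢(Space3, ℂ)) (f : L2Space) :
    fourierPairing ψ (schwartzMul (lapSchwartz χ) f) =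
      ∫ x, f x * (Δ (𝓕 (SchwartzMap.pairing (ContinuousLinearMap.mul ℂ ℂ) χ ψ)) :
        𝓢(Space3, ℂ)) x := by
  rw [fourierPairing_apply, integral_mul_laplacian_fourier]
  refine integral_congr_ae ?_
  filter_upwards [coeFn_fourier_schwartzMul (lapSchwartz χ) f] with ξ h
  rw [h, lapSchwartz_apply, SchwartzMap.pairing_apply_apply, ContinuousLinearMap.mul_apply']
  ring

theorem isPrimitive_schwartzMul {T : ℝ} {w g : ℝ → L2Space} (hw : ContinuousOn w (Icc 0 T))
    (hg : IntegrableOn g (Ioc 0 T))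
    (heq : ∀ φ : 𝓢(Space3, ℂ), ∀ t ∈ Icc 0 T,
      Complex.I * ((∫ x, w t x * φ x) - ∫ x, w 0 x * φ x) +
        ∫ s in (0 : ℝ)..t, ∫ x, w s x * (Δ φ) x = ∫ s in (0 : ℝ)..t, ∫ x, g s x * φ x)
    (χ : 𝓢(Space3, ℂ)) :
    IsPrimitive T (fun t => schwartzMul χ (w t))
      (fun s => Complex.I • schwartzMul (lapSchwartz χ) (w s) - Complex.I • schwartzMul χ (g s)) := by
  have i1 : IntegrableOn (fun s => schwartzMul (lapSchwartz χ) (w s)) (Ioc 0 T) := by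
    have h1 : ContinuousOn (fun s => schwartzMul (lapSchwartz χ) (w s)) (Icc 0 T) :=
      (schwartzMul (lapSchwartz χ)).continuous.comp_continuousOn hw
    exact h1.integrableOn_Icc.mono_set Ioc_subset_Icc_self
  have i2 : IntegrableOn (fun s => schwartzMul χ (g s)) (Ioc 0 T) :=
    (schwartzMul χ).integrable_comp hg
  have i3 : IntegrableOn (fun s => Complex.I • schwartzMul (lapSchwartz χ) (w s)) (Ioc 0 T) :=
    i1.smul Complex.I
  have i4 : IntegrableOn (fun s => Complex.I • schwartzMul χ (g s)) (Ioc 0 T) := i2.smul Complex.I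
  refine ⟨i3.sub i4, fun t ht => eq_of_fourierPairing fun ψ => ?_⟩
  have hsub : Ioc 0 t ⊆ Ioc 0 T := Ioc_subset_Ioc_right ht.2
  have e1 : fourierPairing ψ (∫ s in Ioc 0 t, (Complex.I • schwartzMul (lapSchwartz χ) (w s) -
      Complex.I • schwartzMul χ (g s))) =
      Complex.I * (∫ s in Ioc 0 t, fourierPairing ψ (schwartzMul (lapSchwartz χ) (w s))) -
      Complex.I * ∫ s in Ioc 0 t, fourierPairing ψ (schwartzMul χ (g s)) := by
    have j1 := i1.mono_set hsub
    have j2 := i2.mono_set hsub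
    have k1 : ∫ s in Ioc 0 t, Complex.I • schwartzMul (lapSchwartz χ) (w s) =
        Complex.I • ∫ s in Ioc 0 t, schwartzMul (lapSchwartz χ) (w s) := integral_smul _ _
    have k2 : ∫ s in Ioc 0 t, Complex.I • schwartzMul χ (g s) =
        Complex.I • ∫ s in Ioc 0 t, schwartzMul χ (g s) := integral_smul _ _
    rw [integral_sub (i3.mono_set hsub) (i4.mono_set hsub), k1, k2, map_sub, map_smul, map_smul,
      (fourierPairing ψ).integral_comp_comm j1, (fourierPairing ψ).integral_comp_comm j2,
      smul_eq_mul, smul_eq_mul]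
  have h := heq (𝓕 (SchwartzMap.pairing (ContinuousLinearMap.mul ℂ ℂ) χ ψ)) t ht
  simp only [← fourierPairing_schwartzMul, ← fourierPairing_schwartzMul_lapSchwartz] at h
  rw [intervalIntegral.integral_of_le ht.1, intervalIntegral.integral_of_le ht.1] at h
  rw [map_add, e1, ← h]
  linear_combination (fourierPairing ψ (schwartzMul χ (w t)) -
    fourierPairing ψ (schwartzMul χ (w 0))) * Complex.I_mul_I

theorem gradSchwartz_lapSchwartz (j : Fin 3) (χ : 𝓢(Space3, ℂ)) :
    gradSchwartz j (lapSchwartz χ) = lapSchwartz (gradSchwartz j χ) := by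
  ext ξ
  simp only [gradSchwartz_apply, lapSchwartz_apply]
  ring

theorem gradSchwartz_comm (j k : Fin 3) (χ : 𝓢(Space3, ℂ)) :
    gradSchwartz j (gradSchwartz k χ) = gradSchwartz k (gradSchwartz j χ) := by
  ext ξ
  simp only [gradSchwartz_apply]
  ring

theorem sum_schwartzMul_gradSchwartz (χ : 𝓢(Space3, ℂ)) (f : L2Space) :
    ∑ k, schwartzMul (gradSchwartz k (gradSchwartz k χ)) f = schwartzMul (lapSchwartz χ) f := by
  refine (FourierTransform.fourierCLE ℂ L2Space).injective (Lp.ext ?_)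
  rw [map_sum]
  simp only [FourierTransform.fourierCLE_apply, Fin.sum_univ_three]
  filter_upwards [coeFn_fourier_schwartzMul (lapSchwartz χ) f,
    coeFn_fourier_schwartzMul (gradSchwartz 0 (gradSchwartz 0 χ)) f,
    coeFn_fourier_schwartzMul (gradSchwartz 1 (gradSchwartz 1 χ)) f,
    coeFn_fourier_schwartzMul (gradSchwartz 2 (gradSchwartz 2 χ)) f,
    Lp.coeFn_add (𝓕 (schwartzMul (gradSchwartz 0 (gradSchwartz 0 χ)) f) +
      𝓕 (schwartzMul (gradSchwartz 1 (gradSchwartz 1 χ)) f) : L2Space)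
      (𝓕 (schwartzMul (gradSchwartz 2 (gradSchwartz 2 χ)) f)),
    Lp.coeFn_add (𝓕 (schwartzMul (gradSchwartz 0 (gradSchwartz 0 χ)) f) : L2Space)
      (𝓕 (schwartzMul (gradSchwartz 1 (gradSchwartz 1 χ)) f))] with ξ h h0 h1 h2 h3 h4
  rw [h3, Pi.add_apply, h4, Pi.add_apply, h, h0, h1, h2]
  simp only [gradSchwartz_apply, lapSchwartz_apply, gradSymbol, lapSymbol, norm_sq_eq_sum,
    Fin.sum_univ_three]
  push_cast
  linear_combination (4 * Real.pi ^ 2 * χ ξ * (𝓕 f : L2Space) ξ *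
    ((ξ 0 : ℂ) ^ 2 + (ξ 1 : ℂ) ^ 2 + (ξ 2 : ℂ) ^ 2)) * Complex.I_sq

theorem schwartzMul_eq_fourierMul (χ : 𝓢(Space3, ℂ)) : schwartzMul χ = fourierMul (χ.toLp ∞) := by
  rw [schwartzMul]

theorem convForm_add_left (k : Weight) (p p' q : Lp (α := Space3) ℝ 1 volume) :
    convForm k (p + p') q = convForm k p q + convForm k p' q := by
  rw [map_add]; rfl

theorem convForm_add_right (k : Weight) (p q q' : Lp (α := Space3) ℝ 1 volume) :
    convForm k p (q + q') = convForm k p q + convForm k p q' :=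
  map_add _ _ _

theorem IsGradient.schwartzMul {f : L2Space} {Df : Fin 3 → L2Space} (h : IsGradient f Df)
    (χ : 𝓢(Space3, ℂ)) (j : Fin 3) :
    _root_.schwartzMul (gradSchwartz j χ) f = _root_.schwartzMul χ (Df j) := by
  have h1 := h.fourierMul (χ.toLp ∞)
  rw [← schwartzMul_eq_fourierMul] at h1
  exact congrFun ((isGradient_schwartzMul χ f).unique h1) j

section Morawetz

variable (δ : ℝ) [hδ : Fact (0 < δ)]

theorem IsPrimitive.innerL1 {T : ℝ} {u u' v v' : ℝ → L2Space} (hu : IsPrimitive T u u')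
    (hv : IsPrimitive T v v') :
    IsPrimitive T (fun t => innerL1 (u t) (v t))
      (fun t => innerL1 (u' t) (v t) + innerL1 (u t) (v' t)) :=
  hu.bilinear hv _root_.innerL1

theorem IsPrimitive.convForm {T : ℝ} {u u' v v' : ℝ → Lp (α := Space3) ℝ 1 volume}
    (hu : IsPrimitive T u u') (hv : IsPrimitive T v v') (k : Weight) :
    IsPrimitive T (fun t => convForm k (u t) (v t))
      (fun t => convForm k (u' t) (v t) + convForm k (u t) (v' t)) :=
  hu.bilinear hv (_root_.convForm k)

theorem IsPrimitive.I_smul {T : ℝ} {u u' : ℝ → L2Space} (hu : IsPrimitive T u u') :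
    IsPrimitive T (fun t => Complex.I • u t) (fun t => Complex.I • u' t) := by
  refine ⟨hu.1.smul Complex.I, fun t ht => ?_⟩
  have k : ∫ s in Ioc 0 t, Complex.I • u' s = Complex.I • ∫ s in Ioc 0 t, u' s := integral_smul _ _
  rw [k, hu.2 t ht, smul_add]

theorem isPrimitive_morawetzAction {T : ℝ} {f f' : ℝ → L2Space} {f₁ f₁' : Fin 3 → ℝ → L2Space}
    (hf : IsPrimitive T f f') (hf₁ : ∀ j, IsPrimitive T (f₁ j) (f₁' j)) :
    IsPrimitive T (fun t => morawetzAction δ (f t) (fun j => f₁ j t)) (fun t => ∑ j,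
      (convForm (radial δ j) (innerL1 (f' t) (f t) + innerL1 (f t) (f' t))
          (innerL1 (Complex.I • f t) (f₁ j t)) +
        convForm (radial δ j) (innerL1 (f t) (f t)) (innerL1 (Complex.I • f' t) (f₁ j t) +
          innerL1 (Complex.I • f t) (f₁' j t)))) := by
  unfold morawetzAction
  exact IsPrimitive.finsetSum _ fun j => (hf.innerL1 hf).convForm (hf.I_smul.innerL1 (hf₁ j)) _

theorem sum_morawetz_algebra {b c d : Fin 3 → ℝ} {e : ℝ} (h : ∑ j, d j = ∑ j, c j - e) :
    ∑ j, ((b j + b j) + (c j + d j)) = ∑ j, (2 * b j + 2 * c j) - e := by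
  simp only [Finset.sum_add_distrib, ← Finset.mul_sum, h]
  ring

theorem sum_potential_flux {f h : L2Space} {f₁ h₁ : Fin 3 → L2Space} (hf : IsGradient f f₁)
    (hh : IsGradient h h₁) (y : Space3) :
    ∑ j, potential (radial δ j) y (innerL1 (Complex.I • f) (h₁ j)) =
      ∑ j, potential (radial δ j) y (innerL1 (Complex.I • h) (f₁ j)) -
        potential (radialDiv δ) y (innerL1 (Complex.I • f) h) := by
  have h1 := sum_potential_radial δ (hf.smul Complex.I) hh y
  have h2 : ∀ j, potential (radial δ j) y (innerL1 (Complex.I • f₁ j) h) =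
      -potential (radial δ j) y (innerL1 (Complex.I • h) (f₁ j)) := by
    intro j
    rw [innerL1_I_smul_left, innerL1_comm, map_neg]
  simp only [Pi.smul_apply] at h1
  rw [Finset.sum_congr rfl fun j _ => h2 j, Finset.sum_neg_distrib] at h1
  linarith

theorem sum_convForm_flux {f h : L2Space} {f₁ h₁ : Fin 3 → L2Space} (hf : IsGradient f f₁)
    (hh : IsGradient h h₁) (p : Lp (α := Space3) ℝ 1 volume) :
    ∑ j, convForm (radial δ j) p (innerL1 (Complex.I • f) (h₁ j)) =
      ∑ j, convForm (radial δ j) p (innerL1 (Complex.I • h) (f₁ j)) -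
        convForm (radialDiv δ) p (innerL1 (Complex.I • f) h) := by
  rw [sum_convForm_eq_integral, sum_convForm_eq_integral, convForm_apply, ← integral_sub
    (integrable_mul_sum_potential _ _ _) (integrable_mul_potential _ _ _)]
  refine integral_congr_ae (Filter.Eventually.of_forall fun y => ?_)
  simp only []
  rw [sum_potential_flux δ hf hh y, mul_sub]

theorem morawetzAction_deriv_eq {f h : L2Space} {f₁ h₁ : Fin 3 → L2Space} (hf : IsGradient f f₁)
    (hh : IsGradient h h₁) :
    ∑ j, (convForm (radial δ j) (innerL1 h f + innerL1 f h) (innerL1 (Complex.I • f) (f₁ j)) +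
        convForm (radial δ j) (innerL1 f f) (innerL1 (Complex.I • h) (f₁ j) +
          innerL1 (Complex.I • f) (h₁ j))) = morawetzDeriv δ f f₁ h := by
  rw [morawetzDeriv]
  have e1 : ∀ j, convForm (radial δ j) (innerL1 h f + innerL1 f h) (innerL1 (Complex.I • f) (f₁ j)) =
      convForm (radial δ j) (innerL1 f h) (innerL1 (Complex.I • f) (f₁ j)) +
        convForm (radial δ j) (innerL1 f h) (innerL1 (Complex.I • f) (f₁ j)) := fun j =>
    (congrArg (fun p => convForm (radial δ j) (p + innerL1 f h)
      (innerL1 (Complex.I • f) (f₁ j))) (innerL1_comm h f)).trans (convForm_add_left _ _ _ _)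
  have e2 : ∀ j, convForm (radial δ j) (innerL1 f f) (innerL1 (Complex.I • h) (f₁ j) +
      innerL1 (Complex.I • f) (h₁ j)) =
      convForm (radial δ j) (innerL1 f f) (innerL1 (Complex.I • h) (f₁ j)) +
        convForm (radial δ j) (innerL1 f f) (innerL1 (Complex.I • f) (h₁ j)) := fun j =>
    convForm_add_right _ _ _ _
  refine (Finset.sum_congr rfl fun j _ => congrArg₂ (· + ·) (e1 j) (e2 j)).trans ?_
  exact sum_morawetz_algebra (sum_convForm_flux δ hf hh (innerL1 f f))

end Morawetz

/-! ### The interaction Morawetz inequality -/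

section Morawetz

variable (δ : ℝ) [hδ : Fact (0 < δ)]

/-- The momentum-type components of a frequency localization of `w`. -/
theorem isGradient_localized_deriv (χ : 𝓢(Space3, ℂ)) (u g : L2Space) :
    IsGradient (Complex.I • schwartzMul (lapSchwartz χ) u - Complex.I • schwartzMul χ g)
      (fun j => Complex.I • schwartzMul (lapSchwartz (gradSchwartz j χ)) u -
        Complex.I • schwartzMul (gradSchwartz j χ) g) := by
  have h1 := (isGradient_schwartzMul (lapSchwartz χ) u).smul Complex.I
  have h2 := (isGradient_schwartzMul χ g).smul Complex.I
  have h3 := h1.sub h2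
  simp only [gradSchwartz_lapSchwartz] at h3
  exact h3

theorem isPrimitive_morawetzAction_localized {T : ℝ} {w g : ℝ → L2Space}
    (hw : ContinuousOn w (Icc 0 T)) (hg : IntegrableOn g (Ioc 0 T))
    (heq : ∀ φ : 𝓢(Space3, ℂ), ∀ t ∈ Icc 0 T,
      Complex.I * ((∫ x, w t x * φ x) - ∫ x, w 0 x * φ x) +
        ∫ s in (0 : ℝ)..t, ∫ x, w s x * (Δ φ) x = ∫ s in (0 : ℝ)..t, ∫ x, g s x * φ x)
    (χ : 𝓢(Space3, ℂ)) :
    IsPrimitive T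
      (fun t => morawetzAction δ (schwartzMul χ (w t)) fun j => schwartzMul (gradSchwartz j χ) (w t))
      (fun t => morawetzDeriv δ (schwartzMul χ (w t)) (fun j => schwartzMul (gradSchwartz j χ) (w t))
        (Complex.I • schwartzMul (lapSchwartz χ) (w t) - Complex.I • schwartzMul χ (g t))) := by
  have h := isPrimitive_morawetzAction δ (isPrimitive_schwartzMul hw hg heq χ)
    (fun j => isPrimitive_schwartzMul hw hg heq (gradSchwartz j χ))
  refine h.congr_deriv fun s _ => ?_
  exact morawetzAction_deriv_eq δ (isGradient_schwartzMul χ (w s))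
    (isGradient_localized_deriv χ (w s) (g s))

theorem morawetzDeriv_free_add_ge {f h e : L2Space} {f₁ : Fin 3 → L2Space}
    {f₂ : Fin 3 → Fin 3 → L2Space} (h₁ : IsGradient f f₁) (h₂ : ∀ k, IsGradient (f₁ k) (f₂ k))
    (hs : ∀ j k, f₂ j k = f₂ k j) (he : ∑ k, f₂ k k = e) :
    1 / 2 * convForm (bilapWeight δ) (innerL1 f f) (innerL1 f f) + morawetzDeriv δ f f₁ (-h) ≤
      morawetzDeriv δ f f₁ (Complex.I • e - h) := by
  subst he
  have h1 := morawetzDeriv_free_ge δ h₁ h₂ hs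
  rw [sub_eq_add_neg, morawetzDeriv_add]
  linarith

theorem morawetzDeriv_localized_ge (f g : L2Space) (χ : 𝓢(Space3, ℂ)) {f₁ : Fin 3 → L2Space}
    (hf₁ : f₁ = fun j => schwartzMul (gradSchwartz j χ) f) :
    1 / 2 * convForm (bilapWeight δ) (innerL1 (schwartzMul χ f) (schwartzMul χ f))
        (innerL1 (schwartzMul χ f) (schwartzMul χ f)) +
      morawetzDeriv δ (schwartzMul χ f) f₁ (-(Complex.I • schwartzMul χ g)) ≤
    morawetzDeriv δ (schwartzMul χ f) (fun j => schwartzMul (gradSchwartz j χ) f)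
        (Complex.I • schwartzMul (lapSchwartz χ) f - Complex.I • schwartzMul χ g) := by
  subst hf₁
  have hs : ∀ j k, schwartzMul (gradSchwartz k (gradSchwartz j χ)) f =
      schwartzMul (gradSchwartz j (gradSchwartz k χ)) f := fun j k => by
    rw [gradSchwartz_comm]
  exact morawetzDeriv_free_add_ge δ (h := Complex.I • schwartzMul χ g)
    (f₁ := fun j => schwartzMul (gradSchwartz j χ) f)
    (f₂ := fun j k => schwartzMul (gradSchwartz k (gradSchwartz j χ)) f)
    (e := schwartzMul (lapSchwartz χ) f) (isGradient_schwartzMul χ f)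
    (fun k => isGradient_schwartzMul (gradSchwartz k χ) f) hs (sum_schwartzMul_gradSchwartz χ f)

theorem abs_morawetzDeriv_localized_le {f g : L2Space} {Df : Fin 3 → L2Space}
    (hf : IsGradient f Df) {D : ℝ} (hD : ∀ j, ‖Df j‖ ≤ D) (n : ℕ) :
    |morawetzDeriv δ (schwartzMul (cutoffSymbol n) f)
      (fun j => schwartzMul (cutoffSymbol n) (Df j))
        (-(Complex.I • schwartzMul (cutoffSymbol n) g))| ≤ 30 * (‖f‖ ^ 2 * D * ‖g‖) := by
  have hD0 : 0 ≤ D := (norm_nonneg _).trans (hD 0)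
  have h1 : IsGradient (schwartzMul (cutoffSymbol n) f)
      (fun j => schwartzMul (cutoffSymbol n) (Df j)) := by
    have := isGradient_schwartzMul (cutoffSymbol n) f
    simpa only [hf.schwartzMul] using this
  refine (abs_morawetzDeriv_le δ h1
    (fun j => (norm_schwartzMul_cutoff_le n (Df j)).trans (hD j)) _).trans ?_
  rw [norm_neg, norm_I_smul]
  have h2 := norm_schwartzMul_cutoff_le n f
  have h3 := norm_schwartzMul_cutoff_le n g
  gcongr

theorem tendsto_morawetzDeriv_localized (f g : L2Space) (Df : Fin 3 → L2Space) :
    Filter.Tendsto (fun n => morawetzDeriv δ (schwartzMul (cutoffSymbol n) f)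
      (fun j => schwartzMul (cutoffSymbol n) (Df j))
        (-(Complex.I • schwartzMul (cutoffSymbol n) g))) Filter.atTop
      (𝓝 (morawetzDeriv δ f Df (-(Complex.I • g)))) := by
  let F : ℕ → L2Space × (Fin 3 → L2Space) × L2Space := fun n =>
    (schwartzMul (cutoffSymbol n) f, fun j => schwartzMul (cutoffSymbol n) (Df j),
      -(Complex.I • schwartzMul (cutoffSymbol n) g))
  have h1 : Filter.Tendsto (fun n => (F n).1) Filter.atTop (𝓝 f) := tendsto_schwartzMul_cutoff f
  have h2 : Filter.Tendsto (fun n => (F n).2.1) Filter.atTop (𝓝 Df) :=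
    tendsto_pi_nhds.2 fun j => tendsto_schwartzMul_cutoff (Df j)
  have h3 : Filter.Tendsto (fun n => (F n).2.2) Filter.atTop (𝓝 (-(Complex.I • g))) :=
    ((tendsto_schwartzMul_cutoff g).const_smul Complex.I).neg
  have h4 : Filter.Tendsto F Filter.atTop (𝓝 (f, Df, -(Complex.I • g))) :=
    h1.prodMk_nhds (h2.prodMk_nhds h3)
  have h5 := (continuous_morawetzDeriv δ).tendsto (f, Df, -(Complex.I • g))
  have h6 := Filter.Tendsto.comp h5 h4
  exact h6

theorem tendsto_morawetzAction_localized {f : L2Space} {Df : Fin 3 → L2Space}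
    (hf : IsGradient f Df) :
    Filter.Tendsto (fun n => morawetzAction δ (schwartzMul (cutoffSymbol n) f)
      (fun j => schwartzMul (gradSchwartz j (cutoffSymbol n)) f)) Filter.atTop
      (𝓝 (morawetzAction δ f Df)) := by
  let F : ℕ → L2Space × (Fin 3 → L2Space) := fun n =>
    (schwartzMul (cutoffSymbol n) f, fun j => schwartzMul (gradSchwartz j (cutoffSymbol n)) f)
  have h1 : Filter.Tendsto (fun n => (F n).1) Filter.atTop (𝓝 f) := tendsto_schwartzMul_cutoff f
  have h2 : Filter.Tendsto (fun n => (F n).2) Filter.atTop (𝓝 Df) := by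
    refine tendsto_pi_nhds.2 fun j => ?_
    have : ∀ n, (F n).2 j = schwartzMul (cutoffSymbol n) (Df j) := fun n => hf.schwartzMul _ j
    simp only [this]
    exact tendsto_schwartzMul_cutoff (Df j)
  have h4 : Filter.Tendsto F Filter.atTop (𝓝 (f, Df)) := h1.prodMk_nhds h2
  have h5 := (continuous_morawetzAction δ).tendsto (f, Df)
  have h6 := Filter.Tendsto.comp h5 h4
  exact h6

theorem continuous_convForm_bilapWeight :
    Continuous fun f : L2Space => convForm (bilapWeight δ) (innerL1 f f) (innerL1 f f) := by
  have h : Continuous fun f : L2Space => innerL1 f f := continuous_id.innerL1 continuous_id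
  exact h.convForm h _

theorem convForm_bilapWeight_nonneg (f : L2Space) :
    0 ≤ convForm (bilapWeight δ) (innerL1 f f) (innerL1 f f) := by
  rw [convForm_apply]
  refine integral_nonneg_of_ae ?_
  filter_upwards [innerL1_self_nonneg f] with y h
  refine mul_nonneg h (potential_nonneg (fun z => ?_) y (innerL1_self_nonneg f))
  rw [bilapWeight_apply]
  have := invDist_pos δ z
  have := hδ.out
  positivity

theorem convForm_bilapWeight_localized_le (f : L2Space) (n : ℕ) :
    convForm (bilapWeight δ) (innerL1 (schwartzMul (cutoffSymbol n) f)
      (schwartzMul (cutoffSymbol n) f)) (innerL1 (schwartzMul (cutoffSymbol n) f)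
      (schwartzMul (cutoffSymbol n) f)) ≤ ‖bilapWeight δ‖ * ‖f‖ ^ 4 := by
  have h2 := norm_schwartzMul_cutoff_le n f
  generalize schwartzMul (cutoffSymbol n) f = u at *
  refine (le_abs_self _).trans ((abs_convForm_le _ _ _).trans ?_)
  have h3 := norm_innerL1_le u u
  calc _ ≤ ‖bilapWeight δ‖ * (‖u‖ * ‖u‖) * (‖u‖ * ‖u‖) := by gcongr
    _ ≤ ‖bilapWeight δ‖ * (‖f‖ * ‖f‖) * (‖f‖ * ‖f‖) := by gcongr
    _ = _ := by ring

theorem continuous_schwartzMul_cutoff (n : ℕ) :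
    Continuous fun f => schwartzMul (cutoffSymbol n) f :=
  (schwartzMul (cutoffSymbol n)).continuous

theorem aestronglyMeasurable_morawetzDeriv {T : ℝ} {f g : ℝ → L2Space} {Df : ℝ → Fin 3 → L2Space}
    (hf : AEStronglyMeasurable f (volume.restrict (Ioc 0 T)))
    (hD : AEStronglyMeasurable Df (volume.restrict (Ioc 0 T)))
    (hg : AEStronglyMeasurable g (volume.restrict (Ioc 0 T))) :
    AEStronglyMeasurable (fun s => morawetzDeriv δ (f s) (Df s) (g s))
      (volume.restrict (Ioc 0 T)) :=
  (continuous_morawetzDeriv δ).comp_aestronglyMeasurable (hf.prodMk (hD.prodMk hg))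

/-- The interaction Morawetz inequality for a forced Schrödinger equation with data in `H¹`. -/
theorem interaction_morawetz {T : ℝ} (hT : 0 ≤ T) {w g : ℝ → L2Space} {Dw : ℝ → Fin 3 → L2Space}
    (hw : ContinuousOn w (Icc 0 T)) (hDw : ContinuousOn Dw (Icc 0 T))
    (hgrad : ∀ t ∈ Icc 0 T, IsGradient (w t) (Dw t)) (hg : IntegrableOn g (Ioc 0 T))
    (heq : ∀ φ : 𝓢(Space3, ℂ), ∀ t ∈ Icc 0 T,
      Complex.I * ((∫ x, w t x * φ x) - ∫ x, w 0 x * φ x) +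
        ∫ s in (0 : ℝ)..t, ∫ x, w s x * (Δ φ) x = ∫ s in (0 : ℝ)..t, ∫ x, g s x * φ x) :
    IntegrableOn (fun s => 1 / 2 * convForm (bilapWeight δ) (innerL1 (w s) (w s))
      (innerL1 (w s) (w s)) + morawetzDeriv δ (w s) (Dw s) (-(Complex.I • g s))) (Ioc 0 T) ∧
    ∫ s in Ioc 0 T, (1 / 2 * convForm (bilapWeight δ) (innerL1 (w s) (w s)) (innerL1 (w s) (w s)) +
      morawetzDeriv δ (w s) (Dw s) (-(Complex.I • g s))) ≤
      morawetzAction δ (w T) (Dw T) - morawetzAction δ (w 0) (Dw 0) := by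
  have hT' : T ∈ Icc 0 T := ⟨hT, le_rfl⟩
  have h0' : (0 : ℝ) ∈ Icc 0 T := ⟨le_rfl, hT⟩
  obtain ⟨A, hA⟩ := isCompact_Icc.exists_bound_of_continuousOn hw
  obtain ⟨D, hD⟩ := isCompact_Icc.exists_bound_of_continuousOn hDw
  have hD' : ∀ t ∈ Icc 0 T, ∀ j, ‖Dw t j‖ ≤ D := fun t ht j =>
    (norm_le_pi_norm (Dw t) j).trans (hD t ht)
  have hA0 : 0 ≤ A := (norm_nonneg _).trans (hA 0 h0')
  have hD0 : 0 ≤ D := (norm_nonneg _).trans (hD 0 h0')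
  have mw : AEStronglyMeasurable w (volume.restrict (Ioc 0 T)) :=
    (hw.mono Ioc_subset_Icc_self).aestronglyMeasurable measurableSet_Ioc
  have mD : ∀ n, AEStronglyMeasurable (fun t => fun j => schwartzMul (cutoffSymbol n) (Dw t j))
      (volume.restrict (Ioc 0 T)) := by
    intro n
    have h1 : ContinuousOn (fun t => fun j => schwartzMul (cutoffSymbol n) (Dw t j)) (Icc 0 T) :=
      continuousOn_pi.2 fun j => (continuous_schwartzMul_cutoff n).comp_continuousOn
        ((continuous_apply j).comp_continuousOn hDw)
    exact (h1.mono Ioc_subset_Icc_self).aestronglyMeasurable measurableSet_Ioc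
  have mP : ∀ n {u : ℝ → L2Space}, AEStronglyMeasurable u (volume.restrict (Ioc 0 T)) →
      AEStronglyMeasurable (fun s => schwartzMul (cutoffSymbol n) (u s))
        (volume.restrict (Ioc 0 T)) := fun n u hu =>
    (continuous_schwartzMul_cutoff n).comp_aestronglyMeasurable hu
  have mI : ∀ {u : ℝ → L2Space}, AEStronglyMeasurable u (volume.restrict (Ioc 0 T)) →
      AEStronglyMeasurable (fun s => -(Complex.I • u s)) (volume.restrict (Ioc 0 T)) := fun hu =>
    (hu.const_smul Complex.I).neg
  let R : ℕ → ℝ → ℝ := fun n s =>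
    1 / 2 * convForm (bilapWeight δ) (innerL1 (schwartzMul (cutoffSymbol n) (w s))
      (schwartzMul (cutoffSymbol n) (w s))) (innerL1 (schwartzMul (cutoffSymbol n) (w s))
        (schwartzMul (cutoffSymbol n) (w s))) +
      morawetzDeriv δ (schwartzMul (cutoffSymbol n) (w s))
        (fun j => schwartzMul (cutoffSymbol n) (Dw s j))
        (-(Complex.I • schwartzMul (cutoffSymbol n) (g s)))
  let b : ℝ → ℝ := fun s => 1 / 2 * (‖bilapWeight δ‖ * A ^ 4) + 30 * (A ^ 2 * D * ‖g s‖)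
  have hb : IntegrableOn b (Ioc 0 T) :=
    (integrableOn_const (by simp)).add ((hg.norm.const_mul _).const_mul _)
  have mR : ∀ n, AEStronglyMeasurable (R n) (volume.restrict (Ioc 0 T)) := fun n =>
    (((continuous_convForm_bilapWeight δ).comp_aestronglyMeasurable (mP n mw)).const_mul _).add
      (aestronglyMeasurable_morawetzDeriv δ (mP n mw) (mD n) (mI (mP n hg.1)))
  have hbR : ∀ n, ∀ s ∈ Ioc 0 T, ‖R n s‖ ≤ b s := by
    intro n s hs
    have hs' := Ioc_subset_Icc_self hs
    have h1 := convForm_bilapWeight_localized_le δ (w s) n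
    have h2 := convForm_bilapWeight_nonneg δ (schwartzMul (cutoffSymbol n) (w s))
    have h3 := abs_morawetzDeriv_localized_le δ (g := g s) (hgrad s hs') (hD' s hs') n
    have h4 : ‖w s‖ ≤ A := hA s hs'
    have h5 : ‖bilapWeight δ‖ * ‖w s‖ ^ 4 ≤ ‖bilapWeight δ‖ * A ^ 4 := by gcongr
    have h6 : 30 * (‖w s‖ ^ 2 * D * ‖g s‖) ≤ 30 * (A ^ 2 * D * ‖g s‖) := by gcongr
    refine (norm_add_le _ _).trans (add_le_add ?_ (h3.trans h6))
    rw [Real.norm_of_nonneg (by positivity)]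
    linarith
  have hlim : ∀ s, Filter.Tendsto (fun n => R n s) Filter.atTop
      (𝓝 (1 / 2 * convForm (bilapWeight δ) (innerL1 (w s) (w s)) (innerL1 (w s) (w s)) +
        morawetzDeriv δ (w s) (Dw s) (-(Complex.I • g s)))) := by
    intro s
    have h1 := ((continuous_convForm_bilapWeight δ).tendsto (w s)).comp
      (tendsto_schwartzMul_cutoff (w s))
    exact (h1.const_mul (1 / 2)).add (tendsto_morawetzDeriv_localized δ (w s) (g s) (Dw s))
  have hint := tendsto_integral_of_dominated_convergence b mR hb
    (fun n => (ae_restrict_iff' measurableSet_Ioc).2 (Filter.Eventually.of_forall (hbR n)))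
    (Filter.Eventually.of_forall hlim)
  have hact := (tendsto_morawetzAction_localized δ (hgrad T hT')).sub
    (tendsto_morawetzAction_localized δ (hgrad 0 h0'))
  have hi := hb.mono' (aestronglyMeasurable_of_tendsto_ae Filter.atTop mR
    (Filter.Eventually.of_forall hlim))
    ((ae_restrict_iff' measurableSet_Ioc).2 (Filter.Eventually.of_forall fun s hs =>
      le_of_tendsto (hlim s).norm (Filter.Eventually.of_forall fun n => hbR n s hs)))
  refine ⟨hi, le_of_tendsto_of_tendsto' hint hact fun n => ?_⟩
  have hprim := isPrimitive_morawetzAction_localized δ hw hg heq (cutoffSymbol n)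
  rw [hprim.2 T hT', add_sub_cancel_left]
  refine setIntegral_mono_on ?_ hprim.1 measurableSet_Ioc fun s hs => ?_
  · exact hb.mono' (mR n)
      ((ae_restrict_iff' measurableSet_Ioc).2 (Filter.Eventually.of_forall (hbR n)))
  · exact morawetzDeriv_localized_ge δ (w s) (g s) (cutoffSymbol n)
      (funext fun j => ((hgrad s (Ioc_subset_Icc_self hs)).schwartzMul (cutoffSymbol n) j).symm)

end Morawetz

/-! ### Semicontinuity of norms and the free flow -/

theorem lowerSemicontinuous_eLpNorm_mul {m : Space3 → ℂ} (hm : AEStronglyMeasurable m volume)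
    (r : ℝ≥0∞) : LowerSemicontinuous fun f : L2Space => eLpNorm (fun x => m x * f x) r volume := by
  rw [lowerSemicontinuous_iff_isClosed_preimage]
  refine fun C => IsSeqClosed.isClosed fun u f hu huf => ?_
  obtain ⟨ns, -, hns⟩ := (tendstoInMeasure_of_tendsto_Lp huf).exists_seq_tendsto_ae
  refine Lp.eLpNorm_le_of_ae_tendsto (u := Filter.atTop) (f := fun n x => m x * u (ns n) x)
    (Filter.Eventually.of_forall fun n => hu (ns n))
    (fun n => hm.mul (Lp.aestronglyMeasurable _)) ?_
  filter_upwards [hns] with x hx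
  exact hx.const_mul (m x)

theorem lowerSemicontinuous_eLpNorm (r : ℝ≥0∞) :
    LowerSemicontinuous fun f : L2Space => eLpNorm f r volume := by
  simpa using lowerSemicontinuous_eLpNorm_mul (m := fun _ => 1) aestronglyMeasurable_const r

theorem coeFn_fourier_freeSchrodinger (t : ℝ) (f : L2Space) :
    (𝓕 (freeSchrodinger t f) : L2Space) =ᵐ[volume]
      fun ξ => schrodingerPhase t ξ * (𝓕 f : L2Space) ξ := by
  rw [freeSchrodinger, FourierTransform.fourier_fourierInv_eq]
  exact MemLp.coeFn_toLp _

theorem continuous_freeSchrodinger (f : L2Space) : Continuous fun t => freeSchrodinger t f := by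
  refine continuous_iff_seqContinuous.2 fun t t₀ ht => ?_
  refine tendsto_of_tendsto_fourier (tendsto_L2_of_dominated (b := fun ξ => ‖(𝓕 f : L2Space) ξ‖)
    (integrable_norm_sq (𝓕 f)) (fun n => ?_) ?_)
  · filter_upwards [coeFn_fourier_freeSchrodinger (t n) f] with ξ h
    simp only [Function.comp_apply]
    rw [h, norm_mul, norm_schrodingerPhase, one_mul]
  · have h : ∀ᵐ ξ, ∀ n, (𝓕 (freeSchrodinger (t n) f) : L2Space) ξ =
        schrodingerPhase (t n) ξ * (𝓕 f : L2Space) ξ :=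
      ae_all_iff.2 fun n => coeFn_fourier_freeSchrodinger (t n) f
    filter_upwards [h, coeFn_fourier_freeSchrodinger t₀ f] with ξ h1 h2
    simp only [Function.comp_apply, h1, h2]
    have hc : Continuous fun s => schrodingerPhase s ξ := by
      unfold schrodingerPhase
      fun_prop
    exact ((hc.tendsto t₀).comp ht).mul_const _

/-! ### The Sobolev embedding of `H¹` into `L⁶` -/

/-- A cutoff to the ball of radius `2 (n + 1)` in physical space. -/
def spaceCutoff (n : ℕ) (x : Space3) : ℝ :=
  (⟨1, 2, one_pos, one_lt_two⟩ : ContDiffBump (0 : Space3)) ((n + 1 : ℝ)⁻¹ • x)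

theorem contDiff_spaceCutoff (n : ℕ) : ContDiff ℝ 1 (spaceCutoff n) :=
  (ContDiffBump.contDiff _).comp (contDiff_const_smul _)

theorem abs_spaceCutoff_le (n : ℕ) (x : Space3) : ‖spaceCutoff n x‖ ≤ 1 := by
  rw [spaceCutoff, Real.norm_of_nonneg (ContDiffBump.nonneg _)]
  exact ContDiffBump.le_one _

theorem hasCompactSupport_spaceCutoff (n : ℕ) : HasCompactSupport (spaceCutoff n) :=
  (ContDiffBump.hasCompactSupport _).comp_smul (by positivity)

theorem exists_norm_fderiv_spaceCutoff_le :
    ∃ K : ℝ, 0 ≤ K ∧ ∀ n x, ‖fderiv ℝ (spaceCutoff n) x‖ ≤ K := by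
  let b : ContDiffBump (0 : Space3) := ⟨1, 2, one_pos, one_lt_two⟩
  have hb : ContDiff ℝ 1 b := b.contDiff
  obtain ⟨K, hK⟩ := (b.hasCompactSupport.fderiv (𝕜 := ℝ)).exists_bound_of_continuous
    (hb.continuous_fderiv one_ne_zero)
  have hK0 : 0 ≤ K := (norm_nonneg _).trans (hK 0)
  refine ⟨K, hK0, fun n x => ?_⟩
  have h1 : fderiv ℝ (spaceCutoff n) x = (n + 1 : ℝ)⁻¹ • fderiv ℝ b ((n + 1 : ℝ)⁻¹ • x) :=
    fderiv_comp_smul _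
  rw [h1, norm_smul, Real.norm_of_nonneg (by positivity)]
  have h2 : (n + 1 : ℝ)⁻¹ ≤ 1 := inv_le_one_of_one_le₀ (by linarith [Nat.cast_nonneg (α := ℝ) n])
  calc _ ≤ 1 * K := by gcongr; exact hK _
    _ = K := one_mul K

theorem tendsto_spaceCutoff (x : Space3) :
    Filter.Tendsto (fun n => spaceCutoff n x) Filter.atTop (𝓝 1) := by
  have h1 : Filter.Tendsto (fun n : ℕ => (n + 1 : ℝ)⁻¹) Filter.atTop (𝓝 0) := by
    simpa using tendsto_one_div_add_atTop_nhds_zero_nat (𝕜 := ℝ)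
  have h2 := h1.smul_const x
  rw [zero_smul] at h2
  let b : ContDiffBump (0 : Space3) := ⟨1, 2, one_pos, one_lt_two⟩
  have h3 := (b.continuous.tendsto 0).comp h2
  have h4 : b 0 = 1 := b.one_of_mem_closedBall (by simp [b])
  rw [h4] at h3
  exact h3

theorem norm_fderiv_le_sum (φ : 𝓢(Space3, ℂ)) (x : Space3) :
    ‖fderiv ℝ φ x‖ ≤ ∑ j, ‖(∂_{basisVec j} φ : 𝓢(Space3, ℂ)) x‖ := by
  refine ContinuousLinearMap.opNorm_le_bound _ (Finset.sum_nonneg fun j _ => norm_nonneg _)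
    fun v => ?_
  have hv : v = ∑ j, v j • basisVec j := by
    have := (EuclideanSpace.basisFun (Fin 3) ℝ).sum_repr v
    simpa [basisVec] using this.symm
  have h1 : fderiv ℝ φ x v = ∑ j, v j • (∂_{basisVec j} φ : 𝓢(Space3, ℂ)) x := by
    conv_lhs => rw [hv]
    rw [map_sum]
    refine Finset.sum_congr rfl fun j _ => ?_
    rw [map_smul, SchwartzMap.lineDerivOp_apply_eq_fderiv]
  rw [h1, Finset.sum_mul]
  refine (norm_sum_le _ _).trans (Finset.sum_le_sum fun j _ => ?_)
  rw [norm_smul, mul_comm]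
  gcongr
  exact PiLp.norm_apply_le v j

theorem exists_eLpNorm_six_schwartz_le : ∃ C : ℝ≥0, ∀ φ : 𝓢(Space3, ℂ),
    eLpNorm φ 6 volume ≤ C * ENNReal.ofReal
      (‖φ.toLp 2‖ + ∑ j, ‖(∂_{basisVec j} φ : 𝓢(Space3, ℂ)).toLp 2‖) := by
  obtain ⟨K, hK0, hK⟩ := exists_norm_fderiv_spaceCutoff_le
  refine ⟨SNormLESNormFDerivOfEqConst ℂ (volume : Measure Space3) 2 * (K.toNNReal + 1), fun φ => ?_⟩
  have hbound : ∀ n, eLpNorm (fun x => spaceCutoff n x • φ x) 6 volume ≤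
      SNormLESNormFDerivOfEqConst ℂ (volume : Measure Space3) 2 *
        eLpNorm (fun x => K * ‖φ x‖ + ∑ j, ‖(∂_{basisVec j} φ : 𝓢(Space3, ℂ)) x‖) 2 volume := by
    intro n
    have h1 := eLpNorm_le_eLpNorm_fderiv_of_eq (volume : Measure Space3) (F := ℂ) (p := 2) (p' := 6)
      (u := fun x => spaceCutoff n x • φ x)
      ((contDiff_spaceCutoff n).smul (φ.smooth 1))
      ((hasCompactSupport_spaceCutoff n).smul_right) (by norm_num) (by simp) (by simp; norm_num)
    refine h1.trans (mul_le_mul_right ?_ _)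
    refine eLpNorm_mono_real (F := Space3 →L[ℝ] ℂ) fun x => ?_
    have h2 : fderiv ℝ (fun x => spaceCutoff n x • φ x) x = spaceCutoff n x • fderiv ℝ φ x +
        (fderiv ℝ (spaceCutoff n) x).smulRight (φ x) :=
      fderiv_fun_smul ((contDiff_spaceCutoff n).differentiable one_ne_zero x) φ.differentiableAt
    rw [h2]
    refine (norm_add_le _ _).trans ?_
    rw [norm_smul, ContinuousLinearMap.norm_smulRight_apply, add_comm]
    have h3 := norm_fderiv_le_sum φ x
    have h4 := abs_spaceCutoff_le n x
    have h5 := hK n x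
    refine add_le_add (by gcongr) ?_
    calc _ ≤ 1 * ‖fderiv ℝ φ x‖ := by gcongr
      _ ≤ _ := by rw [one_mul]; exact h3
  have hnorm : ∀ ψ : 𝓢(Space3, ℂ), eLpNorm (fun x => ‖ψ x‖) 2 volume = ENNReal.ofReal ‖ψ.toLp 2‖ := by
    intro ψ
    rw [eLpNorm_norm (fun x => ψ x), SchwartzMap.norm_toLp, ENNReal.ofReal_toReal (ψ.memLp 2 volume).2.ne]
  have hsum : eLpNorm (fun x => K * ‖φ x‖ + ∑ j, ‖(∂_{basisVec j} φ : 𝓢(Space3, ℂ)) x‖) 2 volume ≤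
      (K.toNNReal + 1 : ℝ≥0) * ENNReal.ofReal
        (‖φ.toLp 2‖ + ∑ j, ‖(∂_{basisVec j} φ : 𝓢(Space3, ℂ)).toLp 2‖) := by
    have m1 : AEStronglyMeasurable (fun x => K * ‖φ x‖) volume :=
      (φ.continuous.norm.const_mul K).aestronglyMeasurable
    have m2 : ∀ j, AEStronglyMeasurable (fun x => ‖(∂_{basisVec j} φ : 𝓢(Space3, ℂ)) x‖) volume :=
      fun j => (SchwartzMap.continuous _).norm.aestronglyMeasurable
    have h1 := eLpNorm_add_le m1 (Finset.aestronglyMeasurable_fun_sum Finset.univ fun j _ => m2 j)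
      (p := 2) (by norm_num)
    have h2 := eLpNorm_sum_le (μ := volume) (p := 2) (s := Finset.univ)
      (f := fun j x => ‖(∂_{basisVec j} φ : 𝓢(Space3, ℂ)) x‖) (fun j _ => m2 j) (by norm_num)
    have h3 : eLpNorm (fun x => K * ‖φ x‖) 2 volume = ENNReal.ofReal K * ENNReal.ofReal ‖φ.toLp 2‖ := by
      have := eLpNorm_const_smul K (fun x => ‖φ x‖) 2 volume
      rw [hnorm φ, ← ofReal_norm, Real.norm_of_nonneg hK0] at this
      exact this
    have h4 : (∑ j, fun x => ‖(∂_{basisVec j} φ : 𝓢(Space3, ℂ)) x‖) =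
        fun x => ∑ j, ‖(∂_{basisVec j} φ : 𝓢(Space3, ℂ)) x‖ := by
      ext x
      rw [Finset.sum_apply]
    rw [h4] at h2
    simp only [hnorm] at h2
    rw [ENNReal.ofReal_add (norm_nonneg _) (Finset.sum_nonneg fun j _ => norm_nonneg _),
      ENNReal.ofReal_sum_of_nonneg fun j _ => norm_nonneg _, ENNReal.coe_add, ENNReal.coe_one,
      add_mul, mul_add, mul_add, one_mul, one_mul]
    refine h1.trans ((add_le_add h3.le h2).trans ?_)
    refine add_le_add le_self_add ?_
    exact le_add_self
  have hlim := Lp.eLpNorm_le_of_ae_tendsto (μ := volume) (p := 6) (u := Filter.atTop)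
    (f := fun n x => spaceCutoff n x • φ x) (g := φ) (Filter.Eventually.of_forall hbound)
    (fun n => ((contDiff_spaceCutoff n).continuous.smul φ.continuous).aestronglyMeasurable)
    (Filter.Eventually.of_forall fun x => by
      simpa using (tendsto_spaceCutoff x).smul_const (φ x))
  refine hlim.trans ?_
  rw [ENNReal.coe_mul, mul_assoc]
  gcongr

theorem exists_eLpNorm_six_le : ∃ C : ℝ≥0, ∀ {f : L2Space} {Df : Fin 3 → L2Space},
    IsGradient f Df → eLpNorm f 6 volume ≤ C * ENNReal.ofReal (‖f‖ + ∑ j, ‖Df j‖) := by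
  obtain ⟨C, hC⟩ := exists_eLpNorm_six_schwartz_le
  refine ⟨C, fun {f Df} h => ?_⟩
  refine h.induction_schwartz (p := fun f Df =>
    eLpNorm f 6 volume ≤ C * ENNReal.ofReal (‖f‖ + ∑ j, ‖Df j‖)) ?_ fun φ => ?_
  · have c1 : Continuous fun z : L2Space × (Fin 3 → L2Space) => z.1 := continuous_fst
    have c2 : ∀ j, Continuous fun z : L2Space × (Fin 3 → L2Space) => z.2 j := fun j =>
      (continuous_apply j).comp continuous_snd
    have c3 : Continuous fun z : L2Space × (Fin 3 → L2Space) =>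
        (C : ℝ≥0∞) * ENNReal.ofReal (‖z.1‖ + ∑ j, ‖z.2 j‖) :=
      ENNReal.continuous_const_mul (by simp) |>.comp (ENNReal.continuous_ofReal.comp
        (c1.norm.add (continuous_finsetSum _ fun j _ => (c2 j).norm)))
    exact ((lowerSemicontinuous_eLpNorm 6).isClosed_epigraph).preimage (c1.prodMk c3)
  · refine le_trans (le_of_eq ?_) (hC φ)
    exact eLpNorm_congr_ae (φ.coeFn_toLp 2 volume)

/-! ### The cubic nonlinearity in `L²` -/

theorem norm_cubic_sub_le (v w : ℂ) :
    ‖((‖v + w‖ ^ 2 : ℝ) : ℂ) * (v + w) - ((‖w‖ ^ 2 : ℝ) : ℂ) * w‖ ≤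
      5 * ‖v‖ * (‖w‖ ^ 2 + ‖v‖ ^ 2) := by
  have e : ((‖v + w‖ ^ 2 : ℝ) : ℂ) * (v + w) - ((‖w‖ ^ 2 : ℝ) : ℂ) * w =
      ((‖v + w‖ ^ 2 : ℝ) : ℂ) * v + (((‖v + w‖ + ‖w‖) * (‖v + w‖ - ‖w‖) : ℝ) : ℂ) * w := by
    push_cast; ring
  have h1 : ‖v + w‖ ≤ ‖v‖ + ‖w‖ := norm_add_le v w
  have h2 : |‖v + w‖ - ‖w‖| ≤ ‖v‖ := by
    have := abs_norm_sub_norm_le (v + w) w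
    rwa [add_sub_cancel_right] at this
  rw [e]
  refine (norm_add_le _ _).trans ?_
  rw [norm_mul, norm_mul, Complex.norm_real, Complex.norm_real, norm_mul, Real.norm_eq_abs,
    Real.norm_eq_abs, Real.norm_eq_abs, abs_of_nonneg (by positivity : 0 ≤ ‖v + w‖ ^ 2),
    abs_of_nonneg (by positivity : 0 ≤ ‖v + w‖ + ‖w‖)]
  have h3 : ‖v + w‖ ^ 2 * ‖v‖ + (‖v + w‖ + ‖w‖) * |‖v + w‖ - ‖w‖| * ‖w‖ ≤
      (‖v‖ + ‖w‖) ^ 2 * ‖v‖ + (‖v‖ + ‖w‖ + ‖w‖) * ‖v‖ * ‖w‖ := by gcongr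
  refine h3.trans ?_
  have ha := norm_nonneg v
  nlinarith [mul_nonneg ha (sq_nonneg (‖v‖ - ‖w‖)), mul_nonneg ha (sq_nonneg ‖v‖),
    mul_nonneg ha (sq_nonneg ‖w‖)]

theorem exists_Lp_of_norm_le {u : Space3 → ℂ} (hu : AEStronglyMeasurable u volume) {b : L2Space}
    (h : ∀ᵐ x, ‖u x‖ ≤ ‖b x‖) : ∃ f : L2Space, (f =ᵐ[volume] u) ∧ ‖f‖ ≤ ‖b‖ := by
  have hm : MemLp u 2 volume := (Lp.memLp b).of_le hu h
  refine ⟨hm.toLp, hm.coeFn_toLp, Lp.norm_le_norm_of_ae_le ?_⟩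
  filter_upwards [hm.coeFn_toLp, h] with x h1 h2
  rwa [h1]

theorem exists_Lp_norm_sq {f : L2Space} (hf : Integrable fun x => ‖f x‖ ^ 4) :
    ∃ s : L2Space, (∀ᵐ x, s x = ((‖f x‖ ^ 2 : ℝ) : ℂ)) ∧ ‖s‖ = √(∫ x, ‖f x‖ ^ 4) := by
  have hm : AEStronglyMeasurable (fun x => ((‖f x‖ ^ 2 : ℝ) : ℂ)) volume :=
    Complex.continuous_ofReal.comp_aestronglyMeasurable ((Lp.aestronglyMeasurable f).norm.pow 2)
  have e : ∀ x, ‖((‖f x‖ ^ 2 : ℝ) : ℂ)‖ ^ 2 = ‖f x‖ ^ 4 := by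
    intro x
    rw [Complex.norm_real, Real.norm_of_nonneg (by positivity), ← pow_mul]
  have hL : MemLp (fun x => ((‖f x‖ ^ 2 : ℝ) : ℂ)) 2 volume := by
    rw [memLp_two_iff_integrable_sq_norm hm]
    simpa only [e] using hf
  refine ⟨hL.toLp, hL.coeFn_toLp, ?_⟩
  rw [← Real.sqrt_sq (norm_nonneg hL.toLp), norm_sq_eq_integral_norm_sq]
  congr 1
  refine integral_congr_ae ?_
  filter_upwards [hL.coeFn_toLp] with x h
  rw [h, e]

theorem integrable_quartic_of_cubic {f N : L2Space} (hN : ∀ᵐ x, N x = ((‖f x‖ ^ 2 : ℝ) : ℂ) * f x) :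
    Integrable (fun x => ‖f x‖ ^ 4) ∧ ∫ x, ‖f x‖ ^ 4 ≤ ‖f‖ ^ 2 + ‖N‖ ^ 2 := by
  have hb := (integrable_norm_sq f).add (integrable_norm_sq N)
  have h : ∀ᵐ x, ‖f x‖ ^ 4 ≤ ‖f x‖ ^ 2 + ‖N x‖ ^ 2 := by
    filter_upwards [hN] with x hx
    rw [hx, norm_mul, Complex.norm_real, Real.norm_of_nonneg (by positivity)]
    nlinarith [sq_nonneg (‖f x‖ - ‖f x‖ ^ 3), norm_nonneg (f x), sq_nonneg ‖f x‖,
      sq_nonneg (‖f x‖ ^ 3)]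
  have hi : Integrable fun x => ‖f x‖ ^ 4 := by
    refine hb.mono' ((Lp.aestronglyMeasurable f).norm.pow 4) ?_
    filter_upwards [h] with x hx
    rwa [Real.norm_of_nonneg (by positivity)]
  refine ⟨hi, ?_⟩
  rw [norm_sq_eq_integral_norm_sq, norm_sq_eq_integral_norm_sq,
    ← integral_add (integrable_norm_sq f) (integrable_norm_sq N)]
  exact integral_mono_ae hi hb h

theorem exists_cubic {C : ℝ≥0} {f : L2Space} {M : ℝ} (hM : 0 ≤ M)
    (h6 : eLpNorm f 6 volume ≤ C * ENNReal.ofReal M) :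
    ∃ N : L2Space, (∀ᵐ x, N x = ((‖f x‖ ^ 2 : ℝ) : ℂ) * f x) ∧ ‖N‖ ≤ (C * M) ^ 3 := by
  set u : Space3 → ℂ := fun x => ((‖f x‖ ^ 2 : ℝ) : ℂ) * f x with hu
  have hm : AEStronglyMeasurable u volume :=
    (Complex.continuous_ofReal.comp_aestronglyMeasurable
      ((Lp.aestronglyMeasurable f).norm.pow 2)).mul (Lp.aestronglyMeasurable f)
  have e : eLpNorm u 2 volume = eLpNorm f 6 volume ^ 3 := by
    have h1 := eLpNorm_norm_rpow (μ := volume) f (q := 3) (p := 2) (by norm_num)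
    have h2 : (2 : ℝ≥0∞) * ENNReal.ofReal 3 = 6 := by
      rw [show (3 : ℝ) = ((3 : ℕ) : ℝ) by norm_num, ENNReal.ofReal_natCast]; norm_num
    rw [h2] at h1
    rw [← ENNReal.rpow_natCast, Nat.cast_ofNat, ← h1]
    refine eLpNorm_congr_norm_ae (Filter.Eventually.of_forall fun x => ?_)
    rw [hu]
    simp only []
    rw [norm_mul, Complex.norm_real, Real.norm_of_nonneg (by positivity),
      Real.norm_of_nonneg (by positivity), show (3 : ℝ) = ((3 : ℕ) : ℝ) by norm_num,
      Real.rpow_natCast]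
    ring
  have hb : eLpNorm u 2 volume ≤ ENNReal.ofReal ((C * M) ^ 3) := by
    rw [e, ENNReal.ofReal_pow (by positivity), ENNReal.ofReal_mul (by positivity),
      ENNReal.ofReal_coe_nnreal]
    gcongr
  have hL : MemLp u 2 volume := ⟨hm, hb.trans_lt ENNReal.ofReal_lt_top⟩
  refine ⟨hL.toLp, hL.coeFn_toLp, ?_⟩
  rw [Lp.norm_toLp]
  exact ENNReal.toReal_le_of_le_ofReal (by positivity) hb

theorem exists_cubic_sub {v w N : L2Space} (hN : ∀ᵐ x, N x = ((‖w x‖ ^ 2 : ℝ) : ℂ) * w x) {β : ℝ}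
    (hβ : 0 ≤ β) (hv : ∀ᵐ x, ‖v x‖ ≤ β) :
    ∃ F : L2Space, (∀ᵐ x, (N + F) x = ((‖(v + w) x‖ ^ 2 : ℝ) : ℂ) * (v + w) x) ∧
      ‖F‖ ≤ 5 * β * (√(∫ x, ‖w x‖ ^ 4) + √(∫ x, ‖v x‖ ^ 4)) := by
  have hv4 : Integrable fun x => ‖v x‖ ^ 4 := by
    refine ((integrable_norm_sq v).const_mul (β ^ 2)).mono'
      ((Lp.aestronglyMeasurable v).norm.pow 4) ?_
    filter_upwards [hv] with x hx
    rw [Real.norm_of_nonneg (by positivity)]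
    calc ‖v x‖ ^ 4 = ‖v x‖ ^ 2 * ‖v x‖ ^ 2 := by ring
      _ ≤ β ^ 2 * ‖v x‖ ^ 2 := by gcongr
  obtain ⟨sw, hsw, nsw⟩ := exists_Lp_norm_sq (integrable_quartic_of_cubic hN).1
  obtain ⟨sv, hsv, nsv⟩ := exists_Lp_norm_sq hv4
  set u : Space3 → ℂ := fun x => ((‖v x + w x‖ ^ 2 : ℝ) : ℂ) * (v x + w x) -
    ((‖w x‖ ^ 2 : ℝ) : ℂ) * w x with hu
  have mv := Lp.aestronglyMeasurable v
  have mw := Lp.aestronglyMeasurable w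
  have hm : AEStronglyMeasurable u volume :=
    ((Complex.continuous_ofReal.comp_aestronglyMeasurable ((mv.add mw).norm.pow 2)).mul
      (mv.add mw)).sub
    ((Complex.continuous_ofReal.comp_aestronglyMeasurable (mw.norm.pow 2)).mul mw)
  obtain ⟨F, hF, nF⟩ := exists_Lp_of_norm_le hm (b := ((5 * β : ℝ) : ℂ) • (sw + sv)) (by
    filter_upwards [hv, hsw, hsv, Lp.coeFn_smul ((5 * β : ℝ) : ℂ) (sw + sv),
      Lp.coeFn_add sw sv] with x h1 h2 h3 h4 h5
    rw [h4, Pi.smul_apply, h5, Pi.add_apply, h2, h3, norm_smul, Complex.norm_real,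
      Real.norm_of_nonneg (by positivity), ← Complex.ofReal_add, Complex.norm_real,
      Real.norm_of_nonneg (by positivity)]
    exact (norm_cubic_sub_le (v x) (w x)).trans (by gcongr))
  refine ⟨F, ?_, nF.trans ?_⟩
  · filter_upwards [hF, hN, Lp.coeFn_add N F, Lp.coeFn_add v w] with x h1 h2 h3 h4
    rw [h3, Pi.add_apply, h1, h2, h4, Pi.add_apply, hu]
    simp only []
    ring
  · rw [norm_smul, Complex.norm_real, Real.norm_of_nonneg (by positivity), ← nsw, ← nsv]
    gcongr
    exact norm_add_le _ _

/-! ### Concentration of the convolution kernels -/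

instance fact_inv_succ_pos (n : ℕ) : Fact ((0 : ℝ) < (n + 1 : ℝ)⁻¹) := ⟨by positivity⟩

theorem bilapWeight_ge (δ : ℝ) [hδ : Fact (0 < δ)] {z : Space3} (hz : ‖z‖ ≤ δ) :
    (δ ^ 3 * Real.pi * 4 / 3)⁻¹ ≤ bilapWeight δ z := by
  have hδ0 := hδ.out
  have h1 := invDist_sq_mul δ z
  have h2 := invDist_pos δ z
  rw [bilapWeight_apply]
  set i := invDist δ z
  have h3 : 1 ≤ 2 * (δ * i) ^ 2 := by
    have : ‖z‖ ^ 2 ≤ δ ^ 2 := by gcongr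
    nlinarith [sq_nonneg i]
  have h4 : 1 / 2 ≤ δ * i := by
    have : 0 < δ * i := by positivity
    nlinarith
  have h5 : 1 / 8 ≤ ((δ * i) ^ 2) ^ 3 := by
    have h6 : 1 / 2 ≤ (δ * i) ^ 2 := by linarith
    calc (1 / 8 : ℝ) = (1 / 2) ^ 3 := by norm_num
      _ ≤ _ := by gcongr
  have h7 : 1 / 16 ≤ (δ * i) * ((δ * i) ^ 2) ^ 3 := by
    calc (1 / 16 : ℝ) = 1 / 2 * (1 / 8) := by norm_num
      _ ≤ _ := by gcongr
  have hpi := Real.pi_gt_three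
  rw [inv_le_iff_one_le_mul₀ (by positivity)]
  have h8 : 15 * δ ^ 4 * i ^ 7 * (δ ^ 3 * Real.pi * 4 / 3) =
      20 * Real.pi * ((δ * i) * ((δ * i) ^ 2) ^ 3) := by ring
  rw [h8]
  calc (1 : ℝ) ≤ 20 * 3 * (1 / 16) := by norm_num
    _ ≤ _ := by gcongr

theorem average_le_potential (δ : ℝ) [hδ : Fact (0 < δ)] {p : Lp (α := Space3) ℝ 1 volume}
    (hp : ∀ᵐ x, 0 ≤ p x) (y : Space3) :
    ⨍ x in Metric.closedBall y δ, p x ≤ potential (bilapWeight δ) y p := by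
  have hi := L1.integrable_coeFn p
  have hδ0 := hδ.out
  have hvol : (volume : Measure Space3).real (Metric.closedBall y δ) = δ ^ 3 * Real.pi * 4 / 3 := by
    rw [measureReal_def, EuclideanSpace.volume_closedBall_fin_three, ENNReal.toReal_mul,
      ENNReal.toReal_pow, ENNReal.toReal_ofReal hδ0.le, ENNReal.toReal_ofReal (by positivity)]
    ring
  rw [setAverage_eq, hvol, smul_eq_mul, ← integral_const_mul,
    ← integral_indicator Metric.isClosed_closedBall.measurableSet, potential_apply]
  refine integral_mono_ae ((hi.const_mul _).indicator Metric.isClosed_closedBall.measurableSet)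
    (integrable_bcf_mul (W := (bilapWeight δ).translate y) hi) ?_
  filter_upwards [hp] with x hx
  by_cases h : x ∈ Metric.closedBall y δ
  · rw [indicator_of_mem h]
    refine mul_le_mul_of_nonneg_right (bilapWeight_ge δ ?_) hx
    rwa [← dist_eq_norm]
  · rw [indicator_of_notMem h]
    refine mul_nonneg ?_ hx
    rw [bilapWeight_apply]
    have := invDist_pos δ (x - y)
    positivity

theorem lintegral_sq_le_liminf_convForm {p : Lp (α := Space3) ℝ 1 volume} (hp : ∀ᵐ x, 0 ≤ p x) :
    ∫⁻ x, ENNReal.ofReal (p x * p x) ≤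
      Filter.liminf (fun n : ℕ => ENNReal.ofReal (convForm (bilapWeight ((n + 1 : ℝ)⁻¹)) p p))
        Filter.atTop := by
  have hi := L1.integrable_coeFn p
  have hpot : ∀ (n : ℕ) y, 0 ≤ potential (bilapWeight ((n + 1 : ℝ)⁻¹)) y p := fun n y =>
    potential_nonneg (fun z => by
      rw [bilapWeight_apply]
      have := invDist_pos ((n + 1 : ℝ)⁻¹) z
      positivity) y hp
  have e : ∀ n : ℕ, ENNReal.ofReal (convForm (bilapWeight ((n + 1 : ℝ)⁻¹)) p p) =
      ∫⁻ y, ENNReal.ofReal (p y * potential (bilapWeight ((n + 1 : ℝ)⁻¹)) y p) := by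
    intro n
    rw [convForm_apply]
    refine ofReal_integral_eq_lintegral_ofReal (integrable_mul_potential _ p p) ?_
    filter_upwards [hp] with y hy
    exact mul_nonneg hy (hpot n y)
  have hδ : Filter.Tendsto (fun n : ℕ => (n + 1 : ℝ)⁻¹) Filter.atTop (𝓝[>] 0) := by
    refine tendsto_nhdsWithin_iff.2 ⟨?_, Filter.Eventually.of_forall fun n => ?_⟩
    · simpa using tendsto_one_div_add_atTop_nhds_zero_nat (𝕜 := ℝ)
    · exact mem_Ioi.2 (by positivity)
  simp only [e]
  refine le_trans (lintegral_mono_ae ?_) (lintegral_liminf_le' fun n =>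
    (integrable_mul_potential _ p p).aestronglyMeasurable.aemeasurable.ennreal_ofReal)
  filter_upwards [hp, IsUnifLocDoublingMeasure.ae_tendsto_average
    (μ := (volume : Measure Space3)) hi.locallyIntegrable 1] with y hy hav
  have h1 := hav (fun _ : ℕ => y) (fun n => (n + 1 : ℝ)⁻¹) hδ
    (Filter.Eventually.of_forall fun n => Metric.mem_closedBall_self (by positivity))
  have h2 := (ENNReal.continuous_ofReal.tendsto _).comp (h1.const_mul (p y))
  refine h2.liminf_eq.symm.le.trans (Filter.liminf_le_liminf
    (Filter.Eventually.of_forall fun n => ?_))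
  exact ENNReal.ofReal_le_ofReal (mul_le_mul_of_nonneg_left (average_le_potential _ hp y) hy)

/-! ### Space-time norms -/

theorem forall_mem_Icc_of_ae {X : Type*} [TopologicalSpace X] {T : ℝ} (hT : 0 < T) {w : ℝ → X}
    (hw : ContinuousOn w (Icc 0 T)) {S : Set X} (hS : IsClosed S)
    (h : ∀ᵐ t ∂(volume.restrict (Icc 0 T)), w t ∈ S) : ∀ t ∈ Icc 0 T, w t ∈ S := by
  have hU := (hw.mono Ioo_subset_Icc_self).isOpen_inter_preimage isOpen_Ioo hS.isOpen_compl
  have h0 : volume (Ioo 0 T ∩ w ⁻¹' Sᶜ) = 0 := by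
    rw [ae_restrict_iff' measurableSet_Icc] at h
    refine measure_mono_null (fun t ht => ?_) h
    exact fun hc => ht.2 (hc (Ioo_subset_Icc_self ht.1))
  have h1 := (hU.measure_eq_zero_iff volume).1 h0
  have h2 : ∀ t ∈ Ioo 0 T, w t ∈ S := fun t ht => by
    by_contra hc
    exact (Set.eq_empty_iff_forall_notMem.1 h1 t) ⟨ht, hc⟩
  intro t ht
  have h3 : t ∈ closure (Ioo 0 T) := by rwa [closure_Ioo hT.ne]
  have h4 : w t ∈ closure (w '' Ioo 0 T) :=
    (hw t ht).mono Ioo_subset_Icc_self |>.mem_closure_image h3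
  exact hS.closure_subset_iff.2 (by rintro _ ⟨s, hs, rfl⟩; exact h2 s hs) h4

theorem ae_le_timeNorm_top (T : ℝ) (g : ℝ → ℝ≥0∞) :
    ∀ᵐ t ∂(volume.restrict (Icc 0 T)), g t ≤ timeNorm ∞ T g := by
  have h := ae_le_eLpNormEssSup (f := g) (μ := volume.restrict (Icc 0 T))
  simpa [timeNorm, eLpNorm_exponent_top] using h

theorem timeNorm_pow {n : ℕ} (hn : n ≠ 0) (T : ℝ) (g : ℝ → ℝ≥0∞) :
    timeNorm n T g ^ n = ∫⁻ t in Icc 0 T, g t ^ n := by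
  have hn' : (n : ℝ) ≠ 0 := by exact_mod_cast hn
  rw [timeNorm, eLpNorm_eq_lintegral_rpow_enorm_toReal (by exact_mod_cast hn) (by simp),
    ← ENNReal.rpow_natCast, ← ENNReal.rpow_mul, ENNReal.toReal_natCast, one_div,
    inv_mul_cancel₀ hn', ENNReal.rpow_one]
  simp

theorem timeNorm_mono_top (T : ℝ) {g : ℝ → ℝ≥0∞} {K : ℝ≥0∞} (h : ∀ t ∈ Icc 0 T, g t ≤ K) :
    timeNorm ∞ T g ≤ K := by
  rw [timeNorm, eLpNorm_exponent_top]
  refine eLpNormEssSup_le_of_ae_enorm_bound ?_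
  rw [ae_restrict_iff' measurableSet_Icc]
  exact Filter.Eventually.of_forall fun t ht => by simpa using h t ht

theorem eLpNorm_four_pow (f : L2Space) :
    eLpNorm f 4 volume ^ 4 = ∫⁻ x, ENNReal.ofReal (‖f x‖ ^ 4) := by
  have h : eLpNorm f 4 volume ^ ((4 : ℕ) : ℝ) = ∫⁻ x, ‖f x‖ₑ ^ ((4 : ℕ) : ℝ) := by
    rw [eLpNorm_eq_lintegral_rpow_enorm_toReal (by norm_num) (by norm_num), ← ENNReal.rpow_mul]
    norm_num
  simp only [ENNReal.rpow_natCast] at h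
  rw [h]
  refine lintegral_congr fun x => ?_
  rw [ENNReal.ofReal_pow (norm_nonneg _), ofReal_norm]

theorem integral_quartic (f : L2Space) :
    ∫ x, ‖f x‖ ^ 4 = (eLpNorm f 4 volume ^ 4).toReal := by
  rw [eLpNorm_four_pow]
  exact integral_eq_lintegral_of_nonneg_ae (Filter.Eventually.of_forall fun x => by positivity)
    ((Lp.aestronglyMeasurable f).norm.pow 4)

theorem aemeasurable_eLpNorm (r : ℝ≥0∞) {u : ℝ → L2Space} {T : ℝ}
    (hu : ContinuousOn u (Icc 0 T)) :
    AEMeasurable (fun t => eLpNorm (u t) r volume) (volume.restrict (Icc 0 T)) := by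
  borelize L2Space
  have h1 : Measurable fun f : L2Space => eLpNorm f r volume :=
    (lowerSemicontinuous_eLpNorm r).measurable
  exact h1.comp_aemeasurable (hu.aemeasurable measurableSet_Icc)

theorem ofReal_integral_toReal {μ : Measure ℝ} {a : ℝ → ℝ≥0∞} (ha : AEMeasurable a μ)
    (hfin : ∫⁻ t, a t ∂μ ≠ ∞) :
    Integrable (fun t => (a t).toReal) μ ∧ ENNReal.ofReal (∫ t, (a t).toReal ∂μ) = ∫⁻ t, a t ∂μ := by
  refine ⟨integrable_toReal_of_lintegral_ne_top ha hfin, ?_⟩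
  rw [integral_toReal ha (ae_lt_top' ha hfin), ENNReal.ofReal_toReal hfin]

theorem lintegral_innerL1_self_sq (f : L2Space) :
    ∫⁻ x, ENNReal.ofReal (innerL1 f f x * innerL1 f f x) = eLpNorm f 4 volume ^ 4 := by
  rw [eLpNorm_four_pow]
  refine lintegral_congr_ae ?_
  filter_upwards [coeFn_innerL1 f f] with x h
  rw [h, real_inner_self_eq_norm_sq]
  congr 1
  ring

/-! ### The estimate with finite norms -/

theorem morawetz_absorption {X a b : ℝ} :
    30 * (X * (5 * (a + b))) ≤ a ^ 2 / 8 + b ^ 2 + 50625 * X ^ 2 := by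
  nlinarith [sq_nonneg (a - 600 * X), sq_nonneg (b - 75 * X)]

section Estimate

variable {T A D W : ℝ} {v w : ℝ → L2Space} {Dw : ℝ → Fin 3 → L2Space}

theorem exists_nonlinearity {M : ℝ} {C : ℝ≥0} (hM : 0 ≤ M) (v w : ℝ → L2Space)
    (h6 : ∀ t ∈ Icc 0 T, eLpNorm (w t) 6 volume ≤ C * ENNReal.ofReal M) :
    ∃ N F : ℝ → L2Space, ∀ t ∈ Icc 0 T, eLpNorm (v t) ∞ volume < ∞ →
      (∀ᵐ x, N t x = ((‖w t x‖ ^ 2 : ℝ) : ℂ) * w t x) ∧ ‖N t‖ ≤ (C * M) ^ 3 ∧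
      (∀ᵐ x, (N t + F t) x = ((‖(v t + w t) x‖ ^ 2 : ℝ) : ℂ) * (v t + w t) x) ∧
      ‖F t‖ ≤ 5 * (eLpNorm (v t) ∞ volume).toReal *
        (√(∫ x, ‖w t x‖ ^ 4) + √(∫ x, ‖v t x‖ ^ 4)) := by
  have h : ∀ t, ∃ N F : L2Space, t ∈ Icc 0 T → eLpNorm (v t) ∞ volume < ∞ →
      (∀ᵐ x, N x = ((‖w t x‖ ^ 2 : ℝ) : ℂ) * w t x) ∧ ‖N‖ ≤ (C * M) ^ 3 ∧
      (∀ᵐ x, (N + F) x = ((‖(v t + w t) x‖ ^ 2 : ℝ) : ℂ) * (v t + w t) x) ∧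
      ‖F‖ ≤ 5 * (eLpNorm (v t) ∞ volume).toReal *
        (√(∫ x, ‖w t x‖ ^ 4) + √(∫ x, ‖v t x‖ ^ 4)) := by
    intro t
    by_cases ht : t ∈ Icc 0 T ∧ eLpNorm (v t) ∞ volume < ∞
    · obtain ⟨N, hN, nN⟩ := exists_cubic hM (h6 t ht.1)
      have hv : ∀ᵐ x, ‖v t x‖ ≤ (eLpNorm (v t) ∞ volume).toReal := by
        filter_upwards [ae_le_eLpNormEssSup (f := v t) (μ := volume)] with x hx
        rw [← toReal_enorm]
        rw [← eLpNorm_exponent_top] at hx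
        exact ENNReal.toReal_mono ht.2.ne hx
      obtain ⟨F, hF, nF⟩ := exists_cubic_sub hN ENNReal.toReal_nonneg hv
      exact ⟨N, F, fun _ _ => ⟨hN, nN, hF, nF⟩⟩
    · exact ⟨0, 0, fun h1 h2 => absurd ⟨h1, h2⟩ ht⟩
  choose N F hNF using h
  exact ⟨N, F, hNF⟩

theorem morawetzDeriv_nonlinearity_ge (δ : ℝ) [hδ : Fact (0 < δ)] {f N F : L2Space}
    {Df : Fin 3 → L2Space} (hf : IsGradient f Df) (hA : ‖f‖ ≤ A) (hD : ∀ j, ‖Df j‖ ≤ D)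
    (hN : ∀ᵐ x, N x = ((‖f x‖ ^ 2 : ℝ) : ℂ) * f x) {β l m : ℝ} (hl : 0 ≤ l) (hm : 0 ≤ m)
    (hF : ‖F‖ ≤ 5 * β * (√l + √m)) :
    -(l / 8 + m + 50625 * (A ^ 2 * D * β) ^ 2) ≤
      morawetzDeriv δ f Df (-(Complex.I • (N + F))) := by
  have hD0 : 0 ≤ D := (norm_nonneg _).trans (hD 0)
  have h1 := morawetzDeriv_cubic_nonneg δ hf hN
  have h2 := abs_morawetzDeriv_le δ hf hD (-(Complex.I • F))
  rw [norm_neg, norm_I_smul] at h2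
  have e : morawetzDeriv δ f Df (-(Complex.I • (N + F))) =
      morawetzDeriv δ f Df (-(Complex.I • N)) + morawetzDeriv δ f Df (-(Complex.I • F)) := by
    rw [← morawetzDeriv_add, smul_add, neg_add]
  have h3 : 30 * (‖f‖ ^ 2 * D * ‖F‖) ≤ 30 * (A ^ 2 * D * β * (5 * (√l + √m))) := by
    calc _ ≤ 30 * (A ^ 2 * D * (5 * β * (√l + √m))) := by gcongr
      _ = _ := by ring
  have h4 := morawetz_absorption (X := A ^ 2 * D * β) (a := √l) (b := √m)
  rw [Real.sq_sqrt hl, Real.sq_sqrt hm] at h4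
  rw [e]
  linarith [(abs_le.1 h2).1]

theorem eLpNorm_four_pow_le_of_cubic {f N : L2Space}
    (hN : ∀ᵐ x, N x = ((‖f x‖ ^ 2 : ℝ) : ℂ) * f x) :
    eLpNorm f 4 volume ^ 4 ≤ ENNReal.ofReal (‖f‖ ^ 2 + ‖N‖ ^ 2) := by
  obtain ⟨h1, h2⟩ := integrable_quartic_of_cubic hN
  rw [eLpNorm_four_pow, ← ofReal_integral_eq_lintegral_ofReal h1
    (Filter.Eventually.of_forall fun x => by positivity)]
  exact ENNReal.ofReal_le_ofReal h2

theorem lintegral_quartic_lt_top (hA : ∀ t ∈ Icc 0 T, ‖w t‖ ≤ A) {M : ℝ} {C : ℝ≥0} (hM : 0 ≤ M)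
    (h6 : ∀ t ∈ Icc 0 T, eLpNorm (w t) 6 volume ≤ C * ENNReal.ofReal M) :
    ∫⁻ t in Icc 0 T, eLpNorm (w t) 4 volume ^ 4 < ∞ := by
  have h : ∀ t ∈ Icc 0 T, eLpNorm (w t) 4 volume ^ 4 ≤
      ENNReal.ofReal (A ^ 2 + ((C * M) ^ 3) ^ 2) := by
    intro t ht
    obtain ⟨N, hN, nN⟩ := exists_cubic hM (h6 t ht)
    refine (eLpNorm_four_pow_le_of_cubic hN).trans (ENNReal.ofReal_le_ofReal ?_)
    have := hA t ht
    gcongr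
  refine (setLIntegral_mono' measurableSet_Icc h).trans_lt ?_
  rw [setLIntegral_const]
  exact ENNReal.mul_lt_top ENNReal.ofReal_lt_top (by simp)

theorem quartic_le_of_morawetz {L R : ℝ} {J : ℕ → ℝ → ℝ} {a : ℝ → ℝ≥0∞}
    (hL : ENNReal.ofReal L = ∫⁻ t in Ioc 0 T, a t)
    (hJ0 : ∀ n t, 0 ≤ J n t) (hJ : ∀ n, IntegrableOn (J n) (Ioc 0 T))
    (haJ : ∀ t, a t ≤ Filter.liminf (fun n => ENNReal.ofReal (J n t)) Filter.atTop)
    (hR : ∀ n, ∫ t in Ioc 0 T, J n t ≤ R) : L ≤ max R 0 := by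
  have h1 : ENNReal.ofReal L ≤ ENNReal.ofReal R := by
    rw [hL]
    refine (lintegral_mono fun t => haJ t).trans ((lintegral_liminf_le' fun n =>
      (hJ n).1.aemeasurable.ennreal_ofReal).trans ?_)
    refine Filter.liminf_le_of_frequently_le' (Filter.Frequently.of_forall fun n => ?_)
    rw [← ofReal_integral_eq_lintegral_ofReal (hJ n) (Filter.Eventually.of_forall (hJ0 n))]
    exact ENNReal.ofReal_le_ofReal (hR n)
  rcases le_or_gt R 0 with h | h
  · rw [ENNReal.ofReal_of_nonpos h, nonpos_iff_eq_zero, ENNReal.ofReal_eq_zero] at h1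
    exact h1.trans (le_max_right _ _)
  · exact ((ENNReal.ofReal_le_ofReal_iff h.le).1 h1).trans (le_max_left _ _)

theorem integral_div_add_add {μ : Measure ℝ} {a b c : ℝ → ℝ} {K : ℝ} (ha : Integrable a μ)
    (hb : Integrable b μ) (hc : Integrable c μ) :
    ∫ t, (a t / 8 + b t + K * c t) ∂μ = (∫ t, a t ∂μ) / 8 + (∫ t, b t ∂μ) + K * ∫ t, c t ∂μ := by
  have h1 := integral_add ((ha.div_const 8).add hb) (hc.const_mul K)
  have h2 := integral_add (ha.div_const 8) hb
  rw [integral_div] at h2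
  rw [integral_const_mul] at h1
  simp only [Pi.add_apply] at h1
  rw [h1, h2]

theorem lintegral_quartic_le (hT : 0 < T) (hw : ContinuousOn w (Icc 0 T))
    (hDw : ContinuousOn Dw (Icc 0 T)) (hgrad : ∀ t ∈ Icc 0 T, IsGradient (w t) (Dw t))
    (hA : ∀ t ∈ Icc 0 T, ‖w t‖ ≤ A) (hD : ∀ t ∈ Icc 0 T, ∀ j, ‖Dw t j‖ ≤ D) (hW0 : 0 ≤ W)
    (hW : ∀ t ∈ Icc 0 T, homSobolevNorm (1 / 2) (w t) ≤ ENNReal.ofReal W) (hv : Continuous v)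
    (hB : ∫⁻ t in Icc 0 T, eLpNorm (v t) ∞ volume ^ 2 ≠ ∞)
    (hV : ∫⁻ t in Icc 0 T, eLpNorm (v t) 4 volume ^ 4 ≠ ∞)
    (heq : ∀ φ : 𝓢(Space3, ℂ), ∀ t ∈ Icc 0 T,
      Complex.I * ((∫ x, w t x * φ x) - ∫ x, w 0 x * φ x) +
        ∫ s in (0 : ℝ)..t, ∫ x, w s x * (Δ φ) x =
      ∫ s in (0 : ℝ)..t, ∫ x, ((‖(v s + w s) x‖ ^ 2 : ℝ) : ℂ) * (v s + w s) x * φ x) :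
    ∫⁻ t in Icc 0 T, eLpNorm (w t) 4 volume ^ 4 ≤ ENNReal.ofReal 135000 *
      (ENNReal.ofReal (A ^ 2 * W ^ 2) +
        ENNReal.ofReal (D ^ 2 * A ^ 4) * (∫⁻ t in Icc 0 T, eLpNorm (v t) ∞ volume ^ 2) +
        ∫⁻ t in Icc 0 T, eLpNorm (v t) 4 volume ^ 4) := by
  have h0' : (0 : ℝ) ∈ Icc 0 T := ⟨le_rfl, hT.le⟩
  have hT' : T ∈ Icc 0 T := ⟨hT.le, le_rfl⟩
  have hA0 : 0 ≤ A := (norm_nonneg _).trans (hA 0 h0')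
  have hD0 : 0 ≤ D := (norm_nonneg _).trans (hD 0 h0' 0)
  have hμ : volume.restrict (Icc 0 T) = volume.restrict (Ioc 0 T) :=
    Measure.restrict_congr_set Ioc_ae_eq_Icc.symm
  obtain ⟨C, hC⟩ := exists_eLpNorm_six_le
  have hM : 0 ≤ A + ∑ _j : Fin 3, D := by positivity
  have h6 : ∀ t ∈ Icc 0 T,
      eLpNorm (w t) 6 volume ≤ C * ENNReal.ofReal (A + ∑ _j : Fin 3, D) := fun t ht =>
    (hC (hgrad t ht)).trans (mul_le_mul_right (ENNReal.ofReal_le_ofReal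
      (add_le_add (hA t ht) (Finset.sum_le_sum fun j _ => hD t ht j))) _)
  obtain ⟨N, F, hNF⟩ := exists_nonlinearity hM v w h6
  have hfin := (lintegral_quartic_lt_top hA hM h6).ne
  have mB := (aemeasurable_eLpNorm ∞ (hv.continuousOn (s := Icc 0 T))).pow_const 2
  have mV := (aemeasurable_eLpNorm 4 (hv.continuousOn (s := Icc 0 T))).pow_const 4
  have mL := (aemeasurable_eLpNorm 4 hw).pow_const 4
  obtain ⟨iB, eB⟩ := ofReal_integral_toReal mB hB
  obtain ⟨iV, eV⟩ := ofReal_integral_toReal mV hV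
  obtain ⟨iL, eL⟩ := ofReal_integral_toReal mL hfin
  have hgood : ∀ᵐ t ∂(volume.restrict (Ioc 0 T)), t ∈ Icc 0 T ∧ eLpNorm (v t) ∞ volume < ∞ := by
    rw [← hμ]
    filter_upwards [ae_lt_top' mB hB, ae_restrict_mem measurableSet_Icc] with t h1 h2
    exact ⟨h2, by simpa using h1⟩
  rw [hμ] at iB iV iL eB eV eL ⊢
  set Br := ∫ t in Ioc 0 T, (eLpNorm (v t) ∞ volume ^ 2).toReal with hBr
  set Vr := ∫ t in Ioc 0 T, (eLpNorm (v t) 4 volume ^ 4).toReal with hVr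
  set Lr := ∫ t in Ioc 0 T, (eLpNorm (w t) 4 volume ^ 4).toReal with hLr
  have hBr0 : 0 ≤ Br := integral_nonneg fun t => ENNReal.toReal_nonneg
  have hVr0 : 0 ≤ Vr := integral_nonneg fun t => ENNReal.toReal_nonneg
  have mg : AEStronglyMeasurable (fun t => N t + F t) (volume.restrict (Ioc 0 T)) := by
    refine aestronglyMeasurable_of_tendsto_ae Filter.atTop
      (f := fun n t => truncCubicLp n (v t + w t)) (fun n => ?_) ?_
    · exact (((continuous_truncCubicLp n).comp_continuousOn (hv.continuousOn.add hw)).mono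
        Ioc_subset_Icc_self).aestronglyMeasurable measurableSet_Ioc
    · filter_upwards [hgood] with t ht
      exact tendsto_truncCubicLp (hNF t ht.1 ht.2).2.2.1
  have hg : IntegrableOn (fun t => N t + F t) (Ioc 0 T) := by
    have hb : IntegrableOn (fun t => (C * (A + ∑ _j : Fin 3, D)) ^ 3 +
        (5 * (eLpNorm (v t) ∞ volume ^ 2).toReal + 5 * (eLpNorm (w t) 4 volume ^ 4).toReal +
          5 * (eLpNorm (v t) 4 volume ^ 4).toReal)) (Ioc 0 T) :=
      (integrableOn_const (by simp)).add (((iB.const_mul 5).add (iL.const_mul 5)).add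
        (iV.const_mul 5))
    refine hb.mono' mg ?_
    filter_upwards [hgood] with t ht
    obtain ⟨-, h1, -, h2⟩ := hNF t ht.1 ht.2
    rw [integral_quartic, integral_quartic] at h2
    refine (norm_add_le _ _).trans (add_le_add h1 (h2.trans ?_))
    rw [ENNReal.toReal_pow (a := eLpNorm (v t) ∞ volume)]
    have h3 := Real.sq_sqrt (ENNReal.toReal_nonneg (a := eLpNorm (w t) 4 volume ^ 4))
    have h4 := Real.sq_sqrt (ENNReal.toReal_nonneg (a := eLpNorm (v t) 4 volume ^ 4))
    nlinarith [sq_nonneg ((eLpNorm (v t) ∞ volume).toReal - √(eLpNorm (w t) 4 volume ^ 4).toReal),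
      sq_nonneg ((eLpNorm (v t) ∞ volume).toReal - √(eLpNorm (v t) 4 volume ^ 4).toReal)]
  have heq' : ∀ φ : 𝓢(Space3, ℂ), ∀ t ∈ Icc 0 T,
      Complex.I * ((∫ x, w t x * φ x) - ∫ x, w 0 x * φ x) +
        ∫ s in (0 : ℝ)..t, ∫ x, w s x * (Δ φ) x =
      ∫ s in (0 : ℝ)..t, ∫ x, (N s + F s) x * φ x := by
    intro φ t ht
    rw [heq φ t ht, intervalIntegral.integral_of_le ht.1, intervalIntegral.integral_of_le ht.1]
    refine integral_congr_ae (ae_mono (Measure.restrict_mono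
      (Ioc_subset_Ioc_right ht.2) le_rfl) ?_)
    filter_upwards [hgood] with s hs
    refine integral_congr_ae ?_
    filter_upwards [(hNF s hs.1 hs.2).2.2.1] with x hx
    rw [hx]
  have hm : ∀ n : ℕ, ∀ t ∈ Icc 0 T,
      |morawetzAction ((n + 1 : ℝ)⁻¹) (w t) (Dw t)| ≤ 72 * W ^ 2 * A ^ 2 := fun n t ht =>
    (abs_morawetzAction_le_homSobolevNorm _ (hgrad t ht) hW0 (hW t ht)).trans (by
      have := hA t ht
      gcongr)
  let J : ℕ → ℝ → ℝ := fun n t =>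
    convForm (bilapWeight ((n + 1 : ℝ)⁻¹)) (innerL1 (w t) (w t)) (innerL1 (w t) (w t))
  have iJ : ∀ n, IntegrableOn (J n) (Ioc 0 T) := fun n =>
    ((continuous_convForm_bilapWeight ((n + 1 : ℝ)⁻¹)).comp_continuousOn hw).integrableOn_Icc.mono_set
      Ioc_subset_Icc_self
  have hJ : ∀ n, ∫ t in Ioc 0 T, J n t ≤
      288 * W ^ 2 * A ^ 2 + (Lr / 4 + 2 * Vr + 101250 * (A ^ 4 * D ^ 2 * Br)) := by
    intro n
    obtain ⟨i1, h1⟩ := interaction_morawetz ((n + 1 : ℝ)⁻¹) hT.le hw hDw hgrad hg heq'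
    have i2 : IntegrableOn (fun t => (eLpNorm (w t) 4 volume ^ 4).toReal / 8 +
        (eLpNorm (v t) 4 volume ^ 4).toReal +
        50625 * (A ^ 4 * D ^ 2) * (eLpNorm (v t) ∞ volume ^ 2).toReal) (Ioc 0 T) :=
      ((iL.div_const 8).add iV).add (iB.const_mul _)
    have i3 : IntegrableOn (fun t => 1 / 2 * J n t) (Ioc 0 T) := (iJ n).const_mul _
    have h2 : ∫ t in Ioc 0 T, (1 / 2 * J n t - ((eLpNorm (w t) 4 volume ^ 4).toReal / 8 +
        (eLpNorm (v t) 4 volume ^ 4).toReal +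
        50625 * (A ^ 4 * D ^ 2) * (eLpNorm (v t) ∞ volume ^ 2).toReal)) ≤
        144 * W ^ 2 * A ^ 2 := by
      refine (integral_mono_ae (i3.sub i2) i1 ?_).trans (h1.trans ?_)
      · filter_upwards [hgood] with t ht
        obtain ⟨k1, -, -, k2⟩ := hNF t ht.1 ht.2
        have k3 := morawetzDeriv_nonlinearity_ge ((n + 1 : ℝ)⁻¹) (hgrad t ht.1) (hA t ht.1)
          (hD t ht.1) k1 (integral_nonneg fun x => by positivity)
          (integral_nonneg fun x => by positivity) k2
        rw [integral_quartic, integral_quartic] at k3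
        have k4 : (eLpNorm (v t) ∞ volume ^ 2).toReal = (eLpNorm (v t) ∞ volume).toReal ^ 2 :=
          ENNReal.toReal_pow _ _
        simp only [Pi.sub_apply, J, k4]
        linarith
      · have k1 := abs_le.1 (hm n T hT')
        have k2 := abs_le.1 (hm n 0 h0')
        linarith [k1.2, k2.1]
    rw [integral_sub i3 i2, integral_const_mul, integral_div_add_add iL iV iB] at h2
    linarith
  have hfinal := quartic_le_of_morawetz (T := T) eL
    (fun n t => convForm_bilapWeight_nonneg ((n + 1 : ℝ)⁻¹) (w t)) iJ (fun t => by
      rw [← lintegral_innerL1_self_sq]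
      exact lintegral_sq_le_liminf_convForm (innerL1_self_nonneg (w t))) hJ
  have hLr0 : 0 ≤ Lr := integral_nonneg fun t => ENNReal.toReal_nonneg
  have p1 : 0 ≤ A ^ 4 * D ^ 2 * Br := by positivity
  have p2 : 0 ≤ W ^ 2 * A ^ 2 := by positivity
  rw [max_eq_left (by linarith)] at hfinal
  rw [← eL, ← eB, ← eV, ← ENNReal.ofReal_mul (by positivity),
    ← ENNReal.ofReal_add (by positivity) (by positivity),
    ← ENNReal.ofReal_add (by positivity) hVr0, ← ENNReal.ofReal_mul (by positivity)]
  refine ENNReal.ofReal_le_ofReal ?_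
  linarith

end Estimate

/-! ### Bounds from the norms on the time interval -/

theorem IsGradient.gradNorm_eq {f : L2Space} {g : Fin 3 → L2Space} (h : IsGradient f g) :
    gradNorm f = (∑ j, ‖g j‖ₑ ^ 2) ^ (1 / 2 : ℝ) := by
  refine le_antisymm (iInf₂_le g h) (le_iInf₂ fun g' h' => ?_)
  rw [h.unique h']

theorem IsGradient.enorm_le_gradNorm {f : L2Space} {g : Fin 3 → L2Space} (h : IsGradient f g)
    (j : Fin 3) : ‖g j‖ₑ ≤ gradNorm f := by
  have h1 : ‖g j‖ₑ ^ 2 ≤ ∑ k, ‖g k‖ₑ ^ 2 :=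
    Finset.single_le_sum (f := fun k => ‖g k‖ₑ ^ 2) (fun _ _ => zero_le) (Finset.mem_univ j)
  rw [h.gradNorm_eq, one_div]
  refine (ENNReal.le_rpow_inv_iff two_pos).2 ?_
  exact_mod_cast h1

theorem IsGradient.gradNorm_le {f : L2Space} {g : Fin 3 → L2Space} (h : IsGradient f g)
    {D : ℝ≥0∞} (hD : ∀ j, ‖g j‖ₑ ≤ D) : gradNorm f ≤ (3 * D ^ 2) ^ (1 / 2 : ℝ) := by
  rw [h.gradNorm_eq]
  refine ENNReal.rpow_le_rpow ?_ (by norm_num)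
  refine (Finset.sum_le_sum fun j _ => pow_le_pow_left' (hD j) 2).trans ?_
  simp

theorem IsGradient.eq_zero {f : L2Space} {g : Fin 3 → L2Space} (h : IsGradient f g)
    (hg : ∀ j, g j = 0) : f = 0 := by
  rw [isGradient_iff_fourier] at h
  have hF : (𝓕 f : L2Space) = 0 := by
    refine (Lp.eq_zero_iff_ae_eq_zero (f := (𝓕 f : L2Space))).2 ?_
    have h0 : ∀ j, (𝓕 (g j) : L2Space) = 0 := fun j => by
      rw [hg j]; exact map_zero (FourierTransform.fourierCLM ℂ L2Space)
    have hz : ∀ᵐ ξ : Space3, ξ ≠ 0 := by simp [ae_iff]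
    filter_upwards [ae_all_iff.2 h, hz, Lp.coeFn_zero ℂ 2 (volume : Measure Space3)] with ξ h1 h2 h3
    by_contra hne
    refine h2 (PiLp.ext fun j => ?_)
    have h4 := h1 j
    rw [h0 j, h3] at h4
    have h5 : gradSymbol j ξ = 0 := (mul_eq_zero.1 h4.symm).resolve_right hne
    have h6 := norm_gradSymbol j ξ
    rw [h5, norm_zero, eq_comm] at h6
    simpa [Real.pi_ne_zero] using h6
  have := congrArg (fun u : L2Space => (𝓕⁻ u : L2Space)) hF
  simp only [FourierTransform.fourierInv_fourier_eq] at this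
  rw [this]
  exact map_zero (FourierTransform.fourierInvCLM ℂ L2Space)

theorem lowerSemicontinuous_homSobolevNorm {s : ℝ} (hs : 0 ≤ s) :
    LowerSemicontinuous (homSobolevNorm s) := by
  have hm : Continuous fun ξ : Space3 => (((2 * Real.pi * ‖ξ‖) ^ s : ℝ) : ℂ) :=
    Complex.continuous_ofReal.comp
      ((by fun_prop : Continuous fun ξ : Space3 => 2 * Real.pi * ‖ξ‖).rpow_const
        fun ξ => Or.inr hs)
  exact (lowerSemicontinuous_eLpNorm_mul hm.aestronglyMeasurable 2).comp
    (FourierTransform.fourierCLM ℂ L2Space).continuous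

theorem eLpNorm_two_eq_enorm (f : L2Space) : eLpNorm f 2 volume = ‖f‖ₑ := (Lp.enorm_def f).symm

theorem mixedNorm_top_two_lt_top {T : ℝ} {u : ℝ → L2Space} (hu : ContinuousOn u (Icc 0 T)) :
    mixedNorm ∞ 2 T u < ∞ := by
  obtain ⟨K, hK⟩ := isCompact_Icc.exists_bound_of_continuousOn hu
  refine (timeNorm_mono_top T (K := ENNReal.ofReal K) fun t ht => ?_).trans_lt
    ENNReal.ofReal_lt_top
  rw [eLpNorm_two_eq_enorm, ← ofReal_norm]
  exact ENNReal.ofReal_le_ofReal (hK t ht)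

theorem timeNorm_gradNorm_lt_top {T : ℝ} {w : ℝ → L2Space} {Dw : ℝ → Fin 3 → L2Space}
    (hDw : ContinuousOn Dw (Icc 0 T)) (hgrad : ∀ t ∈ Icc 0 T, IsGradient (w t) (Dw t)) :
    timeNorm ∞ T (fun t => gradNorm (w t)) < ∞ := by
  obtain ⟨K, hK⟩ := isCompact_Icc.exists_bound_of_continuousOn hDw
  refine (timeNorm_mono_top T fun t ht => (hgrad t ht).gradNorm_le (D := ENNReal.ofReal K)
    fun j => ?_).trans_lt ?_
  · rw [← ofReal_norm]
    exact ENNReal.ofReal_le_ofReal ((norm_le_pi_norm (Dw t) j).trans (hK t ht))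
  · exact ENNReal.rpow_lt_top_of_nonneg (by norm_num)
      (ENNReal.mul_ne_top (by simp) (ENNReal.pow_ne_top ENNReal.ofReal_ne_top))

theorem enorm_le_mixedNorm_top {T : ℝ} (hT : 0 < T) {u : ℝ → L2Space}
    (hu : ContinuousOn u (Icc 0 T)) : ∀ t ∈ Icc 0 T, ‖u t‖ₑ ≤ mixedNorm ∞ 2 T u := by
  refine forall_mem_Icc_of_ae hT hu (S := {f | ‖f‖ₑ ≤ mixedNorm ∞ 2 T u})
    (isClosed_le continuous_enorm continuous_const) ?_
  filter_upwards [ae_le_timeNorm_top T fun t => eLpNorm (u t) 2 volume] with t ht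
  rw [eLpNorm_two_eq_enorm] at ht
  exact ht

theorem enorm_le_timeNorm_gradNorm {T : ℝ} (hT : 0 < T) {w : ℝ → L2Space}
    {Dw : ℝ → Fin 3 → L2Space} (hDw : ContinuousOn Dw (Icc 0 T))
    (hgrad : ∀ t ∈ Icc 0 T, IsGradient (w t) (Dw t)) (j : Fin 3) :
    ∀ t ∈ Icc 0 T, ‖Dw t j‖ₑ ≤ timeNorm ∞ T (fun t => gradNorm (w t)) := by
  refine forall_mem_Icc_of_ae hT hDw
    (S := {g | ‖g j‖ₑ ≤ timeNorm ∞ T (fun t => gradNorm (w t))})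
    (isClosed_le (continuous_enorm.comp (continuous_apply j)) continuous_const) ?_
  filter_upwards [ae_le_timeNorm_top T fun t => gradNorm (w t),
    ae_restrict_mem measurableSet_Icc] with t ht hm
  exact ((hgrad t hm).enorm_le_gradNorm j).trans ht

theorem homSobolevNorm_le_timeNorm_top {T s : ℝ} (hT : 0 < T) (hs : 0 ≤ s) {w : ℝ → L2Space}
    (hw : ContinuousOn w (Icc 0 T)) : ∀ t ∈ Icc 0 T,
      homSobolevNorm s (w t) ≤ timeNorm ∞ T (fun t => homSobolevNorm s (w t)) :=
  forall_mem_Icc_of_ae hT hw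
    (S := {f | homSobolevNorm s f ≤ timeNorm ∞ T (fun t => homSobolevNorm s (w t))})
    ((lowerSemicontinuous_homSobolevNorm hs).isClosed_preimage _) (ae_le_timeNorm_top T _)

theorem mixedNorm_pow {n : ℕ} (hn : n ≠ 0) (r : ℝ≥0∞) (T : ℝ) (u : ℝ → L2Space) :
    mixedNorm n r T u ^ n = ∫⁻ t in Icc 0 T, eLpNorm (u t) r volume ^ n :=
  timeNorm_pow hn T _

theorem mixedNorm_four_eq_zero {T : ℝ} {w : ℝ → L2Space} (h : ∀ t ∈ Icc 0 T, w t = 0) :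
    mixedNorm 4 4 T w ^ 4 = 0 := by
  have := mixedNorm_pow (n := 4) (by norm_num) 4 T w
  rw [Nat.cast_ofNat] at this
  rw [this, setLIntegral_congr_fun (g := fun _ => 0) measurableSet_Icc fun t ht => ?_]
  · simp
  · simp only [h t ht]
    rw [eLpNorm_congr_ae (Lp.coeFn_zero ℂ 2 (volume : Measure Space3)), eLpNorm_zero]
    simp

end

theorem lemma5p2 :
    ∃ C : ℝ≥0, ∀ (T : ℝ) (v₀ w₀ : L2Space) (w : ℝ → L2Space), 0 < T →
      IsPerturbedNLSSolution T v₀ w₀ w →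
      mixedNorm 4 4 T w ^ 4 ≤
        C * (mixedNorm ∞ 2 T w ^ 2 * timeNorm ∞ T (fun t => homSobolevNorm (1 / 2) (w t)) ^ 2 +
          timeNorm ∞ T (fun t => gradNorm (w t)) ^ 2 * mixedNorm ∞ 2 T w ^ 4 *
            mixedNorm 2 ∞ T (fun t => freeSchrodinger t v₀) ^ 2 +
          mixedNorm 4 4 T (fun t => freeSchrodinger t v₀) ^ 4) := by
  refine ⟨135000, fun T v₀ w₀ w hT hsol => ?_⟩
  obtain ⟨hw, Dw, hDw, hgrad⟩ := hsol.continuous_H1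
  have hA := enorm_le_mixedNorm_top hT hw
  have hD := fun j => enorm_le_timeNorm_gradNorm hT hDw hgrad j
  have hW := homSobolevNorm_le_timeNorm_top hT (by norm_num : (0 : ℝ) ≤ 1 / 2) hw
  have hAt := (mixedNorm_top_two_lt_top hw).ne
  have hDt := (timeNorm_gradNorm_lt_top hDw hgrad).ne
  have hL := mixedNorm_pow (n := 4) (by norm_num) 4 T w
  have hV := mixedNorm_pow (n := 4) (by norm_num) 4 T fun t => freeSchrodinger t v₀
  have hB := mixedNorm_pow (n := 2) (by norm_num) ∞ T fun t => freeSchrodinger t v₀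
  rw [Nat.cast_ofNat] at hL hV hB
  have hzero : (∀ t ∈ Icc 0 T, w t = 0) → mixedNorm 4 4 T w ^ 4 = 0 := mixedNorm_four_eq_zero
  revert hA hD hW hAt hDt
  generalize mixedNorm ∞ 2 T w = A
  generalize timeNorm ∞ T (fun t => gradNorm (w t)) = D
  generalize timeNorm ∞ T (fun t => homSobolevNorm (1 / 2) (w t)) = W
  intro hA hD hW hAt hDt
  rcases eq_or_ne A 0 with rfl | hA0
  · rw [hzero fun t ht => enorm_eq_zero.1 (le_antisymm (hA t ht) (zero_le))]
    exact zero_le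
  rcases eq_or_ne D 0 with rfl | hD0
  · rw [hzero fun t ht => (hgrad t ht).eq_zero fun j =>
      enorm_eq_zero.1 (le_antisymm (hD j t ht) (zero_le))]
    exact zero_le
  rw [hL, hV, hB]
  by_cases hVt : ∫⁻ t in Icc 0 T, eLpNorm (freeSchrodinger t v₀) 4 volume ^ 4 = ∞
  · simp [hVt]
  by_cases hBt : ∫⁻ t in Icc 0 T, eLpNorm (freeSchrodinger t v₀) ∞ volume ^ 2 = ∞
  · rw [hBt]
    simp [ENNReal.mul_top, hA0, hD0]
  rcases eq_or_ne W ∞ with rfl | hWt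
  · simp [ENNReal.mul_top, hA0]
  have key := lintegral_quartic_le (A := A.toReal) (D := D.toReal) (W := W.toReal) hT hw hDw hgrad
    (fun t ht => by
      rw [← toReal_enorm]; exact ENNReal.toReal_mono hAt (hA t ht))
    (fun t ht j => by
      rw [← toReal_enorm]; exact ENNReal.toReal_mono hDt (hD j t ht))
    ENNReal.toReal_nonneg
    (fun t ht => by rw [ENNReal.ofReal_toReal hWt]; exact hW t ht)
    (continuous_freeSchrodinger v₀) hBt hVt
    (by rw [hsol.initial]; exact hsol.equation)
  rw [ENNReal.ofReal_mul (by positivity), ENNReal.ofReal_mul (by positivity),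
    ENNReal.ofReal_pow (by positivity), ENNReal.ofReal_pow (by positivity),
    ENNReal.ofReal_pow (by positivity), ENNReal.ofReal_pow (by positivity),
    ENNReal.ofReal_toReal hAt, ENNReal.ofReal_toReal hDt, ENNReal.ofReal_toReal hWt,
    ENNReal.ofReal_ofNat] at key
  exact key
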